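/- Let $X$ be a compact connected Riemann surface, and let $\phi$ be a non-zero holomorphic quadratic differential on $X$ all of whose zeros are simple. Let $D_\phi$ be the set of zeros of $\phi$, let $d_\phi$ be the distance on $X$ induced by the flat metric $|\phi|$ (the infimum of the lengths $\int|\phi(\dot\gamma)|^{1/2}dt$ of $C^1$ paths), and put $X_P(r)=\{Q\in X: d_\phi(P,Q)<r\}$ and $d_\phi(P,D_\phi)=\inf_{Q\in D_\phi}d_\phi(P,Q)$ (so $=\infty$ if $D_\phi=\emptyset$). A saddle connection of $\phi$ is a geodesic segment of $(X,d_\phi)$, that is, a locally length-minimizing path parametrized by arc length on $[0,L]$ with $L>0$, whose two (possibly equal) end points lie in $D_\phi$ and which has no other point in $D_\phi$; its length is $L$. Let the threshold $M(\phi)$ be the least length (defined as the infimum of the lengths) of the saddle connections. On $\mathbb C$ let $\phi_0=(3/2)^2 z\,(dz)^2$, let $d_{\phi_0}$ be the distance induced by $|\phi_0|$, and put $\mathcal U(r)=\{z\in\mathbb C: d_{\phi_0}(0,z)<r\}$ and $U(r)=\{z\in\mathbb C: |z|<r\}$, for $0\le r\le\infty$. Then $\mathcal U(r)=U(r^{2/3})$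 for all $r$, and the following hold. (1) Let $P\in D_\phi$. Then $M(\phi)>0$, and there is a holomorphic local coordinate $z_P$ around $P$, defined on some open neighbourhood of $P$, with $z_P(P)=0$ and $\phi=(3/2)^2z_P\,(dz_P)^2$ there. Let $z_P$ be any such coordinate. (1a) The germ of $z_P$ at $P$ extends to a holomorphic coordinate on $X_P(M(\phi)/2)$, again denoted $z_P$, with $\phi=(3/2)^2z_P\,(dz_P)^2$ on $X_P(M(\phi)/2)$; for every $0<\kappa\le M(\phi)/2$ the set $X_P(\kappa)$ is open and $z_P$ restricts to a biholomorphism of $X_P(\kappa)$ onto $\mathcal U(\kappa)$. (1b) The inverse $z_P^{-1}:\mathcal U(M(\phi)/2)\to X_P(M(\phi)/2)$ extends to a locally biholomorphic map $\psi_P:\mathcal U(M(\phi))\to X$ such that $\psi_P^*\phi=\phi_0$, $\psi_P^{-1}(D_\phi)=\{0\}$, and $\psi_P(\mathcal U(\kappa))\subset X_P(\kappa)$ for every $0<\kappa\le M(\phi)$. (2) Let $P\in X\setminus D_\phi$. Then $d_\phi(P,D_\phi)>0$, and there is a holomorphic local coordinate $z_P$ around $P$, defined on some open neighbourhood of $P$,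 with $z_P(P)=0$ and $\phi=(dz_P)^2$ there. For any such $z_P$, the germ of $z_P^{-1}$ at $0$ extends to a locally biholomorphic map $\psi_P:U(d_\phi(P,D_\phi))\to X$ such that $\psi_P^*\phi=(dz)^2$, $\psi_P^{-1}(D_\phi)=\emptyset$, and $\psi_P(U(\kappa))\subset X_P(\kappa)$ for every $0<\kappa\le d_\phi(P,D_\phi)$. -/

import Mathlib

open Set Filter Topology
open scoped Manifold ContDiff ENNReal

noncomputable section

/-- A holomorphic quadratic differential on a Riemann surface `X`, i.e. a holomorphic section of
the square of the canonical bundle: a quadratic form on each (complex, one-dimensional) tangent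
space such that, in every chart, it reads `f(z) dz ^ 2` with `f` holomorphic. -/
structure QuadraticDifferential (X : Type*) [TopologicalSpace X] [ChartedSpace ℂ X] where
  form : ∀ p : X, QuadraticForm ℂ (TangentSpace 𝓘(ℂ) p)
  holomorphic : ∀ e ∈ atlas ℂ X,
    DifferentiableOn ℂ
      (fun z : ℂ => form (e.symm z) (mfderiv 𝓘(ℂ) 𝓘(ℂ) e.symm z (1 : ℂ))) e.target

namespace QuadraticDifferential

variable {X : Type*} [TopologicalSpace X] [ChartedSpace ℂ X]

/-- The coefficient `f` of `φ = f(z) dz ^ 2` in the local coordinate `e`. -/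
def coeff (φ : QuadraticDifferential X) (e : OpenPartialHomeomorph X ℂ) (z : ℂ) : ℂ :=
  φ.form (e.symm z) (mfderiv 𝓘(ℂ) 𝓘(ℂ) e.symm z (1 : ℂ))

/-- The set of zeros of `φ`. -/
def zeros (φ : QuadraticDifferential X) : Set X := {p | φ.form p = 0}

/-- Every zero of `φ` is simple. -/
def HasSimpleZeros (φ : QuadraticDifferential X) : Prop :=
  ∀ p ∈ φ.zeros, analyticOrderAt (φ.coeff (chartAt ℂ p)) (chartAt ℂ p p) = 1

/-- The pull-back `f ^* φ` at the point `y`: it sends `v` to `φ (df v)`. -/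
def pullback {Y : Type*} [TopologicalSpace Y] [ChartedSpace ℂ Y]
    (φ : QuadraticDifferential X) (f : Y → X) (y : Y) :
    QuadraticForm ℂ (TangentSpace 𝓘(ℂ) y) :=
  (φ.form (f y)).comp (mfderiv 𝓘(ℂ) 𝓘(ℂ) f y).toLinearMap

/-- The length `|φ(v)| ^ (1 / 2)` of a tangent vector for the (singular) flat metric `|φ|`.
The real tangent space at `p` has the same underlying type as the complex one. -/
@[reducible] def tangentENorm (φ : QuadraticDifferential X) (p : X) :
    ENorm (TangentSpace 𝓘(ℝ, ℂ) p) where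
  enorm v := ENNReal.ofReal (Real.sqrt ‖φ.form p (v : TangentSpace 𝓘(ℂ) p)‖)

/-- The distance induced by the metric `|φ|`: the infimum of the `|φ|`-lengths of the `C ^ 1`
paths in `X` from `P` to `Q`. -/
def dist (φ : QuadraticDifferential X) (P Q : X) : ℝ≥0∞ :=
  @Manifold.riemannianEDist ℂ _ _ ℂ _ 𝓘(ℝ, ℂ) X _ _ φ.tangentENorm P Q

/-- The open ball of centre `P` and radius `r` for the distance induced by `|φ|`. -/
def ball (φ : QuadraticDifferential X) (P : X) (r : ℝ≥0∞) : Set X := {Q | φ.dist P Q < r}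

/-- The distance from `P` to the set of zeros (infinite if there are no zeros). -/
def distZeros (φ : QuadraticDifferential X) (P : X) : ℝ≥0∞ := ⨅ Q ∈ φ.zeros, φ.dist P Q

/-- `γ : [0, L] → X` is a geodesic segment of length `L > 0` for the distance induced by `|φ|`:
it is parametrized by arc length and locally length minimizing. -/
def IsGeodesicSegment (φ : QuadraticDifferential X) (γ : ℝ → X) (L : ℝ) : Prop :=
  0 < L ∧ ∀ t ∈ Icc 0 L, ∃ ε > 0, ∀ s ∈ Icc 0 L, ∀ s' ∈ Icc 0 L,
    |s - t| < ε → |s' - t| < ε → φ.dist (γ s) (γ s') = ENNReal.ofReal |s - s'|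

/-- `γ : [0, L] → X` is a saddle connection of length `L`. Its two ends may coincide. -/
def IsSaddleConnection (φ : QuadraticDifferential X) (γ : ℝ → X) (L : ℝ) : Prop :=
  φ.IsGeodesicSegment γ L ∧ γ 0 ∈ φ.zeros ∧ γ L ∈ φ.zeros ∧ ∀ t ∈ Ioo 0 L, γ t ∉ φ.zeros

/-- The threshold `M(φ)`: the least length of a saddle connection of `φ`. -/
def threshold (φ : QuadraticDifferential X) : ℝ≥0∞ :=
  ⨅ (γ : ℝ → X) (L : ℝ) (_ : φ.IsSaddleConnection γ L), ENNReal.ofReal L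

/-- The quadratic differential `f(z) dz ^ 2` on the complex plane, for an entire function `f`. -/
def ofEntire (f : ℂ → ℂ) (hf : Differentiable ℂ f) : QuadraticDifferential ℂ where
  form z := f z • (QuadraticMap.sq : QuadraticForm ℂ ℂ)
  holomorphic := by
    intro e he
    rw [chartedSpaceSelf_atlas] at he
    subst he
    refine (hf.differentiableOn).congr fun z _ => ?_
    have h : mfderiv 𝓘(ℂ) 𝓘(ℂ) ((OpenPartialHomeomorph.refl ℂ).symm : ℂ → ℂ) z
        = ContinuousLinearMap.id ℂ (TangentSpace 𝓘(ℂ) z) := mfderiv_id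
    rw [h]
    change f z * ((1 : ℂ) * 1) = f z
    ring

/-- The model `φ₀ = (3 / 2) ^ 2 z dz ^ 2` at a simple zero. -/
def modelZero : QuadraticDifferential ℂ :=
  ofEntire (fun z => (3 / 2) ^ 2 * z) (by fun_prop)

/-- The model `dz ^ 2` at a non-zero. -/
def modelFlat : QuadraticDifferential ℂ := ofEntire (fun _ => 1) (by fun_prop)

/-- The model domain: the open ball of radius `r` about `0` for the distance induced by `φ₀`
on the complex plane. -/
def modelDomain (r : ℝ≥0∞) : Set ℂ := modelZero.ball 0 r

/-- The disc `|z| < r` in the complex plane, where `r` may be infinite. -/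
def disc (r : ℝ≥0∞) : Set ℂ := {z | ‖z‖ₑ < r}

/-- `z` is a holomorphic local coordinate around `P` with `z(P) = 0` and `φ = z ^* φ'` on its
domain. For `φ' = φ₀` this says `φ = (3 / 2) ^ 2 z dz ^ 2`, for `φ' = dz ^ 2` it says
`φ = dz ^ 2`. -/
def IsCanonicalCoord (φ : QuadraticDifferential X) (φ' : QuadraticDifferential ℂ) (P : X)
    (z : OpenPartialHomeomorph X ℂ) : Prop :=
  z ∈ IsManifold.maximalAtlas 𝓘(ℂ) ω X ∧ P ∈ z.source ∧ z P = 0 ∧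
    ∀ Q ∈ z.source, φ.form Q = φ'.pullback z Q

end QuadraticDifferential

end

/-! Away from its zeros `φ` is locally `(dz)^2`, with `z` unique up to sign and translation. At a
simple zero it is locally `φ₀`, whose metric is a cone of angle `3π` with flat coordinate `z ^ (3 /
2)`. In both models the distance from the origin is `‖z‖ ^ p`, with `p = 1` or `p = 3 / 2`. The
theorem asks how far the local inverse `ψ` of such a coordinate (a developing map, `IsDev`) can be
continued, and how long it stays injective.

Continuation (`exists_isDev_disc`). Let `ψ` be defined on a disc of radius `R`. Radii have finite
length, so by compactness of `X` the map has a limit along each of them (`exists_radial_limit`). If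
no limit is a zero, uniqueness of flat coordinates extends `ψ` across every boundary point. The
extensions agree by the identity theorem, and compactness yields a larger disc. When `P` is not a
zero, a zero at the end of a radius is at distance at most `R` from `P`, so it cannot occur below
`d_φ(P, D_φ)`. When `P` is a zero, such a radius is a saddle connection of length `R ^ (3 / 2)`
(`threshold_le_of_radial_limit`), so it cannot occur below `M(φ)`.

Injectivity (`injOn_ball`). Otherwise choose distinct `w₁`, `w₂` with the same image and with the
larger modulus minimal. Minimality forces equal moduli, and forces the two radii to meet head-on in
a common flat coordinate. Together they form a saddle connection of length `2 ‖w₁‖ ^ (3 / 2)`, which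
is excluded below half the threshold.

Balls. The function `‖z‖ ^ (3 / 2)` contracts `|φ₀|`, so a path from `P` that is too short cannot
leave the coordinate (`mapsTo_source_of_pathLength_lt`). This identifies `X_P(κ)` with the model
domain.

Positivity of `M(φ)`. Along a geodesic in the coordinate of a zero, the squared distance to that
zero is a monic quadratic in arc length (`exists_quadratic_norm`). By strict convexity a geodesic
cannot return to the zero inside the coordinate, and there are finitely many zeros. -/

noncomputable section

/-! ### Derivatives as complex numbers, and the length and distance of `|φ|`. -/

section ComplexDerivative

variable {M N K : Type*} [TopologicalSpace M] [ChartedSpace ℂ M] [TopologicalSpace N]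
  [ChartedSpace ℂ N] [TopologicalSpace K] [ChartedSpace ℂ K]

/-- The derivative of a map of Riemann surfaces, as a complex number (the tangent spaces are
all identified with `ℂ`). -/
def complexDeriv (f : M → N) (x : M) : ℂ := mfderiv 𝓘(ℂ) 𝓘(ℂ) f x (1 : ℂ)

/-- The velocity of a curve in a Riemann surface, as a complex number. -/
def velocity (γ : ℝ → M) (t : ℝ) : ℂ := mfderiv 𝓘(ℝ) 𝓘(ℝ, ℂ) γ t (1 : ℝ)

theorem mfderiv_apply_eq (f : M → N) (x : M) (v : ℂ) :
    (mfderiv 𝓘(ℂ) 𝓘(ℂ) f x v : ℂ) = complexDeriv f x * v := by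
  have h := (mfderiv 𝓘(ℂ) 𝓘(ℂ) f x).map_smul v (1 : ℂ)
  have e : (v • (1 : ℂ) : ℂ) = v := by simp
  have h2 : (mfderiv 𝓘(ℂ) 𝓘(ℂ) f x v : ℂ) = v * complexDeriv f x := by
    rw [← e]
    refine h.trans ?_
    simp only [smul_eq_mul, mul_one]
    rfl
  rw [h2, mul_comm]

theorem complexDeriv_comp {g : N → K} {f : M → N} {x : M}
    (hg : MDifferentiableAt 𝓘(ℂ) 𝓘(ℂ) g (f x)) (hf : MDifferentiableAt 𝓘(ℂ) 𝓘(ℂ) f x) :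
    complexDeriv (g ∘ f) x = complexDeriv g (f x) * complexDeriv f x := by
  have h := mfderiv_comp x hg hf
  unfold complexDeriv at *
  rw [h]
  exact mfderiv_apply_eq g (f x) _

theorem complexDeriv_congr {f g : M → N} {x : M} (h : f =ᶠ[𝓝 x] g) :
    complexDeriv f x = complexDeriv g x := by
  have : (mfderiv 𝓘(ℂ) 𝓘(ℂ) f x : ℂ →L[ℂ] ℂ) = mfderiv 𝓘(ℂ) 𝓘(ℂ) g x := h.mfderiv_eq
  exact congrArg (fun L : ℂ →L[ℂ] ℂ => L 1) this

theorem complexDeriv_eq_deriv (f : ℂ → ℂ) (x : ℂ) : complexDeriv f x = deriv f x := by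
  have h : (mfderiv 𝓘(ℂ) 𝓘(ℂ) f x : ℂ →L[ℂ] ℂ) = fderiv ℂ f x := mfderiv_eq_fderiv
  exact (congrArg (fun L : ℂ →L[ℂ] ℂ => L 1) h).trans fderiv_apply_one_eq_deriv

theorem complexDeriv_id (x : M) : complexDeriv (fun y : M => y) x = 1 := by
  have : mfderiv 𝓘(ℂ) 𝓘(ℂ) (fun y : M => y) x = ContinuousLinearMap.id ℂ _ := mfderiv_id
  unfold complexDeriv
  rw [this]
  rfl

theorem ContMDiffWithinAt.restrictScalars_real {f : M → N} {s : Set M} {x : M}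
    (h : ContMDiffWithinAt 𝓘(ℂ) 𝓘(ℂ) ω f s x) :
    ContMDiffWithinAt 𝓘(ℝ, ℂ) 𝓘(ℝ, ℂ) 1 f s x := by
  rw [contMDiffWithinAt_iff] at h ⊢
  exact ⟨h.1, (h.2.restrict_scalars ℝ).of_le le_top⟩

theorem ContMDiffOn.restrictScalars_real {f : M → N} {s : Set M}
    (h : ContMDiffOn 𝓘(ℂ) 𝓘(ℂ) ω f s) : ContMDiffOn 𝓘(ℝ, ℂ) 𝓘(ℝ, ℂ) 1 f s :=
  fun x hx => (h x hx).restrictScalars_real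

/-- The chain rule for a holomorphic map along a real curve. -/
theorem velocity_comp {f : M → N} {γ : ℝ → M} {t : ℝ}
    (hf : MDifferentiableAt 𝓘(ℂ) 𝓘(ℂ) f (γ t))
    (hγ : MDifferentiableAt 𝓘(ℝ) 𝓘(ℝ, ℂ) γ t) :
    velocity (f ∘ γ) t = complexDeriv f (γ t) * velocity γ t := by
  let L : ℂ →L[ℂ] ℂ := mfderiv 𝓘(ℂ) 𝓘(ℂ) f (γ t)
  have h' := hf.hasMFDerivAt
  have h2 : HasMFDerivAt 𝓘(ℝ, ℂ) 𝓘(ℝ, ℂ) f (γ t) (L.restrictScalars ℝ) :=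
    ⟨h'.1, HasFDerivWithinAt.restrictScalars ℝ h'.2⟩
  have := (HasMFDerivAt.comp t h2 hγ.hasMFDerivAt).mfderiv
  unfold velocity
  rw [this]
  exact mfderiv_apply_eq f (γ t) _

theorem velocity_eq_deriv (γ : ℝ → ℂ) (t : ℝ) : velocity γ t = deriv γ t := by
  have h : (mfderiv 𝓘(ℝ) 𝓘(ℝ, ℂ) γ t : ℝ →L[ℝ] ℂ) = fderiv ℝ γ t := mfderiv_eq_fderiv
  exact (congrArg (fun L : ℝ →L[ℝ] ℂ => L 1) h).trans fderiv_apply_one_eq_deriv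

end ComplexDerivative

namespace QuadraticDifferential

variable {X : Type*} [TopologicalSpace X] [ChartedSpace ℂ X]

/-- The value of `φ` on the tangent vector `1`. -/
def val (φ : QuadraticDifferential X) (p : X) : ℂ := φ.form p (1 : ℂ)

theorem form_smul (φ : QuadraticDifferential X) (p : X) (c v : ℂ) :
    φ.form p (c * v : ℂ) = c ^ 2 * φ.form p v := by
  have := QuadraticMap.map_smul (φ.form p) c v
  rw [sq]
  exact this

theorem form_apply (φ : QuadraticDifferential X) (p : X) (v : ℂ) :
    φ.form p v = v ^ 2 * φ.val p := by
  have := form_smul φ p v 1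
  rwa [mul_one] at this

theorem mem_zeros_iff (φ : QuadraticDifferential X) (p : X) : p ∈ φ.zeros ↔ φ.val p = 0 := by
  constructor
  · intro h
    change φ.form p = 0 at h
    unfold val
    rw [h]
    rfl
  · intro h
    change φ.form p = 0
    ext v
    rw [form_apply φ p v, h, mul_zero]
    rfl

theorem pullback_apply {Y : Type*} [TopologicalSpace Y] [ChartedSpace ℂ Y]
    (φ : QuadraticDifferential X) (f : Y → X) (y : Y) (v : ℂ) :
    φ.pullback f y v = v ^ 2 * (complexDeriv f y ^ 2 * φ.val (f y)) := by
  change φ.form (f y) (mfderiv 𝓘(ℂ) 𝓘(ℂ) f y v) = _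
  rw [mfderiv_apply_eq, form_apply]
  ring

theorem pullback_eq_form_iff {Y : Type*} [TopologicalSpace Y] [ChartedSpace ℂ Y]
    (φ : QuadraticDifferential X) (φ' : QuadraticDifferential Y) (f : Y → X) (y : Y) :
    φ.pullback f y = φ'.form y ↔ complexDeriv f y ^ 2 * φ.val (f y) = φ'.val y := by
  constructor
  · intro h
    have := pullback_apply φ f y 1
    rw [h, one_pow, one_mul] at this
    exact this.symm
  · intro h
    ext v
    rw [pullback_apply φ f y v, form_apply φ' y v, h]

theorem val_ofEntire (f : ℂ → ℂ) (hf : Differentiable ℂ f) (z : ℂ) :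
    (ofEntire f hf).val z = f z := by
  change f z * ((1 : ℂ) * 1) = f z
  ring

@[simp] theorem val_modelZero (z : ℂ) : modelZero.val z = (3 / 2) ^ 2 * z := val_ofEntire _ _ z

@[simp] theorem val_modelFlat (z : ℂ) : modelFlat.val z = 1 := val_ofEntire _ _ z

theorem coeff_eq (φ : QuadraticDifferential X) (e : OpenPartialHomeomorph X ℂ) (z : ℂ) :
    φ.coeff e z = complexDeriv e.symm z ^ 2 * φ.val (e.symm z) := by
  unfold coeff
  exact form_apply φ _ _

/-- The length of the curve `γ` on `[a, b]` for the metric `|φ|`. -/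
def pathLength (φ : QuadraticDifferential X) (γ : ℝ → X) (a b : ℝ) : ℝ≥0∞ :=
  @Manifold.pathELength ℂ _ _ ℂ _ 𝓘(ℝ, ℂ) X _ _ φ.tangentENorm γ a b

theorem pathLength_eq (φ : QuadraticDifferential X) (γ : ℝ → X) (a b : ℝ) :
    φ.pathLength γ a b = ∫⁻ t in Icc a b, ENNReal.ofReal
      (‖velocity γ t‖ * Real.sqrt ‖φ.val (γ t)‖) := by
  unfold pathLength
  rw [Manifold.pathELength]
  refine MeasureTheory.lintegral_congr fun t => ?_
  change ENNReal.ofReal (Real.sqrt ‖φ.form (γ t) (velocity γ t)‖) = _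
  rw [form_apply, norm_mul, norm_pow, Real.sqrt_mul (by positivity), Real.sqrt_sq (norm_nonneg _)]

/-- Homogeneity under real scalars is what the general facts on `riemannianEDist` ask of the tangent
norms, so the degenerate norms at the zeros are allowed. -/
theorem enormSMulClass (φ : QuadraticDifferential X) (p : X) :
    @ENormSMulClass ℝ (TangentSpace 𝓘(ℝ, ℂ) p) _ (φ.tangentENorm p) _ := by
  let := φ.tangentENorm p
  refine ⟨fun r v => ?_⟩
  have key : ∀ w : ℂ, ENNReal.ofReal (Real.sqrt ‖φ.form p ((r : ℂ) * w : ℂ)‖) =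
    ‖r‖ₑ * ENNReal.ofReal (Real.sqrt ‖φ.form p w‖) := by
    intro w
    rw [form_smul, norm_mul, norm_pow, Real.sqrt_mul (by positivity),
      Real.sqrt_sq (norm_nonneg _), ENNReal.ofReal_mul (norm_nonneg _), ← ofReal_norm]
    simp
  refine Eq.trans ?_ (key v)
  rfl

theorem dist_le_pathLength (φ : QuadraticDifferential X) {γ : ℝ → X} {a b : ℝ} (hab : a ≤ b)
    (hγ : ContMDiffOn 𝓘(ℝ) 𝓘(ℝ, ℂ) 1 γ (Icc a b)) :
    φ.dist (γ a) (γ b) ≤ φ.pathLength γ a b :=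
  @Manifold.riemannianEDist_le_pathELength ℂ _ _ ℂ _ 𝓘(ℝ, ℂ) X _ _ φ.tangentENorm
    φ.enormSMulClass _ _ a b γ hγ rfl rfl hab

theorem exists_path_of_dist_lt (φ : QuadraticDifferential X) {x y : X} {r : ℝ≥0∞}
    (h : φ.dist x y < r) : ∃ γ : ℝ → X, γ 0 = x ∧ γ 1 = y ∧
      ContMDiffOn 𝓘(ℝ) 𝓘(ℝ, ℂ) 1 γ (Icc 0 1) ∧ φ.pathLength γ 0 1 < r :=
  @Manifold.exists_lt_of_riemannianEDist_lt ℂ _ _ ℂ _ 𝓘(ℝ, ℂ) X _ _ φ.tangentENorm x y r h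

theorem dist_self (φ : QuadraticDifferential X) (x : X) : φ.dist x x = 0 :=
  @Manifold.riemannianEDist_self ℂ _ _ ℂ _ 𝓘(ℝ, ℂ) X _ _ φ.tangentENorm φ.enormSMulClass x

theorem dist_comm (φ : QuadraticDifferential X) (x y : X) : φ.dist x y = φ.dist y x :=
  @Manifold.riemannianEDist_comm ℂ _ _ ℂ _ 𝓘(ℝ, ℂ) X _ _ φ.tangentENorm φ.enormSMulClass x y

theorem dist_triangle (φ : QuadraticDifferential X) (x y z : X) :
    φ.dist x z ≤ φ.dist x y + φ.dist y z :=
  @Manifold.riemannianEDist_triangle ℂ _ _ ℂ _ 𝓘(ℝ, ℂ) X _ _ φ.tangentENorm φ.enormSMulClass x y z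

end QuadraticDifferential

end

/-! ### Developing maps, with lower and upper bounds for distances. -/

noncomputable section

namespace QuadraticDifferential

variable {X : Type*} [TopologicalSpace X] [ChartedSpace ℂ X]
  {Y : Type*} [TopologicalSpace Y] [ChartedSpace ℂ Y]
  {W : Type*} [TopologicalSpace W] [ChartedSpace ℂ W]

/-- `f` is holomorphic on `U` and satisfies `f ^* φ = φ'` there. -/
structure IsDev (φ : QuadraticDifferential X) (φ' : QuadraticDifferential Y) (f : Y → X)
    (U : Set Y) : Prop where
  contMDiffOn : ContMDiffOn 𝓘(ℂ) 𝓘(ℂ) ω f U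
  val_eq : ∀ y ∈ U, complexDeriv f y ^ 2 * φ.val (f y) = φ'.val y

namespace IsDev

variable {φ : QuadraticDifferential X} {φ' : QuadraticDifferential Y}
  {φ'' : QuadraticDifferential W} {f f' : Y → X} {U U' : Set Y}

theorem mono (h : IsDev φ φ' f U) (hU : U' ⊆ U) : IsDev φ φ' f U' :=
  ⟨h.contMDiffOn.mono hU, fun y hy => h.val_eq y (hU hy)⟩

theorem contMDiffAt (h : IsDev φ φ' f U) (hU : IsOpen U) {y : Y} (hy : y ∈ U) :
    ContMDiffAt 𝓘(ℂ) 𝓘(ℂ) ω f y :=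
  h.contMDiffOn.contMDiffAt (hU.mem_nhds hy)

theorem mdifferentiableAt (h : IsDev φ φ' f U) (hU : IsOpen U) {y : Y} (hy : y ∈ U) :
    MDifferentiableAt 𝓘(ℂ) 𝓘(ℂ) f y :=
  (h.contMDiffAt hU hy).mdifferentiableAt (by simp)

theorem continuousOn (h : IsDev φ φ' f U) : ContinuousOn f U := h.contMDiffOn.continuousOn

theorem comp {g : W → Y} {V : Set W} (hf : IsDev φ φ' f U) (hg : IsDev φ' φ'' g V)
    (hU : IsOpen U) (hV : IsOpen V) (hm : MapsTo g V U) : IsDev φ φ'' (f ∘ g) V := by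
  refine ⟨hf.contMDiffOn.comp hg.contMDiffOn hm, fun y hy => ?_⟩
  rw [complexDeriv_comp (hf.mdifferentiableAt hU (hm hy)) (hg.mdifferentiableAt hV hy),
    mul_pow, ← hg.val_eq y hy, ← hf.val_eq _ (hm hy)]
  simp only [Function.comp_apply]
  ring

theorem congr (h : IsDev φ φ' f U) (hU : IsOpen U) (he : EqOn f' f U) : IsDev φ φ' f' U := by
  refine ⟨h.contMDiffOn.congr he, fun y hy => ?_⟩
  rw [complexDeriv_congr (he.eventuallyEq_of_mem (hU.mem_nhds hy)), he hy, h.val_eq y hy]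

theorem of_locally (h : ∀ y ∈ U, ∃ V, IsOpen V ∧ y ∈ V ∧ ∃ g, IsDev φ φ' g V ∧ EqOn f g V) :
    IsDev φ φ' f U := by
  have h' : ∀ y ∈ U, ∃ V, IsOpen V ∧ y ∈ V ∧ IsDev φ φ' f V := by
    intro y hy
    obtain ⟨V, hV, hyV, g, hg, he⟩ := h y hy
    exact ⟨V, hV, hyV, hg.congr hV he⟩
  refine ⟨fun y hy => ?_, fun y hy => ?_⟩
  · obtain ⟨V, hV, hyV, hd⟩ := h' y hy
    exact (hd.contMDiffAt hV hyV).contMDiffWithinAt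
  · obtain ⟨V, hV, hyV, hd⟩ := h' y hy
    exact hd.val_eq y hyV

end IsDev

/-- `h` is `C ^ 1` and infinitesimally contracts the metric `|φ'|`. -/
structure IsContraction {E : Type*} [NormedAddCommGroup E] [NormedSpace ℝ E]
    (φ' : QuadraticDifferential ℂ) (h : ℂ → E) : Prop where
  contDiff : ContDiff ℝ 1 h
  le : ∀ z v, ‖fderiv ℝ h z v‖ ≤ ‖v‖ * Real.sqrt ‖φ'.val z‖

section LowerBound

variable {E : Type*} [NormedAddCommGroup E] [NormedSpace ℝ E]
  {φ : QuadraticDifferential X} {φ' : QuadraticDifferential ℂ}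

/-- The speed of `h ∘ e ∘ γ` is at most the `|φ|`-speed of `γ`, because `e` pulls `φ'` back to `φ`
and `h` contracts `|φ'|`. Lower bounds on distances rest on this estimate. -/
theorem enorm_sub_le_pathLength {e : X → ℂ} {U : Set X} (hU : IsOpen U)
    (he : IsDev φ' φ e U) {h : ℂ → E} (hh : IsContraction φ' h) {γ : ℝ → X} {a b : ℝ}
    (hab : a ≤ b) (hγ : ContMDiffOn 𝓘(ℝ) 𝓘(ℝ, ℂ) 1 γ (Icc a b)) (hm : MapsTo γ (Icc a b) U) :
    ‖h (e (γ b)) - h (e (γ a))‖ₑ ≤ φ.pathLength γ a b := by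
  have h1 : ContDiffOn ℝ 1 (e ∘ γ) (Icc a b) :=
    ((he.contMDiffOn.restrictScalars_real).comp hγ hm).contDiffOn
  have h2 : ContDiffOn ℝ 1 (h ∘ (e ∘ γ)) (Icc a b) := hh.contDiff.comp_contDiffOn h1
  refine (enorm_sub_le_lintegral_deriv_of_contDiffOn_Icc h2 hab).trans ?_
  rw [pathLength_eq, ← MeasureTheory.restrict_Ioo_eq_restrict_Icc]
  refine MeasureTheory.setLIntegral_mono' measurableSet_Ioo fun t ht => ?_
  have hn : Icc a b ∈ 𝓝 t := Icc_mem_nhds ht.1 ht.2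
  have ht' : t ∈ Icc a b := Ioo_subset_Icc_self ht
  have d1 : DifferentiableAt ℝ (e ∘ γ) t :=
    ((h1 t ht').contDiffAt hn).differentiableAt one_ne_zero
  have d2 : DifferentiableAt ℝ h ((e ∘ γ) t) := hh.contDiff.differentiable one_ne_zero _
  have d3 : deriv (h ∘ (e ∘ γ)) t = fderiv ℝ h ((e ∘ γ) t) (deriv (e ∘ γ) t) :=
    (d2.hasFDerivAt.comp_hasDerivAt t d1.hasDerivAt).deriv
  have d4 : deriv (e ∘ γ) t = complexDeriv e (γ t) * velocity γ t := by
    rw [← velocity_eq_deriv]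
    exact velocity_comp (he.mdifferentiableAt hU (hm ht'))
      (((hγ t ht').contMDiffAt hn).mdifferentiableAt one_ne_zero)
  rw [d3, ← ofReal_norm]
  refine ENNReal.ofReal_le_ofReal ((hh.le _ _).trans (le_of_eq ?_))
  rw [d4, ← he.val_eq _ (hm ht'), norm_mul, norm_mul, norm_pow, Real.sqrt_mul (by positivity),
    Real.sqrt_sq (norm_nonneg _)]
  simp only [Function.comp_apply]
  ring

/-- A path which starts in the domain of a canonical coordinate and is too short to leave the
compact set `{z | ‖h z - h (e x)‖ ≤ ℓ}` stays in that domain. -/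
theorem mapsTo_source_of_pathLength_lt [T2Space X] {e : OpenPartialHomeomorph X ℂ}
    (he : IsDev φ' φ e e.source) {h : ℂ → E} (hh : IsContraction φ' h) {γ : ℝ → X}
    (hγ : ContMDiffOn 𝓘(ℝ) 𝓘(ℝ, ℂ) 1 γ (Icc 0 1)) (h0 : γ 0 ∈ e.source) {ℓ : ℝ}
    (hK : IsCompact {z | ‖h z - h (e (γ 0))‖ ≤ ℓ})
    (hKt : {z | ‖h z - h (e (γ 0))‖ ≤ ℓ} ⊆ e.target)
    (hlen : φ.pathLength γ 0 1 < ENNReal.ofReal ℓ) : MapsTo γ (Icc 0 1) e.source := by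
  set K := {z | ‖h z - h (e (γ 0))‖ ≤ ℓ}
  have hC : IsClosed (e.symm '' K) := (hK.image_of_continuousOn
    (e.symm.continuousOn.mono hKt)).isClosed
  have hCs : e.symm '' K ⊆ e.source := by
    rintro _ ⟨z, hz, rfl⟩
    exact e.map_target (hKt hz)
  have hcont : ContinuousOn γ (Icc 0 1) := hγ.continuousOn
  -- As long as the path has stayed in the chart, the length estimate keeps it in `e.symm '' K`.
  -- This set is closed and inside the source, so a first exit time is impossible.
  have key : ∀ t ∈ Icc (0 : ℝ) 1, MapsTo γ (Icc 0 t) e.source → γ t ∈ e.symm '' K := by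
    intro t ht hm
    have hle := enorm_sub_le_pathLength e.open_source he hh ht.1
      (hγ.mono (Icc_subset_Icc_right ht.2)) hm
    have hle2 : φ.pathLength γ 0 t ≤ φ.pathLength γ 0 1 := by
      rw [pathLength_eq, pathLength_eq]
      exact MeasureTheory.lintegral_mono_set (Icc_subset_Icc_right ht.2)
    have h3 := (hle.trans hle2).trans_lt hlen
    rw [← ofReal_norm, ENNReal.ofReal_lt_ofReal_iff_of_nonneg (norm_nonneg _)] at h3
    exact ⟨e (γ t), h3.le, e.left_inv (hm ⟨ht.1, le_rfl⟩)⟩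
  by_contra hcon
  obtain ⟨t1, ht1, hbad⟩ : ∃ t ∈ Icc (0 : ℝ) 1, γ t ∉ e.source := by
    simpa [MapsTo, and_assoc] using hcon
  -- The set of exit times and its least element.
  set B := {t ∈ Icc (0 : ℝ) 1 | γ t ∉ e.source} with hB
  have hBc : IsClosed B := by
    have := hcont.preimage_isClosed_of_isClosed isClosed_Icc e.open_source.isClosed_compl
    exact this
  have hBne : B.Nonempty := ⟨t1, ht1, hbad⟩
  have hBb : BddBelow B := ⟨0, fun t ht => ht.1.1⟩
  have hs : sInf B ∈ B := hBc.csInf_mem hBne hBb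
  set s := sInf B
  have hlt : ∀ t ∈ Icc (0 : ℝ) 1, t < s → γ t ∈ e.source := by
    intro t ht hts
    by_contra hc
    exact absurd (csInf_le hBb ⟨ht, hc⟩) (not_le.2 hts)
  have hs0 : 0 < s := by
    rcases hs.1.1.eq_or_lt with h | h
    · exact absurd (h ▸ h0) hs.2
    · exact h
  have hmem : ∀ t ∈ Ico (0 : ℝ) s, γ t ∈ e.symm '' K := fun t ht =>
    key t ⟨ht.1, ht.2.le.trans hs.1.2⟩ fun u hu =>
      hlt u ⟨hu.1, hu.2.trans (ht.2.le.trans hs.1.2)⟩ (hu.2.trans_lt ht.2)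
  have hlim : Tendsto γ (𝓝[Ico 0 s] s) (𝓝 (γ s)) :=
    ((hcont s hs.1).mono (fun t ht => ⟨ht.1, ht.2.le.trans hs.1.2⟩)).tendsto
  have hne : (𝓝[Ico 0 s] s).NeBot := by
    rw [← mem_closure_iff_nhdsWithin_neBot, closure_Ico hs0.ne]
    exact ⟨hs0.le, le_rfl⟩
  exact hs.2 (hCs (hC.mem_of_tendsto hlim (eventually_nhdsWithin_of_forall hmem)))

theorem mem_source_of_dist_lt [T2Space X] {e : OpenPartialHomeomorph X ℂ}
    (he : IsDev φ' φ e e.source) {h : ℂ → E} (hh : IsContraction φ' h) {x y : X}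
    (hx : x ∈ e.source) {ℓ : ℝ} (hK : IsCompact {z | ‖h z - h (e x)‖ ≤ ℓ})
    (hKt : {z | ‖h z - h (e x)‖ ≤ ℓ} ⊆ e.target) (hd : φ.dist x y < ENNReal.ofReal ℓ) :
    y ∈ e.source ∧ ‖h (e y) - h (e x)‖ₑ ≤ φ.dist x y := by
  -- The distance is an infimum that need not be attained, so the bound is proved for each larger
  -- `r`.
  have key : ∀ r, φ.dist x y < r → r ≤ ENNReal.ofReal ℓ →
      y ∈ e.source ∧ ‖h (e y) - h (e x)‖ₑ ≤ r := by
    intro r hr hrl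
    obtain ⟨γ, rfl, rfl, hγ, hlen⟩ := φ.exists_path_of_dist_lt hr
    have hm := mapsTo_source_of_pathLength_lt he hh hγ hx hK hKt (hlen.trans_le hrl)
    exact ⟨hm ⟨zero_le_one, le_rfl⟩,
      (enorm_sub_le_pathLength e.open_source he hh zero_le_one hγ hm).trans hlen.le⟩
  refine ⟨(key _ hd le_rfl).1, le_of_forall_gt fun r hr => ?_⟩
  obtain ⟨r', h1, h2⟩ := exists_between (lt_min hr hd)
  exact (key r' h1 (h2.le.trans (min_le_right _ _))).2.trans_lt (h2.trans_le (min_le_left _ _))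

end LowerBound

section UpperBound

variable {φ : QuadraticDifferential X} {φ' : QuadraticDifferential ℂ}

/-- The length of `ψ ∘ σ` is the integral of the `|φ'|`-speed of `σ`, hence at most the increment of
a primitive `G` of a bound `g`. Asking for derivatives of `G` only inside the interval lets radii
start at the origin. -/
theorem dist_le_of_hasDerivAt {ψ : ℂ → X} {U : Set ℂ} (hU : IsOpen U) (hψ : IsDev φ φ' ψ U)
    {σ : ℝ → ℂ} {a b : ℝ} (hab : a ≤ b) (hσ : ContDiffOn ℝ 1 σ (Icc a b))
    (hm : MapsTo σ (Icc a b) U) {G g : ℝ → ℝ} (hG : ContinuousOn G (Icc a b))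
    (hg : ContinuousOn g (Icc a b)) (hg0 : ∀ t ∈ Ioo a b, 0 ≤ g t)
    (hGg : ∀ t ∈ Ioo a b, HasDerivAt G (g t) t)
    (hle : ∀ t ∈ Ioo a b, ‖deriv σ t‖ * Real.sqrt ‖φ'.val (σ t)‖ ≤ g t) :
    φ.dist (ψ (σ a)) (ψ (σ b)) ≤ ENNReal.ofReal (G b - G a) := by
  have h1 : ContMDiffOn 𝓘(ℝ) 𝓘(ℝ, ℂ) 1 (ψ ∘ σ) (Icc a b) :=
    (hψ.contMDiffOn.restrictScalars_real).comp hσ.contMDiffOn hm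
  refine (φ.dist_le_pathLength hab h1).trans ?_
  have hint : IntervalIntegrable g MeasureTheory.volume a b :=
    ContinuousOn.intervalIntegrable (by rwa [uIcc_of_le hab])
  have hI := intervalIntegral.integral_eq_sub_of_hasDerivAt_of_le hab hG hGg hint
  have hnn : 0 ≤ᵐ[MeasureTheory.volume.restrict (Ioo a b)] g :=
    (MeasureTheory.ae_restrict_iff' measurableSet_Ioo).2 (Eventually.of_forall hg0)
  rw [← hI, intervalIntegral.integral_of_le hab, ← MeasureTheory.restrict_Ioo_eq_restrict_Ioc,
    MeasureTheory.ofReal_integral_eq_lintegral_ofReal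
      ((hint.1).mono_set Ioo_subset_Ioc_self) hnn, pathLength_eq,
    ← MeasureTheory.restrict_Ioo_eq_restrict_Icc]
  refine MeasureTheory.setLIntegral_mono' measurableSet_Ioo fun t ht => ?_
  refine ENNReal.ofReal_le_ofReal (le_trans (le_of_eq ?_) (hle t ht))
  have hn : Icc a b ∈ 𝓝 t := Icc_mem_nhds ht.1 ht.2
  have ht' : t ∈ Icc a b := Ioo_subset_Icc_self ht
  have d1 : DifferentiableAt ℝ σ t := ((hσ t ht').contDiffAt hn).differentiableAt one_ne_zero
  rw [velocity_comp (hψ.mdifferentiableAt hU (hm ht')) d1.mdifferentiableAt, velocity_eq_deriv,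
    ← hψ.val_eq _ (hm ht'), norm_mul, norm_mul, norm_pow, Real.sqrt_mul (by positivity),
    Real.sqrt_sq (norm_nonneg _)]
  simp only [Function.comp_apply]
  ring

/-- `φ'` is, up to a unitary factor, `p ^ 2 z ^ (2 p - 2) dz ^ 2`. -/
def IsRadial (φ' : QuadraticDifferential ℂ) (p : ℝ) : Prop :=
  1 ≤ p ∧ ∀ z, Real.sqrt ‖φ'.val z‖ = p * ‖z‖ ^ (p - 1)

theorem isRadial_modelFlat : IsRadial modelFlat 1 :=
  ⟨le_rfl, fun z => by simp⟩

theorem isRadial_modelZero : IsRadial modelZero (3 / 2) := by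
  refine ⟨by norm_num, fun z => ?_⟩
  rw [val_modelZero, norm_mul, norm_pow, Real.sqrt_mul (by positivity),
    Real.sqrt_sq (norm_nonneg _), Real.sqrt_eq_rpow]
  norm_num

/-- The gradient of `‖z‖ ^ p` has norm `p ‖z‖ ^ (p - 1)`, exactly the density of the metric. The
exponent must exceed `1` for smoothness at the origin; the flat model uses the identity instead. -/
theorem isContraction_norm_rpow {p : ℝ} (hp : 1 < p) (h : IsRadial φ' p) :
    IsContraction φ' (fun z : ℂ => ‖z‖ ^ p) := by
  refine ⟨contDiff_norm_rpow hp, fun z v => ?_⟩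
  refine ((fderiv ℝ (fun z : ℂ => ‖z‖ ^ p) z).le_opNorm v).trans (le_of_eq ?_)
  rw [norm_fderiv_norm_id_rpow z hp, h.2, mul_comm]

theorem isContraction_id : IsContraction modelFlat (fun z : ℂ => z) := by
  refine ⟨contDiff_id, fun z v => ?_⟩
  simp

/-- The curve `u ↦ u w` has `|φ'|`-speed `p u ^ (p - 1) ‖w‖ ^ p`, with primitive `u ^ p ‖w‖ ^ p`. -/
theorem dist_radial_le {p : ℝ} (hp : IsRadial φ' p) {ψ : ℂ → X} {U : Set ℂ} (hU : IsOpen U)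
    (hψ : IsDev φ φ' ψ U) {w : ℂ} {s t : ℝ} (hs : 0 ≤ s) (hst : s ≤ t)
    (hm : ∀ u ∈ Icc s t, (u : ℂ) * w ∈ U) :
    φ.dist (ψ (s * w)) (ψ (t * w)) ≤ ENNReal.ofReal (t ^ p * ‖w‖ ^ p - s ^ p * ‖w‖ ^ p) := by
  have hp0 : 0 < p := zero_lt_one.trans_le hp.1
  have hd : ∀ u : ℝ, HasDerivAt (fun u : ℝ => (u : ℂ) * w) w u := fun u => by
    simpa using (Complex.ofRealCLM.hasDerivAt (x := u)).mul_const w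
  refine dist_le_of_hasDerivAt (σ := fun u : ℝ => (u : ℂ) * w)
    (G := fun u => u ^ p * ‖w‖ ^ p) (g := fun u => p * u ^ (p - 1) * ‖w‖ ^ p) hU hψ hst
    ?_ hm ?_ ?_ ?_ ?_ ?_
  · exact ((Complex.ofRealCLM.contDiff).mul contDiff_const).contDiffOn
  · exact ((Real.continuous_rpow_const hp0.le).mul continuous_const).continuousOn
  · exact ((continuous_const.mul (Real.continuous_rpow_const (sub_nonneg.2 hp.1))).mul
      continuous_const).continuousOn
  · intro u hu
    have : 0 ≤ u := hs.trans hu.1.le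
    positivity
  · intro u hu
    have : u ≠ 0 := (hs.trans_lt hu.1).ne'
    exact (Real.hasDerivAt_rpow_const (Or.inl this)).mul_const _
  · intro u hu
    have hu0 : 0 ≤ u := hs.trans hu.1.le
    rw [(hd u).deriv, hp.2, norm_mul, Complex.norm_real, Real.norm_of_nonneg hu0,
      Real.mul_rpow hu0 (norm_nonneg _)]
    refine le_of_eq ?_
    have : ‖w‖ ^ p = ‖w‖ * ‖w‖ ^ (p - 1) := by
      rw [← Real.rpow_one_add' (norm_nonneg _) (by linarith)]
      ring_nf
    rw [this]
    ring

theorem dist_le_norm_rpow {p : ℝ} (hp : IsRadial φ' p) {ψ : ℂ → X} {U : Set ℂ} (hU : IsOpen U)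
    (hψ : IsDev φ φ' ψ U) {w : ℂ} (hm : ∀ u ∈ Icc (0 : ℝ) 1, (u : ℂ) * w ∈ U) :
    φ.dist (ψ 0) (ψ w) ≤ ENNReal.ofReal (‖w‖ ^ p) := by
  have := dist_radial_le hp hU hψ le_rfl zero_le_one hm
  simpa [Real.zero_rpow (zero_lt_one.trans_le hp.1).ne'] using this

theorem dist_le_of_modelFlat {ψ : ℂ → X} {U : Set ℂ} (hU : IsOpen U)
    (hψ : IsDev φ modelFlat ψ U) {a b : ℂ} (hm : segment ℝ a b ⊆ U) :
    φ.dist (ψ a) (ψ b) ≤ ENNReal.ofReal ‖b - a‖ := by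
  have hd : ∀ u : ℝ, HasDerivAt (fun u : ℝ => a + (u : ℂ) * (b - a)) (b - a) u := fun u => by
    simpa using ((Complex.ofRealCLM.hasDerivAt (x := u)).mul_const (b - a)).const_add a
  have := dist_le_of_hasDerivAt (σ := fun u : ℝ => a + (u : ℂ) * (b - a)) (a := 0) (b := 1)
    (G := fun u => u * ‖b - a‖) (g := fun _ => ‖b - a‖) hU hψ zero_le_one
    (by exact (contDiff_const.add ((Complex.ofRealCLM.contDiff).mul contDiff_const)).contDiffOn)
    (fun u hu => hm (by
      rw [segment_eq_image']
      exact ⟨u, hu, by simp⟩))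
    (by fun_prop) (by fun_prop) (fun _ _ => norm_nonneg _)
    (fun u _ => by simpa using (hasDerivAt_id u).mul_const ‖b - a‖)
    (fun u _ => by rw [(hd u).deriv]; simp)
  simpa using this

end UpperBound

end QuadraticDifferential

end

/-! ### Inverse function theorem, identity theorem, and flat coordinates of the cone. -/

noncomputable section

section LocalTheory

variable {M N : Type*} [TopologicalSpace M] [ChartedSpace ℂ M] [TopologicalSpace N]
  [ChartedSpace ℂ N]

theorem complexDeriv_mul_of_leftInverse {f : M → N} {g : N → M} {x : M}
    (hg : MDifferentiableAt 𝓘(ℂ) 𝓘(ℂ) g (f x)) (hf : MDifferentiableAt 𝓘(ℂ) 𝓘(ℂ) f x)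
    (h : g ∘ f =ᶠ[𝓝 x] fun y => y) : complexDeriv g (f x) * complexDeriv f x = 1 := by
  rw [← complexDeriv_comp hg hf, complexDeriv_congr h, complexDeriv_id]

theorem exists_openPartialHomeomorph_of_deriv_ne_zero {f : ℂ → ℂ} {w : ℂ} {V : Set ℂ}
    (hV : IsOpen V) (hw : w ∈ V) (hf : DifferentiableOn ℂ f V) (hd : deriv f w ≠ 0) :
    ∃ F : OpenPartialHomeomorph ℂ ℂ, w ∈ F.source ∧ F.source ⊆ V ∧ (F : ℂ → ℂ) = f ∧
      ContDiffOn ℂ ω F F.source ∧ ContDiffOn ℂ ω F.symm F.target := by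
  have hca : ∀ x ∈ V, ContDiffAt ℂ ω f x := fun x hx =>
    (hf.contDiffOn hV).contDiffAt (hV.mem_nhds hx)
  have hda : ∀ x ∈ V, HasDerivAt f (deriv f x) x := fun x hx =>
    (hf.differentiableAt (hV.mem_nhds hx)).hasDerivAt
  let F₀ := (hca w hw).toOpenPartialHomeomorph f ((hda w hw).hasFDerivAt_equiv hd) (by simp)
  have hF₀ : (F₀ : ℂ → ℂ) = f := rfl
  have hw₀ : w ∈ F₀.source :=
    (hca w hw).mem_toOpenPartialHomeomorph_source ((hda w hw).hasFDerivAt_equiv hd) (by simp)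
  have hdc : ContinuousOn (deriv f) V := (hf.deriv hV).continuousOn
  -- Restricting to where the derivative is nonzero makes the inverse analytic on its whole domain,
  -- not only at `f w`.
  let V' : Set ℂ := V ∩ (deriv f) ⁻¹' {0}ᶜ
  have hV' : IsOpen V' := hdc.isOpen_inter_preimage hV isOpen_compl_singleton
  let F := F₀.restrOpen V' hV'
  have hFs : F.source = F₀.source ∩ V' := rfl
  have hF : (F : ℂ → ℂ) = f := rfl
  refine ⟨F, ⟨hw₀, hw, hd⟩, fun x hx => hx.2.1, hF, fun x hx => ?_, fun y hy => ?_⟩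
  · exact (hca x hx.2.1).contDiffWithinAt
  · have hx : F.symm y ∈ F.source := F.map_target hy
    exact (F.contDiffAt_symm_deriv (f₀' := deriv f (F.symm y)) hx.2.2 hy
      (hda _ hx.2.1) (hca _ hx.2.1)).contDiffWithinAt

variable [IsManifold 𝓘(ℂ) ω M] [IsManifold 𝓘(ℂ) ω N]

/-- The inverse function theorem for maps between Riemann surfaces. -/
theorem isLocalDiffeomorphAt_of_complexDeriv_ne_zero {f : M → N} {U : Set M} (hU : IsOpen U)
    (hf : ContMDiffOn 𝓘(ℂ) 𝓘(ℂ) ω f U) {x : M} (hx : x ∈ U) (hd : complexDeriv f x ≠ 0) :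
    ∃ Φ : PartialDiffeomorph 𝓘(ℂ) 𝓘(ℂ) M N ω, x ∈ Φ.source ∧ Φ.source ⊆ U ∧
      EqOn f Φ Φ.source := by
  let c := chartAt ℂ x
  let d := chartAt ℂ (f x)
  have hc : ContMDiffOn 𝓘(ℂ) 𝓘(ℂ) ω c c.source := contMDiffOn_chart
  have hc' : ContMDiffOn 𝓘(ℂ) 𝓘(ℂ) ω c.symm c.target := contMDiffOn_chart_symm
  have hdd : ContMDiffOn 𝓘(ℂ) 𝓘(ℂ) ω d d.source := contMDiffOn_chart
  have hdd' : ContMDiffOn 𝓘(ℂ) 𝓘(ℂ) ω d.symm d.target := contMDiffOn_chart_symm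
  let C : PartialDiffeomorph 𝓘(ℂ) 𝓘(ℂ) M ℂ ω := ⟨c.toPartialEquiv, c.open_source, c.open_target, hc, hc'⟩
  let D : PartialDiffeomorph 𝓘(ℂ) 𝓘(ℂ) N ℂ ω := ⟨d.toPartialEquiv, d.open_source, d.open_target, hdd, hdd'⟩
  let U' : Set M := U ∩ f ⁻¹' d.source
  have hU' : IsOpen U' := hf.continuousOn.isOpen_inter_preimage hU d.open_source
  let V : Set ℂ := c.target ∩ c.symm ⁻¹' U'
  have hV : IsOpen V := c.symm.continuousOn.isOpen_inter_preimage c.open_target hU'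
  have hxc : x ∈ c.source := mem_chart_source ℂ x
  have hxd : f x ∈ d.source := mem_chart_source ℂ (f x)
  have hcx : c.symm (c x) = x := c.left_inv hxc
  have hwV : c x ∈ V := ⟨c.map_source hxc, by
    rw [mem_preimage, hcx]; exact ⟨hx, hxd⟩⟩
  let g : ℂ → ℂ := d ∘ f ∘ c.symm
  have hg : ContMDiffOn 𝓘(ℂ) 𝓘(ℂ) ω g V :=
    hdd.comp (hf.comp (hc'.mono inter_subset_left) fun z hz => hz.2.1) fun z hz => hz.2.2
  have hgd : DifferentiableOn ℂ g V := hg.contDiffOn.differentiableOn (by simp)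
  have hne : (ω : ℕ∞ω) ≠ 0 := by simp
  have m1 : MDifferentiableAt 𝓘(ℂ) 𝓘(ℂ) f x := (hf.contMDiffAt (hU.mem_nhds hx)).mdifferentiableAt hne
  have m2 : MDifferentiableAt 𝓘(ℂ) 𝓘(ℂ) d (f x) :=
    (hdd.contMDiffAt (d.open_source.mem_nhds hxd)).mdifferentiableAt hne
  have m3 : MDifferentiableAt 𝓘(ℂ) 𝓘(ℂ) c.symm (c x) :=
    (hc'.contMDiffAt (c.open_target.mem_nhds (c.map_source hxc))).mdifferentiableAt hne
  have m4 : MDifferentiableAt 𝓘(ℂ) 𝓘(ℂ) c x :=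
    (hc.contMDiffAt (c.open_source.mem_nhds hxc)).mdifferentiableAt hne
  have m5 : MDifferentiableAt 𝓘(ℂ) 𝓘(ℂ) d.symm (d (f x)) :=
    (hdd'.contMDiffAt (d.open_target.mem_nhds (d.map_source hxd))).mdifferentiableAt hne
  have n1 : complexDeriv c.symm (c x) ≠ 0 := left_ne_zero_of_mul (b := complexDeriv c x) (by
    rw [complexDeriv_mul_of_leftInverse m3 m4
      (c.eventually_left_inverse hxc)]; exact one_ne_zero)
  have n2 : complexDeriv d (f x) ≠ 0 := right_ne_zero_of_mul (a := complexDeriv d.symm (d (f x))) (by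
    rw [complexDeriv_mul_of_leftInverse m5 m2
      (d.eventually_left_inverse hxd)]; exact one_ne_zero)
  have hgne : deriv g (c x) ≠ 0 := by
    rw [← complexDeriv_eq_deriv]
    have m1' : MDifferentiableAt 𝓘(ℂ) 𝓘(ℂ) f (c.symm (c x)) := by rwa [hcx]
    have m2' : MDifferentiableAt 𝓘(ℂ) 𝓘(ℂ) d ((f ∘ c.symm) (c x)) := by
      simpa only [Function.comp_apply, hcx] using m2
    rw [show g = d ∘ (f ∘ c.symm) from rfl, complexDeriv_comp m2' (m1'.comp _ m3),
      complexDeriv_comp m1' m3]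
    simp only [Function.comp_apply, hcx]
    exact mul_ne_zero n2 (mul_ne_zero hd n1)
  obtain ⟨F, hF1, hF2, hF3, hF4, hF5⟩ :=
    exists_openPartialHomeomorph_of_deriv_ne_zero hV hwV hgd hgne
  let Fd : PartialDiffeomorph 𝓘(ℂ) 𝓘(ℂ) ℂ ℂ ω :=
    ⟨F.toPartialEquiv, F.open_source, F.open_target, hF4.contMDiffOn, hF5.contMDiffOn⟩
  have key : ∀ y ∈ c.source, c y ∈ F.source → y ∈ U' ∧ F (c y) = d (f y) := by
    intro y hy hy'
    have h1 := (hF2 hy').2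
    rw [mem_preimage, c.left_inv hy] at h1
    refine ⟨h1, ?_⟩
    rw [hF3]
    simp only [g, Function.comp_apply, c.left_inv hy]
  refine ⟨(C.trans Fd).trans D.symm, ?_, ?_, ?_⟩
  · refine ⟨⟨hxc, hF1⟩, ?_⟩
    change F (c x) ∈ d.target
    rw [(key x hxc hF1).2]
    exact d.map_source hxd
  · rintro y ⟨⟨hy, hy'⟩, -⟩
    exact (key y hy hy').1.1
  · rintro y ⟨⟨hy, hy'⟩, -⟩
    change f y = d.symm (F (c y))
    rw [(key y hy hy').2, d.left_inv (key y hy hy').1.2]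

/-- The identity theorem for holomorphic maps from a plane domain to a Riemann surface. -/
theorem eqOn_of_contMDiffOn_of_eventuallyEq [T2Space N] {f g : ℂ → N} {U : Set ℂ}
    (hU : IsOpen U) (hUc : IsPreconnected U) (hf : ContMDiffOn 𝓘(ℂ) 𝓘(ℂ) ω f U)
    (hg : ContMDiffOn 𝓘(ℂ) 𝓘(ℂ) ω g U) {z : ℂ} (hz : z ∈ U) (h : f =ᶠ[𝓝 z] g) : EqOn f g U := by
  let u : Set ℂ := {w | f =ᶠ[𝓝 w] g}
  have hu : IsOpen u := isOpen_setOfPred_eventually_nhds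
  suffices hsub : U ⊆ u from fun w hw => (hsub hw).self_of_nhds
  -- The set `u` is open. A limit point of `u` in `U` belongs to `u`, by the classical identity
  -- theorem in a chart around the common value.
  refine hUc.subset_of_closure_inter_subset hu ⟨z, hz, h⟩ ?_
  rintro w ⟨hwc, hwU⟩
  have cf : ContinuousAt f w := hf.continuousOn.continuousAt (hU.mem_nhds hwU)
  have cg : ContinuousAt g w := hg.continuousOn.continuousAt (hU.mem_nhds hwU)
  have hfg : f w = g w := by
    have : (𝓝[u] w).NeBot := mem_closure_iff_nhdsWithin_neBot.1 hwc
    refine tendsto_nhds_unique_of_eventuallyEq (l := 𝓝[u] w) (cf.tendsto.mono_left nhdsWithin_le_nhds)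
      (cg.tendsto.mono_left nhdsWithin_le_nhds) ?_
    exact eventually_nhdsWithin_of_forall fun y hy => hy.self_of_nhds
  let e := chartAt ℂ (f w)
  have he : ContMDiffOn 𝓘(ℂ) 𝓘(ℂ) ω e e.source := contMDiffOn_chart
  have hs : e.source ∈ 𝓝 (f w) := e.open_source.mem_nhds (mem_chart_source ℂ (f w))
  obtain ⟨r, hr, hB⟩ := Metric.mem_nhds_iff.1
    (inter_mem (hU.mem_nhds hwU) (inter_mem (cf hs) (cg (hfg ▸ hs))))
  have hdf : DifferentiableOn ℂ (e ∘ f) (Metric.ball w r) :=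
    ((he.comp (hf.mono fun y hy => (hB hy).1) fun y hy => (hB hy).2.1).contDiffOn).differentiableOn
      (by simp)
  have hdg : DifferentiableOn ℂ (e ∘ g) (Metric.ball w r) :=
    ((he.comp (hg.mono fun y hy => (hB hy).1) fun y hy => (hB hy).2.2).contDiffOn).differentiableOn
      (by simp)
  obtain ⟨w', hw'B, hw'u⟩ := mem_closure_iff_nhds.1 hwc _ (Metric.ball_mem_nhds w hr)
  have heq := (hdf.analyticOnNhd Metric.isOpen_ball).eqOn_of_preconnected_of_eventuallyEq
    (hdg.analyticOnNhd Metric.isOpen_ball) (convex_ball w r).isPreconnected hw'B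
    (hw'u.mono fun y hy => congrArg e hy)
  filter_upwards [Metric.ball_mem_nhds w hr] with y hy
  exact e.injOn (hB hy).2.1 (hB hy).2.2 (heq hy)

end LocalTheory

namespace QuadraticDifferential

/-- Two flat coordinates on a domain agree up to sign and translation. -/
theorem IsDev.eq_neg_or_eq_add {φ' : QuadraticDifferential ℂ} {f g : ℂ → ℂ} {U : Set ℂ}
    (hU : IsOpen U) (hUc : IsPreconnected U) (hf : IsDev modelFlat φ' f U)
    (hg : IsDev modelFlat φ' g U) (hne : ∀ z ∈ U, φ'.val z ≠ 0) :
    ∃ ε c : ℂ, (ε = 1 ∨ ε = -1) ∧ ∀ z ∈ U, f z = ε * g z + c := by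
  have df : DifferentiableOn ℂ f U := hf.contMDiffOn.contDiffOn.differentiableOn (by simp)
  have dg : DifferentiableOn ℂ g U := hg.contMDiffOn.contDiffOn.differentiableOn (by simp)
  have vf : ∀ z ∈ U, deriv f z ^ 2 = φ'.val z := fun z hz => by
    simpa [complexDeriv_eq_deriv] using hf.val_eq z hz
  have vg : ∀ z ∈ U, deriv g z ^ 2 = φ'.val z := fun z hz => by
    simpa [complexDeriv_eq_deriv] using hg.val_eq z hz
  -- Both derivatives are continuous square roots of the same nowhere vanishing function on a
  -- connected set.
  have key : ∃ ε : ℂ, (ε = 1 ∨ ε = -1) ∧ ∀ z ∈ U, deriv f z = ε * deriv g z := by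
    rcases hUc.eq_or_eq_neg_of_sq_eq (df.deriv hU).continuousOn (dg.deriv hU).continuousOn
      (fun z hz => by simp [vf z hz, vg z hz])
      (fun {z} hz h0 => hne z hz (by rw [← vg z hz, h0]; simp)) with h | h
    · exact ⟨1, Or.inl rfl, fun z hz => by simpa using h hz⟩
    · exact ⟨-1, Or.inr rfl, fun z hz => by simpa using h hz⟩
  obtain ⟨ε, hε, hd⟩ := key
  have dg' : DifferentiableOn ℂ (fun z => ε * g z) U := dg.const_mul ε
  obtain ⟨c, hc⟩ := hU.exists_eq_add_of_deriv_eq hUc df dg' (fun z hz => by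
    rw [hd z hz, deriv_const_mul _ (dg.differentiableAt (hU.mem_nhds hz))])
  exact ⟨ε, c, hε, hc⟩

theorem isDev_modelFlat_iff {φ' : QuadraticDifferential ℂ} {f : ℂ → ℂ} {U : Set ℂ}
    (hU : IsOpen U) : IsDev modelFlat φ' f U ↔
      DifferentiableOn ℂ f U ∧ ∀ z ∈ U, deriv f z ^ 2 = φ'.val z := by
  constructor
  · intro h
    exact ⟨h.contMDiffOn.contDiffOn.differentiableOn (by simp), fun z hz => by
      simpa [complexDeriv_eq_deriv] using h.val_eq z hz⟩
  · rintro ⟨h1, h2⟩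
    exact ⟨(h1.contDiffOn hU).contMDiffOn, fun z hz => by
      simpa [complexDeriv_eq_deriv] using h2 z hz⟩

theorem isDev_affine {ε c : ℂ} (hε : ε = 1 ∨ ε = -1) (U : Set ℂ) :
    IsDev modelFlat modelFlat (fun z => ε * z + c) U := by
  refine IsDev.mono ((isDev_modelFlat_iff isOpen_univ).2 ⟨by fun_prop, fun z _ => ?_⟩)
    (subset_univ U)
  have : HasDerivAt (fun z => ε * z + c) ε z := by
    simpa using ((hasDerivAt_id z).const_mul ε).add_const c
  rw [this.deriv]
  rcases hε with rfl | rfl <;> simp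

/-- A branch of `z ^ (3 / 2)` along the ray through `w`. -/
def sqrtCube (w z : ℂ) : ℂ := (w ^ 3) ^ (1 / 2 : ℂ) * (z / w) ^ (3 / 2 : ℂ)

/-- A slit plane on which the branch `sqrtCube w` is holomorphic. -/
def slitDomain (w : ℂ) : Set ℂ := {z | z / w ∈ Complex.slitPlane}

theorem isOpen_slitDomain (w : ℂ) : IsOpen (slitDomain w) :=
  Complex.isOpen_slitPlane.preimage (continuous_id.div_const w)

theorem mem_slitDomain {w : ℂ} (hw : w ≠ 0) {t : ℝ} (ht : 0 < t) : (t : ℂ) * w ∈ slitDomain w := by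
  change (t : ℂ) * w / w ∈ Complex.slitPlane
  rw [mul_div_cancel_right₀ _ hw]
  exact Complex.ofReal_mem_slitPlane.2 ht

theorem self_mem_slitDomain {w : ℂ} (hw : w ≠ 0) : w ∈ slitDomain w := by
  simpa using mem_slitDomain hw one_pos

/-- Squaring turns the exponents into integers, so the identity holds even on the cut. -/
theorem sqrtCube_sq {w : ℂ} (hw : w ≠ 0) (z : ℂ) : sqrtCube w z ^ 2 = z ^ 3 := by
  unfold sqrtCube
  rw [mul_pow, ← Complex.cpow_nat_mul, ← Complex.cpow_nat_mul]
  have h1 : ((2 : ℕ) : ℂ) * (1 / 2) = 1 := by norm_num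
  have h2 : ((2 : ℕ) : ℂ) * (3 / 2) = ((3 : ℕ) : ℂ) := by norm_num
  rw [h1, h2, Complex.cpow_one, Complex.cpow_natCast, div_pow]
  field_simp

/-- The modulus does not depend on the branch, so the distance to the zero can be read off in any of
these flat coordinates. -/
theorem norm_sqrtCube {w : ℂ} (hw : w ≠ 0) (z : ℂ) : ‖sqrtCube w z‖ = ‖z‖ ^ (3 / 2 : ℝ) := by
  have h := congrArg norm (sqrtCube_sq hw z)
  rw [norm_pow, norm_pow] at h
  have h2 : (‖z‖ ^ (3 / 2 : ℝ)) ^ 2 = ‖z‖ ^ 3 := by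
    rw [← Real.rpow_natCast, ← Real.rpow_mul (norm_nonneg _), ← Real.rpow_natCast]
    norm_num
  rw [← h2] at h
  exact (pow_left_inj₀ (norm_nonneg _) (by positivity) two_ne_zero).1 h

theorem sqrtCube_ofReal_mul {w : ℂ} (hw : w ≠ 0) {t : ℝ} (ht : 0 ≤ t) :
    sqrtCube w (t * w) = (t ^ (3 / 2 : ℝ) : ℝ) * sqrtCube w w := by
  unfold sqrtCube
  rw [mul_div_cancel_right₀ _ hw, div_self hw, Complex.one_cpow, Complex.ofReal_cpow ht]
  push_cast
  ring

/-- Differentiating `s ^ 2 = z ^ 3` gives `2 s s' = 3 z ^ 2`; squaring and dividing by `4 z ^ 3`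
gives `s' ^ 2 = (9 / 4) z`. -/
theorem isDev_sqrtCube {w : ℂ} (hw : w ≠ 0) :
    IsDev modelFlat modelZero (sqrtCube w) (slitDomain w) := by
  have hd : DifferentiableOn ℂ (sqrtCube w) (slitDomain w) := by
    intro z hz
    have : DifferentiableAt ℂ (fun z : ℂ => (z / w) ^ (3 / 2 : ℂ)) z :=
      (differentiableAt_id.div_const w).cpow_const hz
    exact (this.const_mul _).differentiableWithinAt
  refine (isDev_modelFlat_iff (isOpen_slitDomain w)).2 ⟨hd, fun z hz => ?_⟩
  have hz0 : z ≠ 0 := by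
    rintro rfl
    exact Complex.slitPlane_ne_zero hz (zero_div w)
  have hda := (hd.differentiableAt ((isOpen_slitDomain w).mem_nhds hz)).hasDerivAt
  have h1 : HasDerivAt (fun y : ℂ => y ^ 3) (2 * sqrtCube w z * deriv (sqrtCube w) z) z := by
    have h2 : (fun y : ℂ => y ^ 3) = fun y => sqrtCube w y ^ 2 :=
      funext fun y => (sqrtCube_sq hw y).symm
    rw [h2]
    exact (hda.pow 2).congr_deriv (by simp)
  have h3 := h1.unique (hasDerivAt_pow 3 z)
  have h4 := sqrtCube_sq hw z
  rw [val_modelZero]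
  have h5 : 4 * z ^ 3 * deriv (sqrtCube w) z ^ 2 = 9 * z ^ 4 := by
    rw [← h4]
    have : (2 * sqrtCube w z * deriv (sqrtCube w) z) ^ 2 = (3 * z ^ 2) ^ 2 := by
      rw [h3]; norm_num
    linear_combination this
  have h6 : z ^ 3 ≠ 0 := pow_ne_zero _ hz0
  apply mul_left_cancel₀ h6
  linear_combination h5 / 4

end QuadraticDifferential

end

/-! ### Existence of canonical coordinates. -/

noncomputable section

/-- Near a point where it does not vanish, a holomorphic function has holomorphic powers. -/
theorem exists_analytic_branch {g : ℂ → ℂ} {x₀ : ℂ} (hg : AnalyticAt ℂ g x₀) (h0 : g x₀ ≠ 0)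
    (m n : ℕ) (hn : n ≠ 0) : ∃ k : ℂ → ℂ, AnalyticAt ℂ k x₀ ∧ k x₀ ≠ 0 ∧
      ∀ x, k x ^ n = g x ^ m := by
  have hn' : (n : ℂ) ≠ 0 := Nat.cast_ne_zero.2 hn
  let c : ℂ := (g x₀ ^ m) ^ (1 / n : ℂ)
  have hc : c ^ n = g x₀ ^ m := by
    simp only [c]
    rw [← Complex.cpow_nat_mul, mul_one_div, div_self hn', Complex.cpow_one]
  -- Division by `g x₀` moves the base value to `1`, inside the slit plane; the constant `c`, an
  -- `n`-th root of `g x₀ ^ m`, restores the lost factor.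
  refine ⟨fun x => c * (g x / g x₀) ^ (m / n : ℂ), ?_, ?_, fun x => ?_⟩
  · refine analyticAt_const.mul ((hg.div analyticAt_const h0).cpow analyticAt_const ?_)
    change g x₀ / g x₀ ∈ Complex.slitPlane
    rw [div_self h0]
    exact Complex.one_mem_slitPlane
  · change c * (g x₀ / g x₀) ^ (m / n : ℂ) ≠ 0
    rw [div_self h0, Complex.one_cpow, mul_one]
    intro h
    rw [h, zero_pow hn] at hc
    exact pow_ne_zero m h0 hc.symm
  · rw [mul_pow, hc, ← Complex.cpow_nat_mul, mul_div_cancel₀ _ hn', Complex.cpow_natCast, div_pow,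
      mul_div_cancel₀ _ (pow_ne_zero m h0)]

/-- The equation `(3 / 2) H + x H' = k` has a holomorphic solution near `0`. -/
theorem exists_euler_solution {k : ℂ → ℂ} (hk : AnalyticAt ℂ k 0) :
    ∃ H : ℂ → ℂ, ∃ ρ > 0, ∀ x ∈ Metric.ball (0 : ℂ) ρ, DifferentiableAt ℂ H x ∧
      (3 / 2) * H x + x * deriv H x = k x := by
  obtain ⟨r, hr, hkr⟩ := Metric.eventually_nhds_iff_ball.1 hk.eventually_analyticAt
  have hρ : r / 2 < r := half_lt_self hr
  set ρ := r / 2 with hρd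
  have hρ0 : 0 < ρ := half_pos hr
  have hkd : ∀ x ∈ Metric.closedBall (0 : ℂ) ρ, AnalyticAt ℂ k x := fun x hx =>
    hkr x (Metric.closedBall_subset_ball hρ hx)
  obtain ⟨C, hC⟩ := (isCompact_closedBall (0 : ℂ) ρ).exists_bound_of_continuousOn
    (f := deriv k) fun x hx => (hkd x hx).deriv.continuousAt.continuousWithinAt
  have hmem : ∀ t ∈ Icc (0 : ℝ) 1, ∀ x ∈ Metric.ball (0 : ℂ) ρ,
      (t : ℂ) * x ∈ Metric.closedBall (0 : ℂ) ρ := by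
    intro t ht x hx
    rw [mem_closedBall_zero_iff, norm_mul, Complex.norm_real, Real.norm_of_nonneg ht.1]
    have hx' : ‖x‖ < ρ := by simpa using hx
    nlinarith [norm_nonneg x, ht.1, ht.2]
  -- The solution is `H x = ∫ t in 0..1, t ^ (1 / 2) * k (t x)`. With `G t = t ^ (3 / 2) * k (t x)`,
  -- the integrand of `(3 / 2) H + x H'` is the derivative of `G`, and `G 1 - G 0 = k x`.
  let σ : ℝ → ℂ := fun t => ((t ^ (1 / 2 : ℝ) : ℝ) : ℂ)
  have hσ : Continuous σ := Complex.continuous_ofReal.comp (Real.continuous_rpow_const (by norm_num))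
  let F : ℂ → ℝ → ℂ := fun x t => σ t * k (t * x)
  let F' : ℂ → ℝ → ℂ := fun x t => σ t * (deriv k (t * x) * t)
  have hFc : ∀ x ∈ Metric.ball (0 : ℂ) ρ, ContinuousOn (F x) (Icc 0 1) := by
    intro x hx t ht
    have h1 : ContinuousAt (fun t : ℝ => k (t * x)) t :=
      ContinuousAt.comp (f := fun t : ℝ => (t : ℂ) * x) (g := k)
        (hkd _ (hmem t ht x hx)).continuousAt (by fun_prop)
    exact (hσ.continuousAt.mul h1).continuousWithinAt
  have hF'c : ∀ x ∈ Metric.ball (0 : ℂ) ρ, ContinuousOn (F' x) (Icc 0 1) := by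
    intro x hx t ht
    have h1 : ContinuousAt (fun t : ℝ => deriv k (t * x)) t :=
      ContinuousAt.comp (f := fun t : ℝ => (t : ℂ) * x) (g := deriv k)
        (hkd _ (hmem t ht x hx)).deriv.continuousAt (by fun_prop)
    exact (hσ.continuousAt.mul (h1.mul (by fun_prop))).continuousWithinAt
  have hint : ∀ {f : ℝ → ℂ}, ContinuousOn f (Icc 0 1) →
      IntervalIntegrable f MeasureTheory.volume 0 1 := fun h =>
    ContinuousOn.intervalIntegrable (by rwa [uIcc_of_le zero_le_one])
  have hσ1 : ∀ t ∈ Icc (0 : ℝ) 1, ‖σ t‖ ≤ 1 := by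
    intro t ht
    simp only [σ, Complex.norm_real, Real.norm_of_nonneg (Real.rpow_nonneg ht.1 _)]
    exact Real.rpow_le_one ht.1 ht.2 (by norm_num)
  have hI : ∀ t ∈ Set.uIoc (0 : ℝ) 1, t ∈ Icc (0 : ℝ) 1 := fun t ht => by
    rw [uIoc_of_le zero_le_one] at ht
    exact Ioc_subset_Icc_self ht
  have hder : ∀ x ∈ Metric.ball (0 : ℂ) ρ,
      HasDerivAt (fun x => ∫ t in (0 : ℝ)..1, F x t) (∫ t in (0 : ℝ)..1, F' x t) x := by
    intro x hx
    refine (intervalIntegral.hasDerivAt_integral_of_dominated_loc_of_deriv_le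
      (F := F) (F' := F') (bound := fun _ => C) (Metric.isOpen_ball.mem_nhds hx) ?_ (hint (hFc x hx)) ?_ ?_ ?_ ?_).2
    · filter_upwards [Metric.isOpen_ball.mem_nhds hx] with y hy
      exact (hint (hFc y hy)).aestronglyMeasurable_restrict_uIoc
    · exact (hint (hF'c x hx)).aestronglyMeasurable_restrict_uIoc
    · refine Eventually.of_forall fun t ht y hy => ?_
      have ht' := hI t ht
      have h1 := hC _ (hmem t ht' y hy)
      simp only [F', norm_mul, Complex.norm_real, Real.norm_of_nonneg ht'.1]
      calc ‖σ t‖ * (‖deriv k (t * y)‖ * t) ≤ 1 * (C * 1) := by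
            refine mul_le_mul (hσ1 t ht') ?_ (mul_nonneg (norm_nonneg _) ht'.1) zero_le_one
            exact mul_le_mul h1 ht'.2 ht'.1 ((norm_nonneg _).trans h1)
        _ = C := by ring
    · exact intervalIntegrable_const
    · refine Eventually.of_forall fun t ht y hy => ?_
      have ht' := hI t ht
      have h1 := (hkd _ (hmem t ht' y hy)).differentiableAt.hasDerivAt
      have h2 : HasDerivAt (fun y : ℂ => (t : ℂ) * y) t y := by
        simpa using (hasDerivAt_id y).const_mul (t : ℂ)
      exact (h1.comp y h2).const_mul (σ t)
  refine ⟨fun x => ∫ t in (0 : ℝ)..1, F x t, ρ, hρ0, fun x hx =>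
    ⟨(hder x hx).differentiableAt, ?_⟩⟩
  rw [(hder x hx).deriv, ← intervalIntegral.integral_const_mul,
    ← intervalIntegral.integral_const_mul, ← intervalIntegral.integral_add
      ((hint (hFc x hx)).const_mul _) ((hint (hF'c x hx)).const_mul _)]
  let G : ℝ → ℂ := fun t => ((t ^ (3 / 2 : ℝ) : ℝ) : ℂ) * k (t * x)
  have h := intervalIntegral.integral_eq_sub_of_hasDerivAt_of_le (f := G)
    (f' := fun t => 3 / 2 * F x t + x * F' x t) zero_le_one ?_ ?_
    (((hint (hFc x hx)).const_mul _).add ((hint (hF'c x hx)).const_mul _))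
  · rw [h]
    simp [G, Real.zero_rpow]
  · intro t ht
    have h1 : ContinuousAt (fun t : ℝ => k (t * x)) t :=
      ContinuousAt.comp (f := fun t : ℝ => (t : ℂ) * x) (g := k)
        (hkd _ (hmem t ht x hx)).continuousAt (by fun_prop)
    have h2 : Continuous fun t : ℝ => ((t ^ (3 / 2 : ℝ) : ℝ) : ℂ) :=
      Complex.continuous_ofReal.comp (Real.continuous_rpow_const (by norm_num))
    exact (h2.continuousAt.mul h1).continuousWithinAt
  · intro t ht
    have ht' := Ioo_subset_Icc_self ht
    have h1 := (hkd _ (hmem t ht' x hx)).differentiableAt.hasDerivAt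
    have h2 : HasDerivAt (fun t : ℝ => (t : ℂ) * x) x t := by
      simpa using (Complex.ofRealCLM.hasDerivAt (x := t)).mul_const x
    have h3 : HasDerivAt (fun t : ℝ => k (t * x)) (deriv k (t * x) * x) t := h1.comp t h2
    have h4 : HasDerivAt (fun t : ℝ => ((t ^ (3 / 2 : ℝ) : ℝ) : ℂ))
        ((3 / 2 * t ^ (1 / 2 : ℝ) : ℝ) : ℂ) t := by
      have := (Real.hasDerivAt_rpow_const (x := t) (p := 3 / 2) (Or.inl ht.1.ne')).ofReal_comp
      convert this using 3
      norm_num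
    have h5 : t ^ (3 / 2 : ℝ) = t ^ (1 / 2 : ℝ) * t := by
      rw [← Real.rpow_add_one ht.1.ne']
      norm_num
    refine (h4.mul h3).congr_deriv ?_
    simp only [F, F', σ]
    rw [h5]
    push_cast
    ring

namespace QuadraticDifferential

variable {X : Type*} [TopologicalSpace X] [ChartedSpace ℂ X]

theorem form_eq_pullback_iff {φ : QuadraticDifferential X} {φ' : QuadraticDifferential ℂ}
    {z : X → ℂ} {U : Set X} : (∀ Q ∈ U, φ.form Q = φ'.pullback z Q) ↔
      ∀ Q ∈ U, complexDeriv z Q ^ 2 * φ'.val (z Q) = φ.val Q :=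
  forall₂_congr fun Q _ => by rw [eq_comm, pullback_eq_form_iff]

variable [IsManifold 𝓘(ℂ) ω X] {φ : QuadraticDifferential X} {φ' : QuadraticDifferential ℂ}

theorem isCanonicalCoord_iff {P : X} {z : OpenPartialHomeomorph X ℂ} :
    φ.IsCanonicalCoord φ' P z ↔ ContMDiffOn 𝓘(ℂ) 𝓘(ℂ) ω z.symm z.target ∧ P ∈ z.source ∧
      z P = 0 ∧ IsDev φ' φ z z.source := by
  unfold IsCanonicalCoord
  rw [form_eq_pullback_iff, IsManifold.mem_maximalAtlas_iff_contMDiffOn]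
  constructor
  · rintro ⟨⟨h1, h2⟩, h3, h4, h5⟩
    exact ⟨h2, h3, h4, h1, h5⟩
  · rintro ⟨h2, h3, h4, h1, h5⟩
    exact ⟨⟨h1, h2⟩, h3, h4, h5⟩

omit [IsManifold 𝓘(ℂ) ω X] in
theorem IsDev.symm {Y : Type*} [TopologicalSpace Y] [ChartedSpace ℂ Y]
    {φ' : QuadraticDifferential Y} {z : OpenPartialHomeomorph X Y} (h : IsDev φ' φ z z.source)
    (hs : ContMDiffOn 𝓘(ℂ) 𝓘(ℂ) ω z.symm z.target) : IsDev φ φ' z.symm z.target := by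
  refine ⟨hs, fun w hw => ?_⟩
  have hm := z.map_target hw
  have h1 := complexDeriv_mul_of_leftInverse (f := z.symm) (g := z) (x := w)
    (h.mdifferentiableAt z.open_source hm)
    ((hs.contMDiffAt (z.open_target.mem_nhds hw)).mdifferentiableAt (by simp))
    (z.eventually_right_inverse hw)
  rw [← h.val_eq _ hm, z.right_inv hw]
  linear_combination φ'.val w * (complexDeriv z (z.symm w) * complexDeriv z.symm w + 1) * h1

theorem IsCanonicalCoord.isDev {P : X} {z : OpenPartialHomeomorph X ℂ}
    (h : φ.IsCanonicalCoord φ' P z) : IsDev φ' φ z z.source := (isCanonicalCoord_iff.1 h).2.2.2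

theorem IsCanonicalCoord.isDev_symm {P : X} {z : OpenPartialHomeomorph X ℂ}
    (h : φ.IsCanonicalCoord φ' P z) : IsDev φ φ' z.symm z.target :=
  h.isDev.symm (isCanonicalCoord_iff.1 h).1

theorem exists_isCanonicalCoord_of_isDev {g : X → ℂ} {U : Set X} (hU : IsOpen U)
    (hg : IsDev φ' φ g U) {P : X} (hP : P ∈ U) (h0 : g P = 0) (hd : complexDeriv g P ≠ 0) :
    ∃ z, φ.IsCanonicalCoord φ' P z ∧ z.source ⊆ U ∧ EqOn z g z.source := by
  obtain ⟨Φ, h1, h2, h3⟩ := isLocalDiffeomorphAt_of_complexDeriv_ne_zero hU hg.contMDiffOn hP hd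
  let z : OpenPartialHomeomorph X ℂ := Φ.toOpenPartialHomeomorph
  have hz : EqOn z g z.source := fun y hy => (h3 hy).symm
  refine ⟨z, isCanonicalCoord_iff.2 ⟨Φ.contMDiffOn_invFun, h1, (hz h1).trans h0, ?_⟩, h2, hz⟩
  exact (hg.mono h2).congr z.open_source hz

/-- A canonical coordinate from its expression in a chart. -/
theorem exists_isCanonicalCoord_of_coeff {P : X} {m : ℂ → ℂ} {B : Set ℂ} (hB : IsOpen B)
    (hPB : chartAt ℂ P P ∈ B) (hm : DifferentiableOn ℂ m B)
    (hm0 : m (chartAt ℂ P P) = 0) (hd : deriv m (chartAt ℂ P P) ≠ 0)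
    (hc : ∀ x ∈ B, deriv m x ^ 2 * φ'.val (m x) = φ.coeff (chartAt ℂ P) x) :
    ∃ z, φ.IsCanonicalCoord φ' P z := by
  let e := chartAt ℂ P
  have hP : P ∈ e.source := mem_chart_source ℂ P
  have he : ContMDiffOn 𝓘(ℂ) 𝓘(ℂ) ω e e.source := contMDiffOn_chart
  have he' : ContMDiffOn 𝓘(ℂ) 𝓘(ℂ) ω e.symm e.target := contMDiffOn_chart_symm
  let U := e.source ∩ e ⁻¹' B
  have hU : IsOpen U := e.isOpen_inter_preimage hB
  have hne : (ω : ℕ∞ω) ≠ 0 := by simp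
  have m1 : ∀ Q ∈ e.source, MDifferentiableAt 𝓘(ℂ) 𝓘(ℂ) e Q := fun Q hQ =>
    (he.contMDiffAt (e.open_source.mem_nhds hQ)).mdifferentiableAt hne
  have inv : ∀ Q ∈ e.source, complexDeriv e.symm (e Q) * complexDeriv e Q = 1 := fun Q hQ =>
    complexDeriv_mul_of_leftInverse
      ((he'.contMDiffAt (e.open_target.mem_nhds (e.map_source hQ))).mdifferentiableAt hne)
      (m1 Q hQ) (e.eventually_left_inverse hQ)
  have dm : ∀ Q ∈ U, complexDeriv (m ∘ e) Q = deriv m (e Q) * complexDeriv e Q := fun Q hQ => by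
    rw [complexDeriv_comp ((hm.differentiableAt (hB.mem_nhds hQ.2)).mdifferentiableAt)
      (m1 Q hQ.1), complexDeriv_eq_deriv]
  have hdev : IsDev φ' φ (m ∘ e) U := by
    refine ⟨((hm.contDiffOn hB).contMDiffOn).comp (he.mono inter_subset_left) fun Q hQ => hQ.2,
      fun Q hQ => ?_⟩
    have h1 := hc _ hQ.2
    rw [coeff_eq, e.left_inv hQ.1] at h1
    rw [dm Q hQ, mul_pow]
    simp only [Function.comp_apply]
    have h2 := inv Q hQ.1
    linear_combination complexDeriv e Q ^ 2 * h1 +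
      φ.val Q * (complexDeriv e.symm (e Q) * complexDeriv e Q + 1) * h2
  obtain ⟨z, hz, -⟩ := exists_isCanonicalCoord_of_isDev hU hdev (P := P) ⟨hP, hPB⟩ hm0 (by
    rw [dm P ⟨hP, hPB⟩]
    exact mul_ne_zero hd (right_ne_zero_of_mul (inv P hP ▸ one_ne_zero)))
  exact ⟨z, hz⟩

omit [IsManifold 𝓘(ℂ) ω X] in
theorem coeff_analyticAt (φ : QuadraticDifferential X) (P : X) :
    AnalyticAt ℂ (φ.coeff (chartAt ℂ P)) (chartAt ℂ P P) :=
  (φ.holomorphic _ (chart_mem_atlas ℂ P)).analyticAt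
    ((chartAt ℂ P).open_target.mem_nhds (mem_chart_target ℂ P))

/-- If `φ = f dx ^ 2` in a chart, with `f` nonzero at `P`, a primitive of a holomorphic square root
of `f` is the coordinate. -/
theorem exists_isCanonicalCoord_modelFlat {P : X} (hP : P ∉ φ.zeros) :
    ∃ z, φ.IsCanonicalCoord modelFlat P z := by
  set e := chartAt ℂ P with he
  have hf := φ.coeff_analyticAt P
  have h0 : φ.coeff e (e P) ≠ 0 := by
    have hPs : P ∈ e.source := mem_chart_source ℂ P
    rw [coeff_eq, e.left_inv hPs]
    refine mul_ne_zero (pow_ne_zero _ ?_) fun h => hP ((mem_zeros_iff φ P).2 h)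
    refine left_ne_zero_of_mul (b := complexDeriv e P) ?_
    refine ne_of_eq_of_ne (complexDeriv_mul_of_leftInverse (g := e.symm) ?_ ?_
      (e.eventually_left_inverse hPs)) one_ne_zero
    · exact ((contMDiffOn_chart_symm (I := 𝓘(ℂ)) (n := ω)).contMDiffAt
        (e.open_target.mem_nhds (e.map_source hPs))).mdifferentiableAt (by simp)
    · exact ((contMDiffOn_chart (I := 𝓘(ℂ)) (n := ω)).contMDiffAt
        (e.open_source.mem_nhds hPs)).mdifferentiableAt (by simp)
  obtain ⟨q, hq, hq0, hqf⟩ := exists_analytic_branch hf h0 1 2 two_ne_zero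
  obtain ⟨r, hr, hB⟩ := Metric.mem_nhds_iff.1
    (inter_mem (e.open_target.mem_nhds (mem_chart_target ℂ P)) hq.eventually_analyticAt)
  have hqd : DifferentiableOn ℂ q (Metric.ball (e P) r) := fun x hx =>
    (hB hx).2.differentiableAt.differentiableWithinAt
  obtain ⟨G, hG0, hG⟩ := hqd.isExactOn_ball.with_val_at (e P) 0
  refine exists_isCanonicalCoord_of_coeff (m := G) Metric.isOpen_ball (Metric.mem_ball_self hr)
    (fun x hx => (hG x hx).differentiableAt.differentiableWithinAt) hG0 ?_ ?_
  · rw [(hG _ (Metric.mem_ball_self hr)).deriv]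
    exact hq0
  · intro x hx
    rw [(hG x hx).deriv, hqf, val_modelFlat]
    simp

/-- In a chart centred at `P` write `φ = x q(x) ^ 2 dx ^ 2`. The coordinate should satisfy `z ^ (3 /
2) = ∫ x ^ (1 / 2) q dx = x ^ (3 / 2) H`, where `(3 / 2) H + x H' = q`. Hence `z = x m` with `m ^ 3
= H ^ 2`, which involves no branch of `x ^ (1 / 2)`. -/
theorem exists_isCanonicalCoord_modelZero {P : X}
    (hP : analyticOrderAt (φ.coeff (chartAt ℂ P)) (chartAt ℂ P P) = 1) :
    ∃ z, φ.IsCanonicalCoord modelZero P z := by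
  set e := chartAt ℂ P with he
  have hf := φ.coeff_analyticAt P
  obtain ⟨g, hg, hg0, hgf⟩ := (hf.analyticOrderAt_eq_natCast (n := 1)).1 (by exact_mod_cast hP)
  obtain ⟨q, hq, hq0, hqg⟩ := exists_analytic_branch hg hg0 1 2 two_ne_zero
  have hq' : AnalyticAt ℂ (fun x => q (e P + x)) 0 := by
    refine AnalyticAt.fun_comp (g := q) (f := fun x => e P + x) ?_ (by fun_prop)
    simpa using hq
  obtain ⟨H, ρ, hρ, hH⟩ := exists_euler_solution hq'
  have hHa : AnalyticAt ℂ H 0 := by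
    refine DifferentiableOn.analyticAt (s := Metric.ball 0 ρ) (fun x hx => ?_)
      (Metric.ball_mem_nhds 0 hρ)
    exact (hH x hx).1.differentiableWithinAt
  have hH0 : H 0 ≠ 0 := by
    have := (hH 0 (Metric.mem_ball_self hρ)).2
    intro h
    rw [h] at this
    simp only [mul_zero, zero_mul, add_zero] at this
    exact hq0 this.symm
  obtain ⟨m, hm, hm0, hmH⟩ := exists_analytic_branch hHa hH0 2 3 three_ne_zero
  have key : ∀ᶠ x in 𝓝 (0 : ℂ), AnalyticAt ℂ m x ∧ m x ≠ 0 ∧ H x ≠ 0 ∧ x ∈ Metric.ball 0 ρ :=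
    hm.eventually_analyticAt.and ((hm.continuousAt.eventually_ne hm0).and
      ((hHa.continuousAt.eventually_ne hH0).and (Metric.ball_mem_nhds 0 hρ)))
  have key' := (tendsto_sub_nhds_zero_iff.2 (tendsto_id (x := 𝓝 (e P)))).eventually key
  obtain ⟨r, hr, hB⟩ := Metric.mem_nhds_iff.1
    (inter_mem (e.open_target.mem_nhds (mem_chart_target ℂ P)) (inter_mem key' hgf))
  have hder : ∀ x ∈ Metric.ball (e P) r, HasDerivAt (fun x => (x - e P) * m (x - e P))
      (m (x - e P) + (x - e P) * deriv m (x - e P)) x := by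
    intro x hx
    have h1 : HasDerivAt m (deriv m (x - e P)) (x - e P) :=
      (hB hx).2.1.1.differentiableAt.hasDerivAt
    have h2 : HasDerivAt (fun x => x - e P) 1 x := (hasDerivAt_id x).sub_const _
    exact (h2.mul (h1.comp x h2)).congr_deriv (by simp)
  refine exists_isCanonicalCoord_of_coeff (m := fun x => (x - e P) * m (x - e P))
    Metric.isOpen_ball (Metric.mem_ball_self hr)
    (fun x hx => (hder x hx).differentiableAt.differentiableWithinAt)
    (by simp [he]) ?_ ?_
  · rw [← he, (hder _ (Metric.mem_ball_self hr)).deriv]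
    simpa using hm0
  · intro x hx
    rw [(hder x hx).deriv, val_modelZero]
    obtain ⟨-, ⟨ha, hmx, hHx, hxρ⟩, hfx⟩ := hB hx
    have hfx' : φ.coeff e x = (x - e P) ^ 1 • g x := hfx
    simp only [id] at ha hmx hHx hxρ
    rw [← he, hfx', pow_one, smul_eq_mul]
    set y := x - e P with hy
    have h1 := (hH y hxρ).2
    have hxy : e P + y = x := by rw [hy]; ring
    rw [hxy] at h1
    have h2 : q x ^ 2 = g x := by simpa using hqg x
    have h3 := hmH y
    have h4 : 3 * m y ^ 2 * deriv m y = 2 * H y * deriv H y := by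
      have d1 : HasDerivAt (fun x => m x ^ 3) (3 * m y ^ 2 * deriv m y) y :=
        (ha.differentiableAt.hasDerivAt.pow 3).congr_deriv (by simp)
      have d2 : HasDerivAt (fun x => H x ^ 2) (2 * H y * deriv H y) y :=
        ((hH y hxρ).1.hasDerivAt.pow 2).congr_deriv (by simp)
      have : (fun x => m x ^ 3) = fun x => H x ^ 2 := funext hmH
      rw [this] at d1
      exact d1.unique d2
    rw [← h2, ← h1]
    apply mul_left_cancel₀ (pow_ne_zero 3 hmx)
    set M := m y
    set M' := deriv m y
    set A := H y
    set A' := deriv H y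
    have h5 : A ^ 2 * (M ^ 3 * (M + y * M') ^ 2 * ((3 / 2) ^ 2 * (y * M))) =
        A ^ 2 * (M ^ 3 * (y * (3 / 2 * A + y * A') ^ 2)) := by
      -- The factor `M ^ 2` makes the derivative of `y m` expressible through `m ^ 3 = H ^ 2` and
      -- its derivative.
      have h6 : M ^ 2 * (M + y * M') = A * (A + 2 / 3 * y * A') := by
        linear_combination h3 + y / 3 * h4
      have h7 : (M ^ 2 * (M + y * M')) ^ 2 = (A * (A + 2 / 3 * y * A')) ^ 2 := by rw [h6]
      linear_combination (9 / 4) * A ^ 2 * y * h7 -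
        (9 / 4) * A ^ 2 * y * (A + 2 / 3 * y * A') ^ 2 * h3
    have h6 := mul_left_cancel₀ (pow_ne_zero 2 hHx) h5
    linear_combination h6

end QuadraticDifferential

end

/-! ### Local comparison of `|φ|` with the two models. -/

noncomputable section

namespace QuadraticDifferential

/-- A radial model with a contraction of the corresponding growth. -/
structure IsModel {E : Type} [NormedAddCommGroup E] [NormedSpace ℝ E]
    (φ' : QuadraticDifferential ℂ) (p : ℝ) (h : ℂ → E) : Prop where
  radial : IsRadial φ' p
  contraction : IsContraction φ' h
  norm_eq : ∀ z, ‖h z‖ = ‖z‖ ^ p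

theorem isModel_flat : IsModel modelFlat 1 (fun z : ℂ => z) :=
  ⟨isRadial_modelFlat, isContraction_id, fun z => by simp⟩

/-- This contraction is real-valued and sees only radial displacement, which is enough for distances
from the zero and along radii. -/
theorem isModel_zero : IsModel modelZero (3 / 2) (fun z : ℂ => ‖z‖ ^ (3 / 2 : ℝ)) :=
  ⟨isRadial_modelZero, isContraction_norm_rpow (by norm_num) isRadial_modelZero, fun z => by
    rw [Real.norm_of_nonneg (by positivity)]⟩

variable {X : Type*} [TopologicalSpace X] [ChartedSpace ℂ X]
  {φ : QuadraticDifferential X} {φ' : QuadraticDifferential ℂ}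

theorem isDev_id (φ : QuadraticDifferential X) (U : Set X) : IsDev φ φ (fun x => x) U :=
  ⟨contMDiffOn_id, fun y _ => by rw [complexDeriv_id]; ring⟩

namespace IsModel

variable {E : Type} [NormedAddCommGroup E] [NormedSpace ℝ E] {p : ℝ} {h : ℂ → E}

theorem pos (hm : IsModel φ' p h) : 0 < p := zero_lt_one.trans_le hm.radial.1

theorem map_zero (hm : IsModel φ' p h) : h 0 = 0 := by
  rw [← norm_eq_zero, hm.norm_eq, norm_zero, Real.zero_rpow hm.pos.ne']

theorem subset_closedBall (hm : IsModel φ' p h) {ρ ℓ : ℝ} (hρ : 0 ≤ ρ) {a : E}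
    (hl : ‖a‖ + ℓ ≤ ρ ^ p) : {z | ‖h z - a‖ ≤ ℓ} ⊆ Metric.closedBall 0 ρ := by
  intro z hz
  have h1 : ‖h z‖ ≤ ‖h z - a‖ + ‖a‖ := by simpa using norm_add_le (h z - a) a
  have hz' : ‖h z - a‖ ≤ ℓ := hz
  rw [hm.norm_eq] at h1
  have h2 : ‖z‖ ^ p ≤ ρ ^ p := by linarith
  rw [mem_closedBall_zero_iff]
  exact (Real.rpow_le_rpow_iff (norm_nonneg _) hρ hm.pos).1 h2

theorem isCompact_setOf (hm : IsModel φ' p h) {ρ ℓ : ℝ} (hρ : 0 ≤ ρ) {a : E}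
    (hl : ‖a‖ + ℓ ≤ ρ ^ p) : IsCompact {z | ‖h z - a‖ ≤ ℓ} := by
  refine (isCompact_closedBall (0 : ℂ) ρ).of_isClosed_subset ?_ (hm.subset_closedBall hρ hl)
  exact isClosed_le ((hm.contraction.contDiff.continuous.sub continuous_const).norm)
    continuous_const

theorem mem_source_of_dist_lt [T2Space X] (hm : IsModel φ' p h) {z : OpenPartialHomeomorph X ℂ}
    (hz : IsDev φ' φ z z.source) {P : X} (hP : P ∈ z.source) (h0 : z P = 0) {ρ : ℝ} (hρ : 0 ≤ ρ)
    (hb : Metric.closedBall 0 ρ ⊆ z.target) {y : X} (hd : φ.dist P y < ENNReal.ofReal (ρ ^ p)) :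
    y ∈ z.source ∧ ENNReal.ofReal (‖z y‖ ^ p) ≤ φ.dist P y := by
  have hl : ‖h (z P)‖ + ρ ^ p ≤ ρ ^ p := by simp [h0, hm.map_zero]
  have := QuadraticDifferential.mem_source_of_dist_lt hz hm.contraction hP
    (hm.isCompact_setOf hρ hl) ((hm.subset_closedBall hρ hl).trans hb) hd
  refine ⟨this.1, ?_⟩
  rw [← hm.norm_eq, ofReal_norm]
  simpa [h0, hm.map_zero] using this.2

theorem exists_nhds_enorm_sub_le [T2Space X] (hm : IsModel φ' p h)
    {z : OpenPartialHomeomorph X ℂ} (hz : IsDev φ' φ z z.source) {P : X} (hP : P ∈ z.source)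
    (h0 : z P = 0) : ∃ N ∈ 𝓝 P, N ⊆ z.source ∧
      ∀ x ∈ N, ∀ y ∈ N, ‖h (z y) - h (z x)‖ₑ ≤ φ.dist x y := by
  have ht : z.target ∈ 𝓝 (0 : ℂ) := z.open_target.mem_nhds (h0 ▸ z.map_source hP)
  obtain ⟨ρ, hρ, hb⟩ := Metric.nhds_basis_closedBall.mem_iff.1 ht
  have hρp : 0 < ρ ^ p := Real.rpow_pos_of_pos hρ p
  have hc : ContinuousAt (fun x => ‖h (z x)‖) P :=
    (hm.contraction.contDiff.continuous.continuousAt.comp (z.continuousAt hP)).norm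
  -- With a third of `ρ ^ p` there are two cases. A path shorter than `2 ρ ^ p / 3` stays in the
  -- coordinate, since the two bounds add up to `ρ ^ p`; otherwise the distance already exceeds the
  -- sum of the two norms.
  have hN : {x | ‖h (z x)‖ < ρ ^ p / 3} ∈ 𝓝 P := by
    refine hc.eventually_lt continuousAt_const ?_
    rw [h0, hm.map_zero, norm_zero]
    positivity
  refine ⟨z.source ∩ {x | ‖h (z x)‖ < ρ ^ p / 3}, inter_mem (z.open_source.mem_nhds hP) hN,
    inter_subset_left, fun x hx y hy => ?_⟩
  have hx2 : ‖h (z x)‖ < ρ ^ p / 3 := hx.2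
  have hy2 : ‖h (z y)‖ < ρ ^ p / 3 := hy.2
  rcases lt_or_ge (φ.dist x y) (ENNReal.ofReal (2 * ρ ^ p / 3)) with hlt | hge
  · have hl : ‖h (z x)‖ + 2 * ρ ^ p / 3 ≤ ρ ^ p := by linarith
    exact (QuadraticDifferential.mem_source_of_dist_lt hz hm.contraction hx.1
      (hm.isCompact_setOf hρ.le hl) ((hm.subset_closedBall hρ.le hl).trans hb) hlt).2
  · refine le_trans ?_ hge
    rw [← ofReal_norm]
    refine ENNReal.ofReal_le_ofReal ((norm_sub_le _ _).trans ?_)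
    linarith

theorem exists_ball_subset [T2Space X] (hm : IsModel φ' p h)
    {z : OpenPartialHomeomorph X ℂ} (hz : IsDev φ' φ z z.source) {P : X} (hP : P ∈ z.source)
    (h0 : z P = 0) {N : Set X} (hN : N ∈ 𝓝 P) : ∃ ε > 0, φ.ball P ε ⊆ N := by
  have ht : z.target ∈ 𝓝 (0 : ℂ) := z.open_target.mem_nhds (h0 ▸ z.map_source hP)
  have hc : ContinuousAt z.symm 0 := z.symm.continuousAt (h0 ▸ z.map_source hP)
  have hs : z.symm 0 = P := by rw [← h0, z.left_inv hP]
  obtain ⟨ρ, hρ, hb⟩ := Metric.nhds_basis_closedBall.mem_iff.1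
    (inter_mem ht (hc (hs.symm ▸ hN)))
  refine ⟨ENNReal.ofReal (ρ ^ p), by simpa using Real.rpow_pos_of_pos hρ p, fun y hy => ?_⟩
  obtain ⟨h1, h2⟩ := hm.mem_source_of_dist_lt hz hP h0 hρ.le (fun v hv => (hb hv).1) hy
  have h3 := h2.trans_lt hy
  rw [ENNReal.ofReal_lt_ofReal_iff_of_nonneg (by positivity)] at h3
  have h4 : z y ∈ Metric.closedBall (0 : ℂ) ρ := by
    rw [mem_closedBall_zero_iff]
    exact ((Real.rpow_lt_rpow_iff (norm_nonneg _) hρ.le hm.pos).1 h3).le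
  have := (hb h4).2
  rwa [mem_preimage, z.left_inv h1] at this

theorem tendsto_dist (hm : IsModel φ' p h)
    {z : OpenPartialHomeomorph X ℂ} (hz : IsDev φ φ' z.symm z.target) {P : X} (hP : P ∈ z.source)
    (h0 : z P = 0) : Tendsto (fun y => φ.dist P y) (𝓝 P) (𝓝 0) := by
  have ht : z.target ∈ 𝓝 (0 : ℂ) := z.open_target.mem_nhds (h0 ▸ z.map_source hP)
  have hs : z.symm 0 = P := by rw [← h0, z.left_inv hP]
  obtain ⟨ρ, hρ, hb⟩ := Metric.mem_nhds_iff.1 ht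
  have hc : Tendsto (fun y => ENNReal.ofReal (‖z y‖ ^ p)) (𝓝 P) (𝓝 0) := by
    have h1 : Tendsto (fun y => ‖z y‖ ^ p) (𝓝 P) (𝓝 0) := by
      have := ((z.continuousAt hP).norm.rpow_const (Or.inr hm.pos.le)).tendsto
      rwa [h0, norm_zero, Real.zero_rpow hm.pos.ne'] at this
    simpa using ENNReal.tendsto_ofReal h1
  refine tendsto_of_tendsto_of_tendsto_of_le_of_le' tendsto_const_nhds hc
    (Eventually.of_forall fun _ => zero_le) ?_
  have hev : ∀ᶠ y in 𝓝 P, z y ∈ Metric.ball (0 : ℂ) ρ :=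
    (z.continuousAt hP) (by rw [h0]; exact Metric.ball_mem_nhds 0 hρ)
  filter_upwards [hev, z.open_source.mem_nhds hP] with y hy hys
  have := dist_le_norm_rpow hm.radial Metric.isOpen_ball (hz.mono hb) (w := z y) fun u hu => by
    rw [mem_ball_zero_iff] at hy ⊢
    rw [norm_mul, Complex.norm_real, Real.norm_of_nonneg hu.1]
    nlinarith [hu.1, hu.2, norm_nonneg (z y)]
  rwa [hs, z.left_inv hys] at this

end IsModel

theorem complexDeriv_ne_zero_of_val_ne_zero {Y : Type*} [TopologicalSpace Y] [ChartedSpace ℂ Y]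
    {φ' : QuadraticDifferential Y} {f : Y → X} {U : Set Y} (h : IsDev φ φ' f U) {y : Y}
    (hy : y ∈ U) (hv : φ'.val y ≠ 0) : complexDeriv f y ≠ 0 ∧ φ.val (f y) ≠ 0 := by
  have := h.val_eq y hy
  constructor
  · intro h0
    rw [h0] at this
    simp only [ne_eq, OfNat.ofNat_ne_zero, not_false_eq_true, zero_pow, zero_mul] at this
    exact hv this.symm
  · intro h0
    rw [h0, mul_zero] at this
    exact hv this.symm

variable [IsManifold 𝓘(ℂ) ω X]

theorem IsCanonicalCoord.mem_zeros_iff {P : X} {z : OpenPartialHomeomorph X ℂ}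
    (hz : φ.IsCanonicalCoord φ' P z) {Q : X} (hQ : Q ∈ z.source) :
    Q ∈ φ.zeros ↔ φ'.val (z Q) = 0 := by
  rw [QuadraticDifferential.mem_zeros_iff]
  have h1 := hz.isDev.val_eq Q hQ
  have h2 := hz.isDev_symm.val_eq (z Q) (z.map_source hQ)
  rw [z.left_inv hQ] at h2
  constructor
  · intro h
    rw [← h2, h, mul_zero]
  · intro h
    rw [← h1, h, mul_zero]

/-- Near every point the metric `|φ|` is one of the two models. -/
theorem exists_isModel (hφ : φ.HasSimpleZeros) (P : X) :
    ∃ (φ' : QuadraticDifferential ℂ) (p : ℝ) (E : Type) (_ : NormedAddCommGroup E)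
      (_ : NormedSpace ℝ E) (h : ℂ → E) (z : OpenPartialHomeomorph X ℂ),
      IsModel φ' p h ∧ φ.IsCanonicalCoord φ' P z ∧ ∀ w, φ'.val w = 0 → w = 0 := by
  by_cases hP : P ∈ φ.zeros
  · obtain ⟨z, hz⟩ := exists_isCanonicalCoord_modelZero (hφ P hP)
    exact ⟨_, _, _, _, _, _, z, isModel_zero, hz, fun w hw => by simpa using hw⟩
  · obtain ⟨z, hz⟩ := exists_isCanonicalCoord_modelFlat hP
    exact ⟨_, _, _, _, _, _, z, isModel_flat, hz, fun w hw => by simp at hw⟩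

/-- Together with `tendsto_dist`, this says that `d_φ` induces the topology of `X`. -/
theorem exists_ball_subset [T2Space X] (hφ : φ.HasSimpleZeros) {P : X} {N : Set X}
    (hN : N ∈ 𝓝 P) : ∃ ε > 0, φ.ball P ε ⊆ N := by
  obtain ⟨φ', p, E, _, _, h, z, hm, hz, -⟩ := exists_isModel hφ P
  have := isCanonicalCoord_iff.1 hz
  exact hm.exists_ball_subset this.2.2.2 this.2.1 this.2.2.1 hN

theorem tendsto_dist (hφ : φ.HasSimpleZeros) (P : X) :
    Tendsto (fun y => φ.dist P y) (𝓝 P) (𝓝 0) := by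
  obtain ⟨φ', p, E, _, _, h, z, hm, hz, -⟩ := exists_isModel hφ P
  have := isCanonicalCoord_iff.1 hz
  exact hm.tendsto_dist hz.isDev_symm this.2.1 this.2.2.1

theorem tendsto_of_tendsto_dist [T2Space X] (hφ : φ.HasSimpleZeros) {P : X} {ι : Type*}
    {l : Filter ι} {f : ι → X} (h : Tendsto (fun i => φ.dist P (f i)) l (𝓝 0)) :
    Tendsto f l (𝓝 P) := by
  intro N hN
  obtain ⟨ε, hε, hb⟩ := exists_ball_subset hφ hN
  exact (h.eventually (gt_mem_nhds hε)).mono fun i hi => hb hi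

/-- The domain of a canonical coordinate contains no zero other than possibly its centre;
compactness does the rest. -/
theorem zeros_finite [CompactSpace X] (hφ : φ.HasSimpleZeros) : φ.zeros.Finite := by
  have hN : ∀ P : X, ∃ N ∈ 𝓝 P, N ∩ φ.zeros ⊆ {P} := by
    intro P
    obtain ⟨φ', p, E, _, _, h, z, -, hz, hv⟩ := exists_isModel hφ P
    have hc := isCanonicalCoord_iff.1 hz
    refine ⟨z.source, z.open_source.mem_nhds hc.2.1, fun Q hQ => ?_⟩
    have := hv _ ((hz.mem_zeros_iff hQ.1).1 hQ.2)
    exact z.injOn hQ.1 hc.2.1 (this.trans hc.2.2.1.symm)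
  choose N hN hNz using hN
  obtain ⟨t, -, ht⟩ := isCompact_univ.elim_nhds_subcover N fun P _ => hN P
  refine t.finite_toSet.subset fun Q hQ => ?_
  obtain ⟨P, hP, hQP⟩ := mem_iUnion₂.1 (ht (mem_univ Q))
  have : Q = P := hNz P ⟨hQP, hQ⟩
  exact this ▸ hP

theorem distZeros_pos [T2Space X] {P : X} (hφ : φ.HasSimpleZeros) (hP : P ∉ φ.zeros) :
    0 < φ.distZeros P := by
  obtain ⟨z, hz⟩ := exists_isCanonicalCoord_modelFlat hP
  have hc := isCanonicalCoord_iff.1 hz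
  obtain ⟨ε, hε, hb⟩ := exists_ball_subset hφ (z.open_source.mem_nhds hc.2.1)
  refine hε.trans_le (le_iInf₂ fun Q hQ => ?_)
  by_contra hlt
  have := (hz.mem_zeros_iff (hb (not_le.1 hlt))).1 hQ
  simp at this

/-- A flat coordinate is an isometry near its origin. -/
theorem exists_nhds_dist_eq [T2Space X] {P : X} {z : OpenPartialHomeomorph X ℂ}
    (hz : φ.IsCanonicalCoord modelFlat P z) :
    ∃ N ∈ 𝓝 P, N ⊆ z.source ∧ ∀ x ∈ N, ∀ y ∈ N, φ.dist x y = ENNReal.ofReal ‖z y - z x‖ := by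
  have hc := isCanonicalCoord_iff.1 hz
  obtain ⟨N, hN, hNs, hNd⟩ := isModel_flat.exists_nhds_enorm_sub_le hc.2.2.2 hc.2.1 hc.2.2.1
  have ht : z.target ∈ 𝓝 (0 : ℂ) :=
    z.open_target.mem_nhds (hc.2.2.1 ▸ z.map_source hc.2.1)
  obtain ⟨ρ, hρ, hb⟩ := Metric.mem_nhds_iff.1 ht
  have hev : z ⁻¹' Metric.ball (0 : ℂ) ρ ∈ 𝓝 P :=
    (z.continuousAt hc.2.1) (by rw [hc.2.2.1]; exact Metric.ball_mem_nhds 0 hρ)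
  refine ⟨N ∩ z ⁻¹' Metric.ball (0 : ℂ) ρ, inter_mem hN hev, fun x hx => hNs hx.1,
    fun x hx y hy => le_antisymm ?_ ?_⟩
  · have := dist_le_of_modelFlat Metric.isOpen_ball (hz.isDev_symm.mono hb)
      ((convex_ball (0 : ℂ) ρ).segment_subset hx.2 hy.2)
    rwa [z.left_inv (hNs hx.1), z.left_inv (hNs hy.1)] at this
  · rw [ofReal_norm]
    exact hNd x hx.1 y hy.1

end QuadraticDifferential

end

/-! ### Continuation of developing maps to larger discs. -/

noncomputable section

namespace QuadraticDifferential

variable {X : Type*} [TopologicalSpace X] [ChartedSpace ℂ X] [T2Space X] [IsManifold 𝓘(ℂ) ω X]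
  {φ : QuadraticDifferential X} {φ' : QuadraticDifferential ℂ}

theorem tendsto_ofReal_mul (w : ℂ) :
    Tendsto (fun t : ℝ => (t : ℂ) * w) (𝓝[<] 1) (𝓝 w) := by
  have : ContinuousAt (fun t : ℝ => (t : ℂ) * w) 1 := by fun_prop
  have h2 := this.tendsto
  simp only [Complex.ofReal_one, one_mul] at h2
  exact h2.mono_left nhdsWithin_le_nhds

/-- A developing map which has a limit outside the zeros along a radius extends past the end of
that radius. -/
theorem exists_extension_at_boundary {ψ : ℂ → X} {R : ℝ}
    (hψ : IsDev φ φ' ψ (Metric.ball 0 R)) {w : ℂ} (hw : ‖w‖ = R) (hR : 0 < R)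
    (hv : φ'.val w ≠ 0) {Q : X} (hQ : Q ∉ φ.zeros)
    (hlim : Tendsto (fun t : ℝ => ψ (t * w)) (𝓝[<] 1) (𝓝 Q)) :
    ∃ ε > 0, ∃ ψ' : ℂ → X, IsDev φ φ' ψ' (Metric.ball w ε) ∧
      EqOn ψ' ψ (Metric.ball 0 R ∩ Metric.ball w ε) := by
  obtain ⟨s, hs⟩ := exists_isCanonicalCoord_modelFlat (φ := φ') (P := w)
    (fun h => hv ((mem_zeros_iff φ' w).1 h))
  obtain ⟨ζ, hζ⟩ := exists_isCanonicalCoord_modelFlat hQ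
  have hsc := isCanonicalCoord_iff.1 hs
  have hζc := isCanonicalCoord_iff.1 hζ
  obtain ⟨r, hr, hrb⟩ := Metric.mem_nhds_iff.1
    (ζ.open_target.mem_nhds (hζc.2.2.1 ▸ ζ.map_source hζc.2.1))
  obtain ⟨ε, hε, hεb⟩ := Metric.mem_nhds_iff.1 (inter_mem (s.open_source.mem_nhds hsc.2.1)
    ((s.continuousAt hsc.2.1) (by rw [hsc.2.2.1]; exact Metric.ball_mem_nhds 0 hr)))
  have hne : ∀ z ∈ s.source, φ'.val z ≠ 0 := by
    intro z hz h0
    have := (hs.mem_zeros_iff hz).1 ((mem_zeros_iff φ' z).2 h0)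
    simp at this
  let O := (Metric.ball (0 : ℂ) R ∩ Metric.ball w ε) ∩ ψ ⁻¹' ζ.source
  have hO : IsOpen O := (hψ.continuousOn.mono inter_subset_left).isOpen_inter_preimage
    (Metric.isOpen_ball.inter Metric.isOpen_ball) ζ.open_source
  have hray : Tendsto (fun t : ℝ => (t : ℂ) * w) (𝓝[<] 1) (𝓝 w) := tendsto_ofReal_mul w
  have hev : ∀ᶠ t : ℝ in 𝓝[<] 1, (t : ℂ) * w ∈ O := by
    have h0 : ∀ᶠ t : ℝ in 𝓝[<] 1, 0 < t :=
      nhdsWithin_le_nhds (lt_mem_nhds one_pos)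
    filter_upwards [hray (Metric.ball_mem_nhds w hε), hlim (ζ.open_source.mem_nhds hζc.2.1),
      self_mem_nhdsWithin, h0] with t h1 h2 h3 h4
    refine ⟨⟨?_, h1⟩, h2⟩
    rw [mem_ball_zero_iff, norm_mul, Complex.norm_real, Real.norm_of_nonneg h4.le, hw]
    have : t < 1 := h3
    nlinarith
  obtain ⟨a, ha, haO⟩ := mem_nhdsLT_iff_exists_Ioo_subset.1 hev
  have ha1 : a < 1 := ha
  obtain ⟨t₀, ht₀a, ht₀1⟩ := exists_between ha1
  let S := (fun t : ℝ => (t : ℂ) * w) '' Ico t₀ 1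
  have hSO : S ⊆ O := by
    rintro _ ⟨t, ht, rfl⟩
    exact haO ⟨ht₀a.trans_le ht.1, ht.2⟩
  have hSc : IsPreconnected S := isPreconnected_Ico.image _ (by fun_prop)
  have hx₀S : (t₀ : ℂ) * w ∈ S := ⟨t₀, ⟨le_rfl, ht₀1⟩, rfl⟩
  -- The flat coordinates `ζ ∘ ψ` and `s` can be compared only on a connected set; this component
  -- contains the end of the radius.
  let C := connectedComponentIn O (t₀ * w)
  have hCo : IsOpen C := hO.connectedComponentIn
  have hCO : C ⊆ O := connectedComponentIn_subset _ _
  have hSC : S ⊆ C := hSc.subset_connectedComponentIn hx₀S hSO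
  have hf : IsDev modelFlat φ' (ζ ∘ ψ) C :=
    hζ.isDev.comp (hψ.mono fun x hx => (hCO hx).1.1) ζ.open_source hCo fun x hx => (hCO hx).2
  have hg : IsDev modelFlat φ' s C := hs.isDev.mono fun x hx => (hεb (hCO hx).1.2).1
  obtain ⟨η, c, hη, heq⟩ := hf.eq_neg_or_eq_add hCo isPreconnected_connectedComponentIn hg
    fun z hz => hne z (hεb (hCO hz).1.2).1
  -- Both coordinates tend to `0` along the radius, so there is no translation.
  have hc0 : c = 0 := by
    have h1 : Tendsto (fun t : ℝ => ζ (ψ (t * w))) (𝓝[<] 1) (𝓝 0) := by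
      have := (ζ.continuousAt hζc.2.1).tendsto.comp hlim
      rwa [hζc.2.2.1] at this
    have h2 : Tendsto (fun t : ℝ => η * s (t * w) + c) (𝓝[<] 1) (𝓝 (η * 0 + c)) := by
      have := (s.continuousAt hsc.2.1).tendsto.comp hray
      rw [hsc.2.2.1] at this
      exact (this.const_mul η).add_const c
    have h3 : (fun t : ℝ => ζ (ψ (t * w))) =ᶠ[𝓝[<] 1] fun t : ℝ => η * s (t * w) + c := by
      filter_upwards [Ioo_mem_nhdsLT ht₀1] with t ht
      exact heq _ (hSC ⟨t, ⟨ht.1.le, ht.2⟩, rfl⟩)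
    have := tendsto_nhds_unique_of_eventuallyEq h1 h2 h3
    simpa using this.symm
  subst hc0
  have hηn : ‖η‖ = 1 := by rcases hη with rfl | rfl <;> simp
  -- On `C` the map `ψ` equals `ζ.symm (η * s)`, and this expression makes sense on the whole ball
  -- around `w`.
  have hd : IsDev φ φ' (ζ.symm ∘ ((fun z => η * z + 0) ∘ s)) (Metric.ball w ε) := by
    refine IsDev.comp (hζ.isDev_symm.mono hrb)
      (IsDev.comp (isDev_affine hη univ) (hs.isDev.mono fun x hx => (hεb hx).1) isOpen_univ
        Metric.isOpen_ball fun _ _ => mem_univ _) Metric.isOpen_ball Metric.isOpen_ball ?_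
    intro x hx
    have := (hεb hx).2
    rw [mem_preimage, mem_ball_zero_iff] at this
    simpa [hηn] using this
  refine ⟨ε, hε, _, hd, ?_⟩
  refine eqOn_of_contMDiffOn_of_eventuallyEq (Metric.isOpen_ball.inter Metric.isOpen_ball)
    ((convex_ball _ _).inter (convex_ball _ _)).isPreconnected
    (hd.contMDiffOn.mono inter_subset_right) (hψ.contMDiffOn.mono inter_subset_left)
    (z := t₀ * w) (hSO hx₀S).1 ?_
  filter_upwards [hCo.mem_nhds (hSC hx₀S)] with x hx
  have := heq x hx
  simp only [Function.comp_apply] at this ⊢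
  rw [← this, ζ.left_inv (hCO hx).2]

/-- A developing map on a disc which extends near each boundary point extends to a larger disc. -/
theorem exists_extension_of_boundary {ψ : ℂ → X} {R : ℝ} (hR : 0 < R)
    (hψ : IsDev φ φ' ψ (Metric.ball 0 R))
    (hb : ∀ w : ℂ, ‖w‖ = R → ∃ ε > 0, ∃ ψ' : ℂ → X, IsDev φ φ' ψ' (Metric.ball w ε) ∧
      EqOn ψ' ψ (Metric.ball 0 R ∩ Metric.ball w ε)) :
    ∃ R' > R, ∃ Ψ : ℂ → X, IsDev φ φ' Ψ (Metric.ball 0 R') ∧ EqOn Ψ ψ (Metric.ball 0 R) := by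
  classical
  have : Nonempty X := ⟨ψ 0⟩
  choose! ε hε ψ' hψ' heq using hb
  have hagree : ∀ w₁ w₂ : ℂ, ‖w₁‖ = R → ‖w₂‖ = R →
      EqOn (ψ' w₁) (ψ' w₂) (Metric.ball w₁ (ε w₁) ∩ Metric.ball w₂ (ε w₂)) := by
    intro w₁ w₂ h₁ h₂ x hx
    by_cases hne : w₁ = w₂
    · rw [hne]
    have e₁ := hε w₁ h₁
    have e₂ := hε w₂ h₂
    have hsum : 0 < ε w₁ + ε w₂ := add_pos e₁ e₂
    have hdist : ‖w₁ - w₂‖ < ε w₁ + ε w₂ := by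
      have h3 : Dist.dist w₁ w₂ ≤ Dist.dist w₁ x + Dist.dist x w₂ := _root_.dist_triangle _ _ _
      have h4 := Metric.mem_ball.1 hx.1
      have h5 := Metric.mem_ball.1 hx.2
      rw [_root_.dist_comm] at h4
      rw [← dist_eq_norm]
      linarith
    -- The point `q` divides the segment from `w₁` to `w₂` in the ratio of the radii, so it lies in
    -- both balls. By strict convexity it also lies inside the disc, where both extensions equal
    -- `ψ`.
    let a : ℝ := ε w₂ / (ε w₁ + ε w₂)
    let b : ℝ := ε w₁ / (ε w₁ + ε w₂)
    have ha : 0 < a := div_pos e₂ hsum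
    have hb' : 0 < b := div_pos e₁ hsum
    have hab : a + b = 1 := by
      simp only [a, b]
      field_simp
      ring
    let q : ℂ := a • w₁ + b • w₂
    have hq₀ : q ∈ Metric.ball (0 : ℂ) R := by
      rw [mem_ball_zero_iff]
      exact norm_combo_lt_of_ne h₁.le h₂.le hne ha hb' hab
    have hq₁ : q ∈ Metric.ball w₁ (ε w₁) := by
      have : q - w₁ = b • (w₂ - w₁) := by
        have : w₁ = (a + b) • w₁ := by rw [hab, one_smul]
        rw [this]
        simp only [q, hab, one_smul]
        rw [show a = 1 - b by linarith, sub_smul, one_smul, smul_sub]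
        ring
      rw [Metric.mem_ball, dist_eq_norm, this, norm_smul, Real.norm_of_nonneg hb'.le,
        norm_sub_rev]
      calc b * ‖w₁ - w₂‖ < b * (ε w₁ + ε w₂) := by gcongr
        _ = ε w₁ := by simp only [b]; field_simp
    have hq₂ : q ∈ Metric.ball w₂ (ε w₂) := by
      have : q - w₂ = a • (w₁ - w₂) := by
        simp only [q]
        rw [show b = 1 - a by linarith, sub_smul, one_smul, smul_sub]
        ring
      rw [Metric.mem_ball, dist_eq_norm, this, norm_smul, Real.norm_of_nonneg ha.le]
      calc a * ‖w₁ - w₂‖ < a * (ε w₁ + ε w₂) := by gcongr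
        _ = ε w₂ := by simp only [a]; field_simp
    refine eqOn_of_contMDiffOn_of_eventuallyEq (Metric.isOpen_ball.inter Metric.isOpen_ball)
      ((convex_ball _ _).inter (convex_ball _ _)).isPreconnected
      ((hψ' w₁ h₁).contMDiffOn.mono inter_subset_left)
      ((hψ' w₂ h₂).contMDiffOn.mono inter_subset_right) (z := q) ⟨hq₁, hq₂⟩ ?_ hx
    filter_upwards [Metric.isOpen_ball.mem_nhds hq₀, Metric.isOpen_ball.mem_nhds hq₁,
      Metric.isOpen_ball.mem_nhds hq₂] with y hy hy₁ hy₂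
    rw [heq w₁ h₁ ⟨hy, hy₁⟩, heq w₂ h₂ ⟨hy, hy₂⟩]
  let Ψ : ℂ → X := fun x =>
    if h : ‖x‖ < R then ψ x else
      if h' : ∃ w : ℂ, ‖w‖ = R ∧ x ∈ Metric.ball w (ε w) then ψ' h'.choose x else ψ x
  have hΨ₀ : EqOn Ψ ψ (Metric.ball 0 R) := by
    intro x hx
    rw [mem_ball_zero_iff] at hx
    simp only [Ψ, dif_pos hx]
  have hΨ₁ : ∀ w : ℂ, ‖w‖ = R → EqOn Ψ (ψ' w) (Metric.ball w (ε w)) := by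
    intro w hw x hx
    by_cases hxR : ‖x‖ < R
    · simp only [Ψ, dif_pos hxR]
      exact (heq w hw ⟨mem_ball_zero_iff.2 hxR, hx⟩).symm
    · have h' : ∃ w : ℂ, ‖w‖ = R ∧ x ∈ Metric.ball w (ε w) := ⟨w, hw, hx⟩
      simp only [Ψ, dif_neg hxR, dif_pos h']
      exact hagree _ w h'.choose_spec.1 hw ⟨h'.choose_spec.2, hx⟩
  let U : Set ℂ := Metric.ball 0 R ∪ ⋃ w ∈ Metric.sphere (0 : ℂ) R, Metric.ball w (ε w)
  have hU : IsOpen U := Metric.isOpen_ball.union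
    (isOpen_biUnion fun _ _ => Metric.isOpen_ball)
  have hsub : Metric.closedBall (0 : ℂ) R ⊆ U := by
    intro x hx
    rcases (mem_closedBall_zero_iff.1 hx).lt_or_eq with h | h
    · exact Or.inl (mem_ball_zero_iff.2 h)
    · exact Or.inr (mem_iUnion₂.2 ⟨x, by simpa using h, Metric.mem_ball_self (hε x h)⟩)
  -- Compactness makes the enlargement uniform in the boundary point.
  obtain ⟨δ, hδ, hδU⟩ := (isCompact_closedBall (0 : ℂ) R).exists_thickening_subset_open hU hsub
  rw [thickening_closedBall hδ hR.le] at hδU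
  refine ⟨δ + R, by linarith, Ψ, ?_, hΨ₀⟩
  refine IsDev.mono (IsDev.of_locally fun y hy => ?_) hδU
  rcases hy with hy | hy
  · exact ⟨_, Metric.isOpen_ball, hy, ψ, hψ, hΨ₀⟩
  · obtain ⟨w, hw, hyw⟩ := mem_iUnion₂.1 hy
    have hw' : ‖w‖ = R := by simpa using hw
    exact ⟨_, Metric.isOpen_ball, hyw, ψ' w, hψ' w hw', hΨ₁ w hw'⟩

/-- Developing maps on concentric discs with the same germ glue. -/
theorem exists_isDev_iUnion {ψ₀ : ℂ → X} {S : Set ℝ} (hS : ∀ r ∈ S, 0 < r)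
    (hψ : ∀ r ∈ S, ∃ ψ : ℂ → X, IsDev φ φ' ψ (Metric.ball 0 r) ∧ ψ =ᶠ[𝓝 0] ψ₀)
    (hne : S.Nonempty) :
    ∃ ψ : ℂ → X, IsDev φ φ' ψ (⋃ r ∈ S, Metric.ball 0 r) ∧ ψ =ᶠ[𝓝 0] ψ₀ := by
  classical
  have : Nonempty X := ⟨ψ₀ 0⟩
  choose! ψ hψd hψ0 using hψ
  have hagree : ∀ r ∈ S, ∀ r' ∈ S, EqOn (ψ r) (ψ r') (Metric.ball 0 r ∩ Metric.ball 0 r') := by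
    intro r hr r' hr'
    exact eqOn_of_contMDiffOn_of_eventuallyEq (Metric.isOpen_ball.inter Metric.isOpen_ball)
      ((convex_ball _ _).inter (convex_ball _ _)).isPreconnected
      ((hψd r hr).contMDiffOn.mono inter_subset_left)
      ((hψd r' hr').contMDiffOn.mono inter_subset_right)
      ⟨Metric.mem_ball_self (hS r hr), Metric.mem_ball_self (hS r' hr')⟩
      ((hψ0 r hr).trans (hψ0 r' hr').symm)
  let Ψ : ℂ → X := fun x =>
    if h : ∃ r ∈ S, x ∈ Metric.ball (0 : ℂ) r then ψ h.choose x else ψ₀ x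
  have hΨ : ∀ r ∈ S, EqOn Ψ (ψ r) (Metric.ball 0 r) := by
    intro r hr x hx
    have h : ∃ r ∈ S, x ∈ Metric.ball (0 : ℂ) r := ⟨r, hr, hx⟩
    simp only [Ψ, dif_pos h]
    exact hagree _ h.choose_spec.1 r hr ⟨h.choose_spec.2, hx⟩
  refine ⟨Ψ, IsDev.of_locally fun y hy => ?_, ?_⟩
  · obtain ⟨r, hr, hyr⟩ := mem_iUnion₂.1 hy
    exact ⟨_, Metric.isOpen_ball, hyr, ψ r, hψd r hr, hΨ r hr⟩
  · obtain ⟨r, hr⟩ := hne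
    exact ((hΨ r hr).eventuallyEq_of_mem (Metric.ball_mem_nhds 0 (hS r hr))).trans (hψ0 r hr)

/-- Exhausting by discs of real radius treats finite and infinite `T` alike. -/
theorem disc_eq_iUnion (T : ℝ≥0∞) :
    disc T = ⋃ r ∈ {r : ℝ | 0 < r ∧ ENNReal.ofReal r ≤ T}, Metric.ball (0 : ℂ) r := by
  ext x
  simp only [disc, mem_ofPred_eq, mem_iUnion, mem_ball_zero_iff, exists_prop]
  rw [← ofReal_norm]
  constructor
  · intro hx
    obtain ⟨q, hq1, hq2⟩ := ENNReal.lt_iff_exists_real_btwn.1 hx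
    have h3 := (ENNReal.ofReal_lt_ofReal_iff_of_nonneg (norm_nonneg x)).1 hq2.1
    exact ⟨q, ⟨(norm_nonneg x).trans_lt h3, hq2.2.le⟩, h3⟩
  · rintro ⟨r, ⟨hr, hrT⟩, hxr⟩
    exact ((ENNReal.ofReal_lt_ofReal_iff hr).2 hxr).trans_le hrT

/-- A germ of a developing map extends to the disc of radius `T`, provided that every extension
to a smaller disc has radial limits outside the zeros. -/
theorem exists_isDev_disc (hv : ∀ w, φ'.val w = 0 → w = 0) {ψ₀ : ℂ → X} {δ : ℝ} (hδ : 0 < δ)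
    (h₀ : IsDev φ φ' ψ₀ (Metric.ball 0 δ)) {T : ℝ≥0∞} (hT : 0 < T)
    (hlim : ∀ R, 0 < R → ENNReal.ofReal R < T → ∀ ψ : ℂ → X, IsDev φ φ' ψ (Metric.ball 0 R) →
      ψ =ᶠ[𝓝 0] ψ₀ → ∀ w : ℂ, ‖w‖ = R →
        ∃ Q ∉ φ.zeros, Tendsto (fun t : ℝ => ψ (t * w)) (𝓝[<] 1) (𝓝 Q)) :
    ∃ ψ : ℂ → X, IsDev φ φ' ψ (disc T) ∧ ψ =ᶠ[𝓝 0] ψ₀ := by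
  let S : Set ℝ := {r | 0 < r ∧ ∃ ψ : ℂ → X, IsDev φ φ' ψ (Metric.ball 0 r) ∧ ψ =ᶠ[𝓝 0] ψ₀}
  have hδS : δ ∈ S := ⟨hδ, ψ₀, h₀, EventuallyEq.rfl⟩
  have hdown : ∀ r ∈ S, ∀ r', 0 < r' → r' ≤ r → r' ∈ S := by
    rintro r ⟨-, ψ, hψ, h⟩ r' h0 hr'
    exact ⟨h0, ψ, hψ.mono (Metric.ball_subset_ball hr'), h⟩
  -- A bounded set of admissible radii contains its supremum, which can be increased.
  have hmain : ∀ r, 0 < r → ENNReal.ofReal r ≤ T → r ∈ S := by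
    intro r₀ hr₀ hr₀T
    by_contra hr₀S
    have hub : ∀ r ∈ S, r ≤ r₀ := fun r hr => by
      by_contra hlt
      exact hr₀S (hdown r hr r₀ hr₀ (not_le.1 hlt).le)
    have hbdd : BddAbove S := ⟨r₀, hub⟩
    set R := sSup S with hRdef
    have hR : 0 < R := hδ.trans_le (le_csSup hbdd hδS)
    obtain ⟨ψ, hψ, hψ0⟩ := exists_isDev_iUnion (S := S) (ψ₀ := ψ₀) (fun r hr => hr.1)
      (fun r hr => hr.2) ⟨δ, hδS⟩
    have hballs : Metric.ball (0 : ℂ) R ⊆ ⋃ r ∈ S, Metric.ball 0 r := by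
      intro x hx
      rw [mem_ball_zero_iff] at hx
      obtain ⟨r, hr, hxr⟩ := exists_lt_of_lt_csSup ⟨δ, hδS⟩ hx
      exact mem_iUnion₂.2 ⟨r, hr, mem_ball_zero_iff.2 hxr⟩
    have hRS : R ∈ S := ⟨hR, ψ, hψ.mono hballs, hψ0⟩
    have hRr₀ : R < r₀ := (csSup_le ⟨δ, hδS⟩ hub).lt_of_ne fun h => hr₀S (h ▸ hRS)
    have hRT : ENNReal.ofReal R < T := ((ENNReal.ofReal_lt_ofReal_iff hr₀).2 hRr₀).trans_le hr₀T
    obtain ⟨R', hR', Ψ, hΨ, hΨψ⟩ := exists_extension_of_boundary hR (hψ.mono hballs)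
      fun w hw => by
        obtain ⟨Q, hQ, hQl⟩ := hlim R hR hRT ψ (hψ.mono hballs) hψ0 w hw
        refine exists_extension_at_boundary (hψ.mono hballs) hw hR (fun h => ?_) hQ hQl
        rw [hv w h, norm_zero] at hw
        exact hR.ne hw
    have : R' ∈ S := ⟨hR.trans hR', Ψ, hΨ,
      (hΨψ.eventuallyEq_of_mem (Metric.ball_mem_nhds 0 hR)).trans hψ0⟩
    exact absurd (le_csSup hbdd this) (not_le.2 hR')
  rw [disc_eq_iUnion]
  refine exists_isDev_iUnion (fun r hr => hr.1) (fun r hr => (hmain r hr.1 hr.2).2) ?_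
  obtain ⟨q, hq, hqT⟩ := ENNReal.lt_iff_exists_real_btwn.1 hT
  exact ⟨q, by simpa using hqT.1, hqT.2.le⟩

end QuadraticDifferential

end

/-! ### Geodesics near a zero, positivity of the threshold, and radial limits. -/

noncomputable section

/-- A distance-preserving curve in the plane has quadratic squared norm. -/
theorem exists_norm_sq_eq_of_isometry {u : ℝ → ℂ} {t₀ ε : ℝ} (hε : 0 < ε)
    (h : ∀ s s' : ℝ, |s - t₀| < ε → |s' - t₀| < ε → ‖u s' - u s‖ = |s - s'|) :
    ∃ β c : ℝ, ∀ t, |t - t₀| < ε → ‖u t‖ ^ 2 = t ^ 2 + β * t + c := by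
  have hσ : 0 < ε / 2 := half_pos hε
  set σ := ε / 2 with hσd
  have h0 : |t₀ - t₀| < ε := by simpa using hε
  have h1 : |t₀ + σ - t₀| < ε := by
    rw [add_sub_cancel_left, abs_of_pos hσ]
    linarith
  have sq : ∀ z : ℂ, ‖z‖ ^ 2 = z.re ^ 2 + z.im ^ 2 := fun z => by
    rw [Complex.sq_norm, Complex.normSq_apply]
    ring
  have hsq : ∀ s s' : ℝ, |s - t₀| < ε → |s' - t₀| < ε →
      ((u s').re - (u s).re) ^ 2 + ((u s').im - (u s).im) ^ 2 = (s' - s) ^ 2 := by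
    intro s s' hs hs'
    have := sq (u s' - u s)
    rw [h s s' hs hs', sq_abs] at this
    simp only [Complex.sub_re, Complex.sub_im] at this
    rw [← this]
    ring
  set A := u t₀
  set B := u (t₀ + σ)
  let b₁ := (B.re - A.re) / σ
  let b₂ := (B.im - A.im) / σ
  have eB := hsq t₀ (t₀ + σ) h0 h1
  -- The distances of `u t` to the two points `A` and `B` of the curve determine it: the sum of
  -- squares `e3` vanishes, so `u` is affine with velocity `(b₁, b₂)`.
  have key : ∀ t, |t - t₀| < ε →
      (u t).re = A.re + (t - t₀) * b₁ ∧ (u t).im = A.im + (t - t₀) * b₂ := by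
    intro t ht
    have e1 := hsq t₀ t h0 ht
    have e2 := hsq (t₀ + σ) t h1 ht
    have e3 : (σ * ((u t).re - A.re) - (t - t₀) * (B.re - A.re)) ^ 2 +
        (σ * ((u t).im - A.im) - (t - t₀) * (B.im - A.im)) ^ 2 = 0 := by
      linear_combination (σ ^ 2 - σ * (t - t₀)) * e1 +
        ((t - t₀) ^ 2 - σ * (t - t₀)) * eB + σ * (t - t₀) * e2
    have e4 := (add_eq_zero_iff_of_nonneg (sq_nonneg _) (sq_nonneg _)).1 e3
    have e5 := pow_eq_zero_iff two_ne_zero |>.1 e4.1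
    have e6 := pow_eq_zero_iff two_ne_zero |>.1 e4.2
    constructor
    · simp only [b₁]
      field_simp
      linarith
    · simp only [b₂]
      field_simp
      linarith
  have hb : b₁ ^ 2 + b₂ ^ 2 = 1 := by
    simp only [b₁, b₂]
    field_simp
    linarith
  refine ⟨2 * (A.re * b₁ + A.im * b₂) - 2 * t₀,
    A.re ^ 2 + A.im ^ 2 - 2 * t₀ * (A.re * b₁ + A.im * b₂) + t₀ ^ 2, fun t ht => ?_⟩
  rw [sq, (key t ht).1, (key t ht).2]
  linear_combination (t - t₀) ^ 2 * hb

/-- A function which is locally a monic quadratic polynomial on an interval is one globally. -/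
theorem exists_quadratic_of_locally {F : ℝ → ℝ} {a b : ℝ}
    (h : ∀ t₀ ∈ Ioo a b, ∃ β c : ℝ, ∀ᶠ t in 𝓝 t₀, F t = t ^ 2 + β * t + c) :
    ∃ β c : ℝ, ∀ t ∈ Ioo a b, F t = t ^ 2 + β * t + c := by
  -- Removing the monic term leaves a locally affine function, whose derivative is locally constant
  -- and hence constant.
  let G : ℝ → ℝ := fun t => F t - t ^ 2
  have hG : ∀ t₀ ∈ Ioo a b, ∃ β c : ℝ, G =ᶠ[𝓝 t₀] fun t => β * t + c := by
    intro t₀ ht₀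
    obtain ⟨β, c, hβ⟩ := h t₀ ht₀
    refine ⟨β, c, hβ.mono fun t ht => ?_⟩
    simp only [G, ht]
    ring
  have hd : ∀ t₀ ∈ Ioo a b, ∃ β : ℝ, deriv G =ᶠ[𝓝 t₀] fun _ => β := by
    intro t₀ ht₀
    obtain ⟨β, c, hβ⟩ := hG t₀ ht₀
    refine ⟨β, hβ.deriv.trans (Eventually.of_forall fun t => ?_)⟩
    have : HasDerivAt (fun t : ℝ => β * t + c) β t := by
      simpa using ((hasDerivAt_id t).const_mul β).add_const c
    exact this.deriv
  obtain ⟨β, hβ⟩ := isOpen_Ioo.exists_is_const_of_deriv_eq_zero (s := Ioo a b) (f := deriv G)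
    isPreconnected_Ioo (fun t ht => by
      obtain ⟨β, hβ⟩ := hd t ht
      exact (hβ.differentiableAt_iff.2 (differentiableAt_const β)).differentiableWithinAt)
    (fun t ht => by
      obtain ⟨β, hβ⟩ := hd t ht
      simp [hβ.deriv_eq])
  obtain ⟨c, hc⟩ := isOpen_Ioo.exists_eq_add_of_deriv_eq (s := Ioo a b) (f := G)
    (g := fun t => β * t) isPreconnected_Ioo (fun t ht => by
      obtain ⟨β, c, hβ⟩ := hG t ht
      exact (hβ.differentiableAt_iff.2 (by fun_prop)).differentiableWithinAt)
    (by fun_prop) (fun t ht => by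
      rw [hβ t ht]
      have : HasDerivAt (fun t : ℝ => β * t) β t := by
        simpa using (hasDerivAt_id t).const_mul β
      exact this.deriv.symm)
  refine ⟨β, c, fun t ht => ?_⟩
  have := hc ht
  simp only [G] at this
  linarith

namespace QuadraticDifferential

variable {X : Type*} [TopologicalSpace X] [ChartedSpace ℂ X] [IsManifold 𝓘(ℂ) ω X]
  {φ : QuadraticDifferential X} {φ' : QuadraticDifferential ℂ}

/-- A flat coordinate on the image of a developing map. -/
theorem exists_flat_coord_of_isDev {ψ : ℂ → X} {U : Set ℂ} (hU : IsOpen U)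
    (hψ : IsDev φ φ' ψ U) {s : ℂ → ℂ} {V : Set ℂ} (hV : IsOpen V) (hs : IsDev modelFlat φ' s V)
    {x : ℂ} (hxU : x ∈ U) (hxV : x ∈ V) (hv : φ'.val x ≠ 0) :
    ∃ ζ, φ.IsCanonicalCoord modelFlat (ψ x) ζ ∧
      ∀ᶠ y in 𝓝 x, ψ y ∈ ζ.source ∧ ζ (ψ y) = s y - s x := by
  obtain ⟨Φ, h1, h2, h3⟩ := isLocalDiffeomorphAt_of_complexDeriv_ne_zero hU hψ.contMDiffOn hxU
    (complexDeriv_ne_zero_of_val_ne_zero hψ hxU hv).1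
  let F : OpenPartialHomeomorph ℂ X := Φ.toOpenPartialHomeomorph
  have hF : EqOn F ψ F.source := fun y hy => (h3 hy).symm
  have hFd : IsDev φ φ' F F.source := (hψ.mono h2).congr F.open_source hF
  have hFs : IsDev φ' φ F.symm F.target := hFd.symm Φ.contMDiffOn_invFun
  let W := F.target ∩ F.symm ⁻¹' V
  have hW : IsOpen W := F.symm.isOpen_inter_preimage hV
  have hg : IsDev modelFlat φ ((fun z => 1 * z + (-s x)) ∘ (s ∘ F.symm)) W :=
    (isDev_affine (Or.inl rfl) univ).comp
      (hs.comp (hFs.mono inter_subset_left) hV hW fun y hy => hy.2) isOpen_univ hW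
      fun _ _ => mem_univ _
  have hFx : F.symm (ψ x) = x := by rw [← hF h1, F.left_inv h1]
  have hPW : ψ x ∈ W := ⟨by rw [← hF h1]; exact F.map_source h1, by rwa [mem_preimage, hFx]⟩
  obtain ⟨ζ, hζ, hζW, hζe⟩ := exists_isCanonicalCoord_of_isDev hW hg hPW
    (by simp [hFx])
    (complexDeriv_ne_zero_of_val_ne_zero hg hPW
      (complexDeriv_ne_zero_of_val_ne_zero hψ hxU hv).2).1
  refine ⟨ζ, hζ, ?_⟩
  have hc : ContinuousAt ψ x := hψ.continuousOn.continuousAt (hU.mem_nhds hxU)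
  filter_upwards [F.open_source.mem_nhds h1,
    hc (ζ.open_source.mem_nhds (isCanonicalCoord_iff.1 hζ).2.1)] with y hy hyζ
  refine ⟨hyζ, ?_⟩
  rw [hζe hyζ]
  have : F.symm (ψ y) = y := by rw [← hF hy, F.left_inv hy]
  simp only [Function.comp_apply, this]
  ring

/-- `γ` is locally an isometric embedding at `t`, among the parameters in `I`. -/
def IsIsometricAt (φ : QuadraticDifferential X) (γ : ℝ → X) (I : Set ℝ) (t : ℝ) : Prop :=
  ∃ ε > 0, ∀ s ∈ I, ∀ s' ∈ I, |s - t| < ε → |s' - t| < ε →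
    φ.dist (γ s) (γ s') = ENNReal.ofReal |s - s'|

variable [T2Space X]

theorem IsIsometricAt.continuousWithinAt (hφ : φ.HasSimpleZeros) {γ : ℝ → X} {I : Set ℝ} {t : ℝ}
    (ht : t ∈ I) (h : φ.IsIsometricAt γ I t) : ContinuousWithinAt γ I t := by
  obtain ⟨ε, hε, hd⟩ := h
  refine tendsto_of_tendsto_dist hφ ?_
  have h1 : Tendsto (fun s => ENNReal.ofReal |t - s|) (𝓝[I] t) (𝓝 0) := by
    have h0 : Continuous (fun s : ℝ => |t - s|) := by fun_prop
    have h2 : ContinuousAt (fun s : ℝ => ENNReal.ofReal |t - s|) t :=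
      (ENNReal.continuous_ofReal.comp h0).continuousAt
    have h3 := h2.tendsto
    simp only [sub_self, abs_zero, ENNReal.ofReal_zero] at h3
    exact h3.mono_left nhdsWithin_le_nhds
  refine h1.congr' ?_
  filter_upwards [self_mem_nhdsWithin, nhdsWithin_le_nhds (Metric.ball_mem_nhds t hε)]
    with s hs hs'
  exact (hd t ht s hs (by simpa using hε) hs').symm

/-- Along a geodesic avoiding the zero `P`, the square of the distance to `P` is quadratic. -/
theorem exists_quadratic_norm (hφ : φ.HasSimpleZeros) {P : X} {e : OpenPartialHomeomorph X ℂ}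
    (he : φ.IsCanonicalCoord modelZero P e) {γ : ℝ → X} {a b : ℝ}
    (hs : ∀ t ∈ Ioo a b, γ t ∈ e.source ∧ e (γ t) ≠ 0)
    (hγ : ∀ t ∈ Ioo a b, φ.IsIsometricAt γ (Ioo a b) t) :
    ∃ β c : ℝ, ∀ t ∈ Ioo a b, (‖e (γ t)‖ ^ (3 / 2 : ℝ)) ^ 2 = t ^ 2 + β * t + c := by
  refine exists_quadratic_of_locally fun t₀ ht₀ => ?_
  obtain ⟨hsrc, hne⟩ := hs t₀ ht₀
  set x := e (γ t₀) with hx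
  -- Near `t₀` a branch of `z ^ (3 / 2)` is isometric, so it turns `γ` into a distance-preserving
  -- plane curve. Its modulus is `‖e (γ t)‖ ^ (3 / 2)` for every branch, so the local results fit
  -- together.
  obtain ⟨ζ, hζ, hζe⟩ := exists_flat_coord_of_isDev e.open_target he.isDev_symm
    (isOpen_slitDomain x) (isDev_sqrtCube hne) (e.map_source hsrc) (self_mem_slitDomain hne)
    (by simpa using hne)
  rw [e.left_inv hsrc] at hζ
  obtain ⟨N, hN, hNs, hNd⟩ := exists_nhds_dist_eq hζ
  have hcγ : ContinuousAt γ t₀ :=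
    ((hγ t₀ ht₀).continuousWithinAt hφ ht₀).continuousAt (isOpen_Ioo.mem_nhds ht₀)
  have hce : Tendsto (fun t => e (γ t)) (𝓝 t₀) (𝓝 x) := (e.continuousAt hsrc).tendsto.comp hcγ
  obtain ⟨ε, hε, hiso⟩ := hγ t₀ ht₀
  have hev : ∀ᶠ t in 𝓝 t₀, t ∈ Ioo a b ∧ |t - t₀| < ε ∧ γ t ∈ N ∧
      ζ (γ t) = sqrtCube x (e (γ t)) - sqrtCube x x := by
    filter_upwards [isOpen_Ioo.mem_nhds ht₀, Metric.ball_mem_nhds t₀ hε, hcγ hN,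
      hce.eventually hζe] with t h1 h2 h3 h4
    refine ⟨h1, h2, h3, ?_⟩
    rw [e.left_inv (hs t h1).1] at h4
    exact h4.2
  obtain ⟨ε', hε', hball⟩ := Metric.eventually_nhds_iff.1 hev
  have hiso' : ∀ s s' : ℝ, |s - t₀| < ε' → |s' - t₀| < ε' →
      ‖sqrtCube x (e (γ s')) - sqrtCube x (e (γ s))‖ = |s - s'| := by
    intro s s' h1 h2
    obtain ⟨a1, a2, a3, a4⟩ := hball (y := s) h1
    obtain ⟨b1, b2, b3, b4⟩ := hball (y := s') h2
    have h3 := hNd _ a3 _ b3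
    rw [hiso s a1 s' b1 a2 b2, a4, b4, sub_sub_sub_cancel_right] at h3
    have := (ENNReal.ofReal_eq_ofReal_iff (abs_nonneg _) (norm_nonneg _)).1 h3
    exact this.symm
  obtain ⟨β, c, hβ⟩ := exists_norm_sq_eq_of_isometry hε' hiso'
  refine ⟨β, c, Metric.eventually_nhds_iff.2 ⟨ε', hε', fun t ht => ?_⟩⟩
  rw [← norm_sqrtCube hne]
  exact hβ t ht

omit [IsManifold 𝓘(ℂ) ω X] [T2Space X] in
/-- A geodesic segment is `1`-Lipschitz. -/
theorem IsGeodesicSegment.dist_le {γ : ℝ → X} {L : ℝ} (h : φ.IsGeodesicSegment γ L) {s t : ℝ}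
    (hs : 0 ≤ s) (hst : s ≤ t) (ht : t ≤ L) : φ.dist (γ s) (γ t) ≤ ENNReal.ofReal (t - s) := by
  let A : Set ℝ := {t | φ.dist (γ s) (γ t) ≤ ENNReal.ofReal (t - s)}
  suffices hsub : Icc s t ⊆ A from hsub ⟨hst, le_rfl⟩
  have hI : ∀ x ∈ Icc s t, x ∈ Icc 0 L := fun x hx => ⟨hs.trans hx.1, hx.2.trans ht⟩
  -- Induction along the interval: `A` is relatively closed, and the local isometry at any of its
  -- points before `t` extends the bound a little further by the triangle inequality.
  refine IsClosed.Icc_subset_of_forall_exists_gt ?_ ?_ ?_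
  · refine isClosed_of_closure_subset fun x hx => ?_
    have hxI : x ∈ Icc s t := closure_minimal inter_subset_right isClosed_Icc hx
    refine ⟨?_, hxI⟩
    obtain ⟨ε, hε, hd⟩ := h.2 x (hI x hxI)
    have hlim : Tendsto (fun δ : ℝ => ENNReal.ofReal (x - s + 2 * δ)) (𝓝[>] 0)
        (𝓝 (ENNReal.ofReal (x - s))) := by
      have h0 : Continuous (fun δ : ℝ => x - s + 2 * δ) := by fun_prop
      have h1 : ContinuousAt (fun δ : ℝ => ENNReal.ofReal (x - s + 2 * δ)) 0 :=
        (ENNReal.continuous_ofReal.comp h0).continuousAt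
      have h2 := h1.tendsto
      simp only [mul_zero, add_zero] at h2
      exact h2.mono_left nhdsWithin_le_nhds
    refine ge_of_tendsto hlim ?_
    filter_upwards [Ioo_mem_nhdsGT hε] with δ hδ
    obtain ⟨y, ⟨hyA, hyI⟩, hyx⟩ := Metric.mem_closure_iff.1 hx δ hδ.1
    have hxy : |x - y| < δ := hyx
    have hxy' : |y - x| < δ := by rwa [abs_sub_comm]
    have h3 := hd y (hI y hyI) x (hI x hxI) (hxy'.trans hδ.2) (by simpa using hε)
    calc φ.dist (γ s) (γ x) ≤ φ.dist (γ s) (γ y) + φ.dist (γ y) (γ x) := φ.dist_triangle _ _ _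
      _ ≤ ENNReal.ofReal (y - s) + ENNReal.ofReal |y - x| := add_le_add hyA h3.le
      _ = ENNReal.ofReal (y - s + |y - x|) :=
        (ENNReal.ofReal_add (sub_nonneg.2 hyI.1) (abs_nonneg _)).symm
      _ ≤ ENNReal.ofReal (x - s + 2 * δ) := by
        refine ENNReal.ofReal_le_ofReal ?_
        have := (abs_lt.1 hxy').2
        linarith
  · change φ.dist (γ s) (γ s) ≤ _
    rw [φ.dist_self]
    exact zero_le
  · rintro x ⟨hxA, hxI⟩ y hy
    have hxy : x < y := hy
    obtain ⟨ε, hε, hd⟩ := h.2 x (hI x ⟨hxI.1, hxI.2.le⟩)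
    obtain ⟨u, hu1, hu2⟩ := exists_between (lt_min hxy (lt_min hxI.2 (lt_add_of_pos_right x hε)))
    have hu3 : u < y := hu2.trans_le (min_le_left _ _)
    have hu4 : u < t := hu2.trans_le ((min_le_right _ _).trans (min_le_left _ _))
    have hu5 : u < x + ε := hu2.trans_le ((min_le_right _ _).trans (min_le_right _ _))
    refine ⟨u, ?_, hu1, hu3.le⟩
    have h3 := hd x (hI x ⟨hxI.1, hxI.2.le⟩) u (hI u ⟨hxI.1.trans hu1.le, hu4.le⟩)
      (by simpa using hε) (by rw [abs_of_pos (sub_pos.2 hu1)]; linarith)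
    calc φ.dist (γ s) (γ u) ≤ φ.dist (γ s) (γ x) + φ.dist (γ x) (γ u) := φ.dist_triangle _ _ _
      _ ≤ ENNReal.ofReal (x - s) + ENNReal.ofReal |x - u| := add_le_add hxA h3.le
      _ = ENNReal.ofReal (x - s + |x - u|) :=
        (ENNReal.ofReal_add (sub_nonneg.2 hxI.1) (abs_nonneg _)).symm
      _ = ENNReal.ofReal (u - s) := by
        rw [abs_of_neg (sub_neg.2 hu1)]
        ring_nf

/-- Saddle connections starting at a given zero are not arbitrarily short. -/
theorem exists_le_length_of_isSaddleConnection (hφ : φ.HasSimpleZeros) {P : X}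
    (hP : P ∈ φ.zeros) : ∃ r > 0, ∀ (γ : ℝ → X) (L : ℝ), φ.IsSaddleConnection γ L → γ 0 = P →
      r ≤ L := by
  obtain ⟨e, he⟩ := exists_isCanonicalCoord_modelZero (hφ P hP)
  have hc := isCanonicalCoord_iff.1 he
  obtain ⟨ρ, hρ, hb⟩ := Metric.nhds_basis_closedBall.mem_iff.1
    (e.open_target.mem_nhds (hc.2.2.1 ▸ e.map_source hc.2.1))
  have hr : 0 < ρ ^ (3 / 2 : ℝ) := Real.rpow_pos_of_pos hρ _
  refine ⟨ρ ^ (3 / 2 : ℝ), hr, ?_⟩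
  rintro γ L ⟨hγ, -, hL, hint⟩ h0
  by_contra hlt
  have hL0 : 0 < L := hγ.1
  have hLr : L < ρ ^ (3 / 2 : ℝ) := not_le.1 hlt
  -- Such points are closer to `P` than the size of the coordinate, so the whole segment lies in its
  -- domain.
  have key : ∀ y, ∀ t ∈ Icc 0 L, φ.dist P y ≤ ENNReal.ofReal t →
      y ∈ e.source ∧ ‖e y‖ ^ (3 / 2 : ℝ) ≤ t := by
    intro y t ht hd
    obtain ⟨h1, h2⟩ := isModel_zero.mem_source_of_dist_lt hc.2.2.2 hc.2.1 hc.2.2.1 hρ.le hb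
      (hd.trans_lt ((ENNReal.ofReal_lt_ofReal_iff hr).2 (ht.2.trans_lt hLr)))
    exact ⟨h1, (ENNReal.ofReal_le_ofReal_iff ht.1).1 (h2.trans hd)⟩
  have k1 : ∀ t ∈ Icc 0 L, γ t ∈ e.source ∧ ‖e (γ t)‖ ^ (3 / 2 : ℝ) ≤ t := by
    intro t ht
    refine key _ t ht ?_
    simpa [h0] using hγ.dist_le le_rfl ht.1 ht.2
  have hz : ∀ t ∈ Icc 0 L, e (γ t) = 0 → γ t = P := fun t ht h =>
    e.injOn (k1 t ht).1 hc.2.1 (h.trans hc.2.2.1.symm)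
  -- The domain contains no other zero. The segment is therefore a loop, and distances to `P` can
  -- also be measured from its end.
  have hLP : γ L = P := hz L ⟨hL0.le, le_rfl⟩ (by
    simpa using (he.mem_zeros_iff (k1 L ⟨hL0.le, le_rfl⟩).1).1 hL)
  have k2 : ∀ t ∈ Icc 0 L, ‖e (γ t)‖ ^ (3 / 2 : ℝ) ≤ L - t := by
    intro t ht
    refine (key (γ t) (L - t) ⟨sub_nonneg.2 ht.2, by linarith [ht.1]⟩ ?_).2
    rw [φ.dist_comm, ← hLP]
    exact hγ.dist_le ht.1 ht.2 le_rfl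
  obtain ⟨β, c, hβ⟩ := exists_quadratic_norm hφ he (a := 0) (b := L) (γ := γ)
    (fun t ht => ⟨(k1 t (Ioo_subset_Icc_self ht)).1, fun h => hint t ht
      ((hz t (Ioo_subset_Icc_self ht) h).symm ▸ hP)⟩)
    (fun t ht => by
      obtain ⟨ε, hε, hd⟩ := hγ.2 t (Ioo_subset_Icc_self ht)
      exact ⟨ε, hε, fun s hs s' hs' =>
        hd s (Ioo_subset_Icc_self hs) s' (Ioo_subset_Icc_self hs')⟩)
  have hcl : closure (Ioo 0 L) = Icc 0 L := closure_Ioo hL0.ne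
  -- The quadratic is at most `0` at both ends by continuity and nonnegative at the midpoint,
  -- against strict convexity.
  have f1 : ∀ t ∈ Icc 0 L, t ^ 2 + β * t + c ≤ t ^ 2 := by
    intro t ht
    rw [← hcl] at ht
    refine le_on_closure (s := Ioo 0 L) (f := fun t => t ^ 2 + β * t + c) (g := fun t => t ^ 2)
      (fun u hu => ?_) (by fun_prop) (by fun_prop) ht
    rw [← hβ u hu]
    exact pow_le_pow_left₀ (by positivity) (k1 u (Ioo_subset_Icc_self hu)).2 2
  have f2 : ∀ t ∈ Icc 0 L, t ^ 2 + β * t + c ≤ (L - t) ^ 2 := by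
    intro t ht
    rw [← hcl] at ht
    refine le_on_closure (s := Ioo 0 L) (f := fun t => t ^ 2 + β * t + c)
      (g := fun t => (L - t) ^ 2) (fun u hu => ?_) (by fun_prop) (by fun_prop) ht
    rw [← hβ u hu]
    exact pow_le_pow_left₀ (by positivity) (k2 u (Ioo_subset_Icc_self hu)) 2
  have f3 : 0 ≤ (L / 2) ^ 2 + β * (L / 2) + c := by
    rw [← hβ (L / 2) ⟨by linarith, by linarith⟩]
    positivity
  have f4 := f1 0 ⟨le_rfl, hL0.le⟩
  have f5 := f2 L ⟨hL0.le, le_rfl⟩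
  have f6 : 0 < L ^ 2 := by positivity
  linarith

theorem threshold_pos [CompactSpace X] (hφ : φ.HasSimpleZeros) : 0 < φ.threshold := by
  have h1 : ∀ P ∈ φ.zeros, ∀ᶠ r : ℝ in 𝓝[>] 0, ∀ (γ : ℝ → X) (L : ℝ),
      φ.IsSaddleConnection γ L → γ 0 = P → r ≤ L := by
    intro P hP
    obtain ⟨r, hr, h⟩ := exists_le_length_of_isSaddleConnection hφ hP
    filter_upwards [Ioo_mem_nhdsGT hr] with r' hr' γ L hγ h0
    exact hr'.2.le.trans (h γ L hγ h0)
  obtain ⟨r, hr, hr0⟩ := (((eventually_all_finite (zeros_finite hφ)).2 h1).and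
    self_mem_nhdsWithin).exists
  have hr0' : 0 < r := hr0
  refine (ENNReal.ofReal_pos.2 hr0').trans_le (le_iInf₂ fun γ L => le_iInf fun hγ => ?_)
  exact ENNReal.ofReal_le_ofReal (hr (γ 0) hγ.2.1 γ L hγ rfl)

/-- A developing map on a disc has radial limits. -/
theorem exists_radial_limit [CompactSpace X] (hφ : φ.HasSimpleZeros) {p : ℝ}
    (hp : IsRadial φ' p) {ψ : ℂ → X} {R : ℝ} (hR : 0 < R) (hψ : IsDev φ φ' ψ (Metric.ball 0 R))
    {w : ℂ} (hw : ‖w‖ = R) : ∃ Q, Tendsto (fun t : ℝ => ψ (t * w)) (𝓝[<] 1) (𝓝 Q) ∧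
      ∀ t : ℝ, 0 ≤ t → t < 1 →
        φ.dist (ψ (t * w)) Q ≤ ENNReal.ofReal (1 ^ p * ‖w‖ ^ p - t ^ p * ‖w‖ ^ p) := by
  have hp0 : 0 < p := zero_lt_one.trans_le hp.1
  -- A cluster point exists by compactness. Its distance to `ψ (t * w)` is at most the length of the
  -- rest of the radius, which tends to `0`, so it is the limit.
  obtain ⟨Q, hQ⟩ := exists_clusterPt_of_compactSpace (map (fun t : ℝ => ψ (t * w)) (𝓝[<] 1))
  have hQ' : MapClusterPt Q (𝓝[<] 1) (fun t : ℝ => ψ (t * w)) := hQ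
  have hb : ∀ t : ℝ, 0 ≤ t → t < 1 →
      φ.dist (ψ (t * w)) Q ≤ ENNReal.ofReal (1 ^ p * ‖w‖ ^ p - t ^ p * ‖w‖ ^ p) := by
    intro t ht0 ht1
    refine ENNReal.le_of_forall_pos_le_add fun ε hε _ => ?_
    have h1 : {y | φ.dist Q y < ε} ∈ 𝓝 Q :=
      (tendsto_dist hφ Q).eventually (gt_mem_nhds (by exact_mod_cast hε))
    obtain ⟨u, hu1, hu2⟩ := ((hQ'.frequently h1).and_eventually (Ioo_mem_nhdsLT ht1)).exists
    have h2 := dist_radial_le hp Metric.isOpen_ball hψ ht0 hu2.1.le (w := w) (fun v hv => by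
      rw [mem_ball_zero_iff, norm_mul, Complex.norm_real, Real.norm_of_nonneg (ht0.trans hv.1), hw]
      nlinarith [hv.2, hu2.2])
    calc φ.dist (ψ (t * w)) Q ≤ φ.dist (ψ (t * w)) (ψ (u * w)) + φ.dist (ψ (u * w)) Q :=
          φ.dist_triangle _ _ _
      _ ≤ _ := by
        refine add_le_add (h2.trans (ENNReal.ofReal_le_ofReal ?_)) ?_
        · have : u ^ p ≤ 1 ^ p := Real.rpow_le_rpow (ht0.trans hu2.1.le) hu2.2.le hp0.le
          gcongr
        · rw [φ.dist_comm]
          exact hu1.le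
  refine ⟨Q, tendsto_of_tendsto_dist hφ ?_, hb⟩
  have hlim : Tendsto (fun t : ℝ => ENNReal.ofReal (1 ^ p * ‖w‖ ^ p - t ^ p * ‖w‖ ^ p)) (𝓝[<] 1)
      (𝓝 0) := by
    have h1 : Continuous (fun t : ℝ => ENNReal.ofReal (1 ^ p * ‖w‖ ^ p - t ^ p * ‖w‖ ^ p)) :=
      ENNReal.continuous_ofReal.comp (continuous_const.sub
        ((Real.continuous_rpow_const hp0.le).mul continuous_const))
    have h2 := h1.tendsto 1
    simp only [sub_self, ENNReal.ofReal_zero] at h2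
    exact h2.mono_left nhdsWithin_le_nhds
  refine tendsto_of_tendsto_of_tendsto_of_le_of_le' tendsto_const_nhds hlim
    (Eventually.of_forall fun _ => zero_le) ?_
  filter_upwards [Ioo_mem_nhdsLT one_pos] with t ht
  rw [φ.dist_comm]
  exact hb t ht.1.le ht.2

end QuadraticDifferential

end

/-! ### Radii from a zero, and radii that end at a zero. -/

noncomputable section

namespace QuadraticDifferential

/-- The radius through `w`, parametrized by arc length for the metric `|φ₀|`. -/
def ray (w : ℂ) (t : ℝ) : ℂ := (((t / ‖w‖ ^ (3 / 2 : ℝ)) ^ (2 / 3 : ℝ) : ℝ) : ℂ) * w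

section Ray

variable {w : ℂ}

theorem continuous_ray (w : ℂ) : Continuous (ray w) :=
  (Complex.continuous_ofReal.comp ((Real.continuous_rpow_const (by norm_num)).comp
    (continuous_id.div_const _))).mul continuous_const

theorem ray_zero (w : ℂ) : ray w 0 = 0 := by
  simp [ray, Real.zero_rpow]

theorem ray_self (hw : w ≠ 0) : ray w (‖w‖ ^ (3 / 2 : ℝ)) = w := by
  have : ‖w‖ ^ (3 / 2 : ℝ) ≠ 0 := (Real.rpow_pos_of_pos (norm_pos_iff.2 hw) _).ne'
  simp [ray, div_self this]

theorem rpow_two_thirds_rpow {x : ℝ} (hx : 0 ≤ x) :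
    (x ^ (2 / 3 : ℝ)) ^ (3 / 2 : ℝ) = x := by
  rw [← Real.rpow_mul hx]
  norm_num

theorem norm_ray (hw : w ≠ 0) {t : ℝ} (ht : 0 ≤ t) : ‖ray w t‖ ^ (3 / 2 : ℝ) = t := by
  have h0 : 0 < ‖w‖ ^ (3 / 2 : ℝ) := Real.rpow_pos_of_pos (norm_pos_iff.2 hw) _
  have h1 : 0 ≤ t / ‖w‖ ^ (3 / 2 : ℝ) := by positivity
  unfold ray
  rw [norm_mul, Complex.norm_real, Real.norm_of_nonneg (by positivity),
    Real.mul_rpow (by positivity) (norm_nonneg _), rpow_two_thirds_rpow h1,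
    div_mul_cancel₀ _ h0.ne']

theorem norm_ray_lt (hw : w ≠ 0) {t R : ℝ} (ht : 0 ≤ t) (hR : 0 ≤ R) (h : t < R ^ (3 / 2 : ℝ)) :
    ‖ray w t‖ < R := by
  rw [← norm_ray hw ht] at h
  exact (Real.rpow_lt_rpow_iff (norm_nonneg _) hR (by norm_num)).1 h

theorem ray_ne_zero (hw : w ≠ 0) {t : ℝ} (ht : 0 < t) : ray w t ≠ 0 := by
  intro h
  have := norm_ray hw ht.le
  rw [h, norm_zero, Real.zero_rpow (by norm_num)] at this
  exact ht.ne this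

theorem ray_mem_slitDomain (hw : w ≠ 0) {t : ℝ} (ht : 0 < t) : ray w t ∈ slitDomain w := by
  have h0 : 0 < ‖w‖ ^ (3 / 2 : ℝ) := Real.rpow_pos_of_pos (norm_pos_iff.2 hw) _
  exact mem_slitDomain hw (by positivity)

/-- In the flat coordinate the radius is a straight segment of unit speed, since `sqrtCube w w` has
modulus `‖w‖ ^ (3 / 2)`. -/
theorem sqrtCube_ray (hw : w ≠ 0) {t : ℝ} (ht : 0 ≤ t) :
    sqrtCube w (ray w t) = ((t / ‖w‖ ^ (3 / 2 : ℝ) : ℝ) : ℂ) * sqrtCube w w := by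
  have h0 : 0 < ‖w‖ ^ (3 / 2 : ℝ) := Real.rpow_pos_of_pos (norm_pos_iff.2 hw) _
  unfold ray
  rw [sqrtCube_ofReal_mul hw (by positivity), rpow_two_thirds_rpow (by positivity)]

end Ray

variable {X : Type*} [TopologicalSpace X] [ChartedSpace ℂ X]
  {φ : QuadraticDifferential X}

theorem dist_ray_le {ψ : ℂ → X} {R : ℝ} (hψ : IsDev φ modelZero ψ (Metric.ball 0 R)) {w : ℂ}
    (hw : w ≠ 0) {s t : ℝ} (hs : 0 ≤ s) (hst : s ≤ t) (ht : ray w t ∈ Metric.ball (0 : ℂ) R) :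
    φ.dist (ψ (ray w s)) (ψ (ray w t)) ≤ ENNReal.ofReal (t - s) := by
  have h0 : 0 < ‖w‖ ^ (3 / 2 : ℝ) := Real.rpow_pos_of_pos (norm_pos_iff.2 hw) _
  have hs' : 0 ≤ s / ‖w‖ ^ (3 / 2 : ℝ) := by positivity
  have ht' : 0 ≤ t / ‖w‖ ^ (3 / 2 : ℝ) := div_nonneg (hs.trans hst) h0.le
  have := dist_radial_le isRadial_modelZero Metric.isOpen_ball hψ (w := w)
    (s := (s / ‖w‖ ^ (3 / 2 : ℝ)) ^ (2 / 3 : ℝ)) (t := (t / ‖w‖ ^ (3 / 2 : ℝ)) ^ (2 / 3 : ℝ))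
    (by positivity) (by gcongr) (fun u hu => by
      have hu0 : 0 ≤ u := (Real.rpow_nonneg hs' _).trans hu.1
      rw [ray, mem_ball_zero_iff, norm_mul, Complex.norm_real,
        Real.norm_of_nonneg (hu0.trans hu.2)] at ht
      rw [mem_ball_zero_iff, norm_mul, Complex.norm_real, Real.norm_of_nonneg hu0]
      exact (mul_le_mul_of_nonneg_right hu.2 (norm_nonneg _)).trans_lt ht)
  rw [rpow_two_thirds_rpow hs', rpow_two_thirds_rpow ht', div_mul_cancel₀ _ h0.ne',
    div_mul_cancel₀ _ h0.ne'] at this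
  exact this

namespace IsIsometricAt

variable {γ γ' : ℝ → X} {I J : Set ℝ} {t : ℝ}

theorem mono (h : φ.IsIsometricAt γ I t) (hJ : J ⊆ I) : φ.IsIsometricAt γ J t := by
  obtain ⟨ε, hε, hd⟩ := h
  exact ⟨ε, hε, fun s hs s' hs' => hd s (hJ hs) s' (hJ hs')⟩

theorem congr (h : φ.IsIsometricAt γ I t) (he : ∀ᶠ s in 𝓝 t, s ∈ I → γ' s = γ s) :
    φ.IsIsometricAt γ' I t := by
  obtain ⟨ε, hε, hd⟩ := h
  obtain ⟨ε', hε', he'⟩ := Metric.eventually_nhds_iff.1 he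
  refine ⟨min ε ε', lt_min hε hε', fun s hs s' hs' h1 h2 => ?_⟩
  rw [he' (y := s) (h1.trans_le (min_le_right _ _)) hs,
    he' (y := s') (h2.trans_le (min_le_right _ _)) hs']
  exact hd s hs s' hs' (h1.trans_le (min_le_left _ _)) (h2.trans_le (min_le_left _ _))

theorem reflect (h : φ.IsIsometricAt γ I t) {c u : ℝ} (hu : c - u = t) :
    φ.IsIsometricAt (fun s => γ (c - s)) ((fun s => c - s) ⁻¹' I) u := by
  obtain ⟨ε, hε, hd⟩ := h
  refine ⟨ε, hε, fun s hs s' hs' h1 h2 => ?_⟩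
  subst hu
  have e : ∀ x y : ℝ, |c - x - (c - y)| = |x - y| := fun x y => by
    rw [show c - x - (c - y) = y - x by ring, abs_sub_comm]
  have := hd _ hs _ hs' (by rwa [e]) (by rwa [e])
  rwa [e] at this

/-- A curve which is affine of unit speed in an isometric coordinate. -/
theorem of_coord {N : Set X} {ζ : X → ℂ}
    (hN : ∀ x ∈ N, ∀ y ∈ N, φ.dist x y = ENNReal.ofReal ‖ζ y - ζ x‖) {a b : ℂ} (ha : ‖a‖ = 1)
    (h : ∀ᶠ s in 𝓝 t, s ∈ I → γ s ∈ N ∧ ζ (γ s) = s * a + b) : φ.IsIsometricAt γ I t := by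
  obtain ⟨ε, hε, he⟩ := Metric.eventually_nhds_iff.1 h
  refine ⟨ε, hε, fun s hs s' hs' h1 h2 => ?_⟩
  obtain ⟨m1, e1⟩ := he (y := s) h1 hs
  obtain ⟨m2, e2⟩ := he (y := s') h2 hs'
  rw [hN _ m1 _ m2, e1, e2, show (s' : ℂ) * a + b - (s * a + b) = ((s' - s : ℝ) : ℂ) * a by
    push_cast; ring, norm_mul, ha, mul_one, Complex.norm_real, Real.norm_eq_abs, abs_sub_comm]

end IsIsometricAt

theorem threshold_le {γ : ℝ → X} {L : ℝ} (hL : 0 < L)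
    (hγ : ∀ t ∈ Icc 0 L, φ.IsIsometricAt γ (Icc 0 L) t) (h0 : γ 0 ∈ φ.zeros) (h1 : γ L ∈ φ.zeros)
    (hint : ∀ t ∈ Ioo 0 L, γ t ∉ φ.zeros) : φ.threshold ≤ ENNReal.ofReal L :=
  iInf₂_le_of_le γ L (iInf_le_of_le ⟨⟨hL, hγ⟩, h0, h1, hint⟩ le_rfl)

variable [IsManifold 𝓘(ℂ) ω X] [T2Space X]

theorem isIsometricAt_ray_of_pos {ψ : ℂ → X} {U : Set ℂ} (hU : IsOpen U)
    (hψ : IsDev φ modelZero ψ U) {w : ℂ} (hw : w ≠ 0) {t : ℝ} (ht : 0 < t) (htU : ray w t ∈ U) :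
    φ.IsIsometricAt (fun s => ψ (ray w s)) univ t := by
  have h0 : 0 < ‖w‖ ^ (3 / 2 : ℝ) := Real.rpow_pos_of_pos (norm_pos_iff.2 hw) _
  obtain ⟨ζ, hζ, hζe⟩ := exists_flat_coord_of_isDev hU hψ (isOpen_slitDomain w)
    (isDev_sqrtCube hw) htU (ray_mem_slitDomain hw ht) (by simpa using ray_ne_zero hw ht)
  obtain ⟨N, hN, hNs, hNd⟩ := exists_nhds_dist_eq hζ
  refine IsIsometricAt.of_coord hNd (a := ((‖w‖ ^ (3 / 2 : ℝ) : ℝ) : ℂ)⁻¹ * sqrtCube w w)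
    (b := - sqrtCube w (ray w t)) ?_ ?_
  · rw [norm_mul, norm_inv, norm_sqrtCube hw, Complex.norm_real, Real.norm_of_nonneg h0.le,
      inv_mul_cancel₀ h0.ne']
  · have hc : ContinuousAt (fun s => ψ (ray w s)) t :=
      ContinuousAt.comp (f := ray w) (g := ψ) (hψ.continuousOn.continuousAt (hU.mem_nhds htU))
        (continuous_ray w).continuousAt
    filter_upwards [hc hN, (continuous_ray w).continuousAt.eventually hζe, lt_mem_nhds ht]
      with s h1 h2 h3 _
    refine ⟨h1, ?_⟩
    rw [h2.2, sqrtCube_ray hw h3.le]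
    push_cast
    ring

/-- There is no flat coordinate at the cone point. The length of the radius bounds the distance
above; the contraction `‖z‖ ^ (3 / 2)`, which equals arc length along the radius, bounds it below.
-/
theorem isIsometricAt_ray_zero {P : X} {z : OpenPartialHomeomorph X ℂ}
    (hz : φ.IsCanonicalCoord modelZero P z) {ψ : ℂ → X} {R : ℝ} (hR : 0 < R)
    (hψ : IsDev φ modelZero ψ (Metric.ball 0 R)) (hψz : ψ =ᶠ[𝓝 0] z.symm) {w : ℂ} (hw : w ≠ 0) :
    φ.IsIsometricAt (fun s => ψ (ray w s)) (Ici 0) 0 := by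
  have hc := isCanonicalCoord_iff.1 hz
  obtain ⟨N, hN, hNs, hNd⟩ := isModel_zero.exists_nhds_enorm_sub_le hc.2.2.2 hc.2.1 hc.2.2.1
  have h0t : (0 : ℂ) ∈ z.target := hc.2.2.1 ▸ z.map_source hc.2.1
  have hs0 : z.symm 0 = P := by rw [← hc.2.2.1, z.left_inv hc.2.1]
  have hray : Tendsto (ray w) (𝓝 0) (𝓝 0) := by
    simpa [ray_zero] using (continuous_ray w).tendsto 0
  have hev : ∀ᶠ x in 𝓝 (0 : ℂ), x ∈ Metric.ball (0 : ℂ) R ∧ ψ x ∈ N ∧ z (ψ x) = x := by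
    filter_upwards [Metric.ball_mem_nhds 0 hR, hψz, z.open_target.mem_nhds h0t,
      (z.symm.continuousAt h0t) (hs0.symm ▸ hN)] with x h1 h2 h3 h4
    rw [h2]
    exact ⟨h1, h4, z.right_inv h3⟩
  obtain ⟨ε, hε, he⟩ := Metric.eventually_nhds_iff.1 (hray.eventually hev)
  have key : ∀ s s' : ℝ, 0 ≤ s → s ≤ s' → |s - 0| < ε → |s' - 0| < ε →
      φ.dist (ψ (ray w s)) (ψ (ray w s')) = ENNReal.ofReal |s - s'| := by
    intro s s' hs hss h1 h2
    obtain ⟨a1, a2, a3⟩ := he (y := s) h1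
    obtain ⟨b1, b2, b3⟩ := he (y := s') h2
    have habs : |s - s'| = s' - s := by rw [abs_sub_comm, abs_of_nonneg (sub_nonneg.2 hss)]
    refine le_antisymm ?_ ?_
    · rw [habs]
      exact dist_ray_le hψ hw hs hss b1
    · have := hNd _ a2 _ b2
      rwa [a3, b3, norm_ray hw hs, norm_ray hw (hs.trans hss), ← ofReal_norm, Real.norm_eq_abs,
        abs_sub_comm] at this
  refine ⟨ε, hε, fun s hs s' hs' h1 h2 => ?_⟩
  rcases le_total s s' with h | h
  · exact key s s' hs h h1 h2
  · rw [φ.dist_comm, abs_sub_comm]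
    exact key s' s hs' h h2 h1

omit [IsManifold 𝓘(ℂ) ω X] [T2Space X] in
theorem notMem_zeros_of_isDev {ψ : ℂ → X} {U : Set ℂ} (hψ : IsDev φ modelZero ψ U) {x : ℂ}
    (hx : x ∈ U) (hx0 : x ≠ 0) : ψ x ∉ φ.zeros := fun h =>
  (complexDeriv_ne_zero_of_val_ne_zero hψ hx (by simpa using hx0)).2 ((mem_zeros_iff φ _).1 h)

/-- If a radius of length `L` from a zero ends at a zero, it is a saddle connection. -/
theorem threshold_le_of_radial_limit (hφ : φ.HasSimpleZeros) {P : X} (hP : P ∈ φ.zeros)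
    {z : OpenPartialHomeomorph X ℂ} (hz : φ.IsCanonicalCoord modelZero P z) {ψ : ℂ → X} {R : ℝ}
    (hR : 0 < R) (hψ : IsDev φ modelZero ψ (Metric.ball 0 R)) (hψz : ψ =ᶠ[𝓝 0] z.symm) {w : ℂ}
    (hw : ‖w‖ = R) {Q : X} (hQ : Q ∈ φ.zeros)
    (hlim : Tendsto (fun t : ℝ => ψ (t * w)) (𝓝[<] 1) (𝓝 Q))
    (hd : ∀ t : ℝ, 0 ≤ t → t < 1 → φ.dist (ψ (t * w)) Q ≤
      ENNReal.ofReal (1 ^ (3 / 2 : ℝ) * ‖w‖ ^ (3 / 2 : ℝ) - t ^ (3 / 2 : ℝ) * ‖w‖ ^ (3 / 2 : ℝ))) :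
    φ.threshold ≤ ENNReal.ofReal (R ^ (3 / 2 : ℝ)) := by
  have hw0 : w ≠ 0 := by
    rw [← norm_pos_iff, hw]
    exact hR
  set L := R ^ (3 / 2 : ℝ) with hLd
  have hL : 0 < L := Real.rpow_pos_of_pos hR _
  have hwL : ‖w‖ ^ (3 / 2 : ℝ) = L := by rw [hw]
  -- The developing map need not have the right value at `w`, so the radius is closed up by its
  -- limit.
  let γ : ℝ → X := fun t => if t < L then ψ (ray w t) else Q
  have γlt : ∀ t, t < L → γ t = ψ (ray w t) := fun t ht => if_pos ht
  have γL : γ L = Q := if_neg (lt_irrefl L)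
  have hball : ∀ t, 0 ≤ t → t < L → ray w t ∈ Metric.ball (0 : ℂ) R := fun t h0 h1 =>
    mem_ball_zero_iff.2 (norm_ray_lt hw0 h0 hR.le h1)
  have hz0 : ψ 0 = P := by
    have hc := isCanonicalCoord_iff.1 hz
    rw [hψz.self_of_nhds, ← hc.2.2.1, z.left_inv hc.2.1]
  have hnz : ∀ t ∈ Ioo 0 L, γ t ∉ φ.zeros := fun t ht => by
    rw [γlt t ht.2]
    exact notMem_zeros_of_isDev hψ (hball t ht.1.le ht.2) (ray_ne_zero hw0 ht.1)
  have hdQ : ∀ t, 0 ≤ t → t < L → φ.dist (γ t) Q ≤ ENNReal.ofReal (L - t) := by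
    intro t h0 h1
    rw [γlt t h1]
    have hq : 0 ≤ t / L := by positivity
    have := hd ((t / L) ^ (2 / 3 : ℝ)) (by positivity)
      (Real.rpow_lt_one hq ((div_lt_one hL).2 h1) (by norm_num))
    rw [rpow_two_thirds_rpow hq, hwL, div_mul_cancel₀ _ hL.ne', Real.one_rpow, one_mul] at this
    unfold ray
    rwa [hwL]
  have hle : ∀ s t, 0 ≤ s → s ≤ t → t ≤ L → φ.dist (γ s) (γ t) ≤ ENNReal.ofReal (t - s) := by
    intro s t hs hst ht
    rcases ht.lt_or_eq with ht | rfl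
    · rw [γlt t ht, γlt s (hst.trans_lt ht)]
      exact dist_ray_le hψ hw0 hs hst (hball t (hs.trans hst) ht)
    · rcases hst.lt_or_eq with hst | rfl
      · rw [γL]
        exact hdQ s hs hst
      · rw [φ.dist_self]
        exact zero_le
  have hIio : ∀ t, t < L → ∀ᶠ s in 𝓝 t, γ s = ψ (ray w s) := fun t ht =>
    (gt_mem_nhds ht).mono fun s hs => γlt s hs
  have hiso : ∀ t, 0 ≤ t → t < L → φ.IsIsometricAt γ (Ici 0) t := by
    intro t h0 h1
    refine IsIsometricAt.congr ?_ ((hIio t h1).mono fun s hs _ => hs)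
    rcases h0.eq_or_lt with rfl | h0
    · exact isIsometricAt_ray_zero hz hR hψ hψz hw0
    · exact (isIsometricAt_ray_of_pos Metric.isOpen_ball hψ hw0 h0 (hball t h0.le h1)).mono
        (subset_univ _)
  refine threshold_le hL (fun t ht => ?_) (by rw [γlt 0 hL, ray_zero, hz0]; exact hP)
    (by rw [γL]; exact hQ) hnz
  rcases ht.2.lt_or_eq with htL | rfl
  · exact (hiso t ht.1 htL).mono fun s hs => hs.1
  -- The end point `Q`.
  obtain ⟨e, he⟩ := exists_isCanonicalCoord_modelZero (hφ Q hQ)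
  have hc := isCanonicalCoord_iff.1 he
  obtain ⟨N, hN, hNs, hNd⟩ := isModel_zero.exists_nhds_enorm_sub_le hc.2.2.2 hc.2.1 hc.2.2.1
  have hlimγ : Tendsto γ (𝓝[<] L) (𝓝 Q) := by
    have h1 : Tendsto (fun s : ℝ => (s / L) ^ (2 / 3 : ℝ)) (𝓝[<] L) (𝓝[<] 1) := by
      refine tendsto_nhdsWithin_iff.2 ⟨?_, ?_⟩
      · have h2 : Continuous (fun s : ℝ => (s / L) ^ (2 / 3 : ℝ)) :=
          (Real.continuous_rpow_const (by norm_num)).comp (continuous_id.div_const _)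
        have h3 := h2.tendsto L
        simp only [div_self hL.ne', Real.one_rpow] at h3
        exact h3.mono_left nhdsWithin_le_nhds
      · filter_upwards [Ioo_mem_nhdsLT hL] with s hs
        exact Real.rpow_lt_one (div_nonneg hs.1.le hL.le) ((div_lt_one hL).2 hs.2) (by norm_num)
    refine (hlim.comp h1).congr' ?_
    filter_upwards [self_mem_nhdsWithin] with s hs
    rw [γlt s hs, ray, hwL]
    rfl
  obtain ⟨a, ha, haN⟩ := (mem_nhdsLT_iff_exists_mem_Ico_Ioo_subset hL).1 (hlimγ hN)
  have hQN : Q ∈ N := mem_of_mem_nhds hN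
  have hpos : ∀ s ∈ Ioo a L, 0 < s := fun s hs => ha.1.trans_lt hs.1
  have hr : ∀ s ∈ Ioo a L, ‖e (γ s)‖ ^ (3 / 2 : ℝ) ≤ L - s := by
    intro s hs
    have h1 := hNd _ (haN hs) _ hQN
    have h2 := h1.trans (hdQ s (hpos s hs).le hs.2)
    rw [← ofReal_norm, ENNReal.ofReal_le_ofReal_iff (sub_nonneg.2 hs.2.le), hc.2.2.1] at h2
    simpa [Real.zero_rpow, abs_of_nonneg (Real.rpow_nonneg (norm_nonneg (e (γ s))) (3 / 2))]
      using h2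
  obtain ⟨β, c, hβ⟩ := exists_quadratic_norm hφ he (a := a) (b := L) (γ := γ)
    (fun s hs => ⟨hNs (haN hs), fun h => by
      have h1 : γ s = Q := e.injOn (hNs (haN hs)) hc.2.1 (h.trans hc.2.2.1.symm)
      exact hnz s ⟨hpos s hs, hs.2⟩ (h1 ▸ hQ)⟩)
    (fun s hs => (hiso s (hpos s hs).le hs.2).mono fun u hu => (hpos u hu).le)
  -- A monic quadratic lying between `0` and `(L - s) ^ 2` up to `s = L` has a double root at `L`.
  -- So the distance to `Q` decreases at unit speed, which gives the isometry at the end point.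
  have hβ' : ∀ s ∈ Ioo a L, ‖e (γ s)‖ ^ (3 / 2 : ℝ) = L - s := by
    have hcl : closure (Ioo a L) = Icc a L := closure_Ioo ha.2.ne
    have f1 : ∀ s ∈ Icc a L, s ^ 2 + β * s + c ≤ (L - s) ^ 2 := by
      intro s hs
      rw [← hcl] at hs
      refine le_on_closure (s := Ioo a L) (f := fun s => s ^ 2 + β * s + c)
        (g := fun s => (L - s) ^ 2) (fun u hu => ?_) (by fun_prop) (by fun_prop) hs
      rw [← hβ u hu]
      exact pow_le_pow_left₀ (by positivity) (hr u hu) 2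
    have f2 : ∀ s ∈ Icc a L, 0 ≤ s ^ 2 + β * s + c := by
      intro s hs
      rw [← hcl] at hs
      refine le_on_closure (s := Ioo a L) (f := fun _ => 0)
        (g := fun s => s ^ 2 + β * s + c) (fun u hu => ?_) (by fun_prop) (by fun_prop) hs
      rw [← hβ u hu]
      positivity
    have f3 : L ^ 2 + β * L + c = 0 := by
      have h1 := f1 L ⟨ha.2.le, le_rfl⟩
      have h2 := f2 L ⟨ha.2.le, le_rfl⟩
      rw [sub_self, zero_pow two_ne_zero] at h1
      exact le_antisymm h1 h2
    have f4 : 0 ≤ 2 * L + β := by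
      have h1 := f1 a ⟨le_rfl, ha.2.le⟩
      have h2 : 0 < L - a := sub_pos.2 ha.2
      by_contra hneg
      nlinarith [mul_neg_of_pos_of_neg h2 (not_le.1 hneg)]
    have f5 : 2 * L + β ≤ 0 := by
      have h1 : ∀ s ∈ Ioo a L, s + L + β ≤ 0 := by
        intro s hs
        have h2 := f2 s (Ioo_subset_Icc_self hs)
        have h3 : 0 < L - s := sub_pos.2 hs.2
        by_contra hpos'
        nlinarith [mul_pos h3 (not_le.1 hpos')]
      have h2 := le_on_closure (s := Ioo a L) (f := fun s => s + L + β) (g := fun _ => 0) h1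
        (by fun_prop) (by fun_prop) (hcl ▸ ⟨ha.2.le, le_rfl⟩ : L ∈ closure (Ioo a L))
      linarith
    have f6 : β = -(2 * L) := by linarith
    intro s hs
    have h1 := hβ s hs
    have h2 : (‖e (γ s)‖ ^ (3 / 2 : ℝ)) ^ 2 = (L - s) ^ 2 := by
      rw [h1]
      subst f6
      linear_combination f3
    exact (pow_left_inj₀ (by positivity) (sub_nonneg.2 hs.2.le) two_ne_zero).1 h2
  have hmem : ∀ s ∈ Ioc a L, γ s ∈ N ∧ ‖e (γ s)‖ ^ (3 / 2 : ℝ) = L - s := by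
    intro s hs
    rcases hs.2.lt_or_eq with h | rfl
    · exact ⟨haN ⟨hs.1, h⟩, hβ' s ⟨hs.1, h⟩⟩
    · rw [γL, hc.2.2.1, norm_zero, Real.zero_rpow (by norm_num), sub_self]
      exact ⟨hQN, rfl⟩
  have key : ∀ s s', s ∈ Ioc a L → s' ∈ Ioc a L → s ≤ s' →
      φ.dist (γ s) (γ s') = ENNReal.ofReal |s - s'| := by
    intro s s' hs hs' hss
    refine le_antisymm ?_ ?_
    · rw [abs_sub_comm, abs_of_nonneg (sub_nonneg.2 hss)]
      exact hle s s' (ha.1.trans hs.1.le) hss hs'.2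
    · have := hNd _ (hmem s hs).1 _ (hmem s' hs').1
      rwa [(hmem s hs).2, (hmem s' hs').2, ← ofReal_norm, Real.norm_eq_abs,
        sub_sub_sub_cancel_left] at this
  refine ⟨L - a, sub_pos.2 ha.2, fun s hs s' hs' h1 h2 => ?_⟩
  have m1 : s ∈ Ioc a L := ⟨by linarith [(abs_lt.1 h1).1], hs.2⟩
  have m2 : s' ∈ Ioc a L := ⟨by linarith [(abs_lt.1 h2).1], hs'.2⟩
  rcases le_total s s' with h | h
  · exact key s s' m1 m2 h
  · rw [φ.dist_comm, abs_sub_comm]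
    exact key s' s m2 m1 h

end QuadraticDifferential

end

/-! ### Minimal pairs with the same image, and radii that meet head-on. -/

noncomputable section

/-- If a locally injective map is not injective on a closed disc, then there is a pair of points
with the same image whose larger modulus is minimal. -/
theorem exists_minimal_pair_of_not_injOn {X : Type*} [TopologicalSpace X] [T2Space X] {ψ : ℂ → X}
    {r : ℝ} (hc : ContinuousOn ψ (Metric.closedBall 0 r))
    (hloc : ∀ w ∈ Metric.closedBall (0 : ℂ) r, ∃ N ∈ 𝓝 w, InjOn ψ N)
    (hn : ¬ InjOn ψ (Metric.closedBall 0 r)) :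
    ∃ w₁ w₂, w₁ ≠ w₂ ∧ ψ w₁ = ψ w₂ ∧ ‖w₁‖ ≤ ‖w₂‖ ∧ ‖w₂‖ ≤ r ∧
      ∀ x y, ψ x = ψ y → ‖x‖ < ‖w₂‖ → ‖y‖ < ‖w₂‖ → x = y := by
  set K := Metric.closedBall (0 : ℂ) r with hK
  have hKc : IsCompact (K ×ˢ K) := (isCompact_closedBall _ _).prod (isCompact_closedBall _ _)
  let C : Set (ℂ × ℂ) := K ×ˢ K ∩ (fun p => (ψ p.1, ψ p.2)) ⁻¹' diagonal X
  have hC : IsClosed C := by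
    refine ContinuousOn.preimage_isClosed_of_isClosed ?_ hKc.isClosed isClosed_diagonal
    exact (hc.comp continuousOn_fst fun p hp => hp.1).prodMk
      (hc.comp continuousOn_snd fun p hp => hp.2)
  let E : Set (ℂ × ℂ) := {p | p ∈ C ∧ p.1 ≠ p.2}
  -- Local injectivity keeps the pairs in `E` from accumulating on the diagonal.
  have hE : IsClosed E := by
    refine isClosed_of_closure_subset fun p hp => ?_
    have hpC : p ∈ C := closure_minimal (fun q hq => hq.1) hC hp
    refine ⟨hpC, fun heq => ?_⟩
    obtain ⟨N, hN, hinj⟩ := hloc p.1 hpC.1.1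
    obtain ⟨q, hq, hqE⟩ := mem_closure_iff_nhds.1 hp (N ×ˢ N)
      (prod_mem_nhds hN (heq ▸ hN))
    exact hqE.2 (hinj hq.1 hq.2 hqE.1.2)
  have hEc : IsCompact E := hKc.of_isClosed_subset hE fun p hp => hp.1.1
  have hne : E.Nonempty := by
    unfold InjOn at hn
    push Not at hn
    obtain ⟨x, hx, y, hy, h, hxy⟩ := hn
    exact ⟨(x, y), ⟨⟨hx, hy⟩, h⟩, hxy⟩
  obtain ⟨p, hp, hmin⟩ := hEc.exists_isMinOn hne (f := fun p => max ‖p.1‖ ‖p.2‖)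
    (by fun_prop)
  have hmin' : ∀ x y, ψ x = ψ y → ‖x‖ < max ‖p.1‖ ‖p.2‖ → ‖y‖ < max ‖p.1‖ ‖p.2‖ → x = y := by
    intro x y h hx hy
    by_contra hxy
    have hr : max ‖p.1‖ ‖p.2‖ ≤ r := max_le (mem_closedBall_zero_iff.1 hp.1.1.1)
      (mem_closedBall_zero_iff.1 hp.1.1.2)
    have : (x, y) ∈ E := ⟨⟨⟨mem_closedBall_zero_iff.2 (hx.le.trans hr),
      mem_closedBall_zero_iff.2 (hy.le.trans hr)⟩, h⟩, hxy⟩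
    exact (max_lt hx hy).not_ge (hmin this)
  have hn1 := mem_closedBall_zero_iff.1 hp.1.1.1
  have hn2 := mem_closedBall_zero_iff.1 hp.1.1.2
  rcases le_total ‖p.1‖ ‖p.2‖ with h | h
  · rw [max_eq_right h] at hmin'
    exact ⟨p.1, p.2, hp.2, hp.1.2, h, hn2, hmin'⟩
  · rw [max_eq_left h] at hmin'
    exact ⟨p.2, p.1, hp.2.symm, hp.1.2.symm, h, hn1, hmin'⟩

namespace QuadraticDifferential

variable {X : Type*} [TopologicalSpace X] [ChartedSpace ℂ X]
  [IsManifold 𝓘(ℂ) ω X] {φ : QuadraticDifferential X}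

/-- Since `φ₀` vanishes at `0`, the pull-back equation says nothing there; the derivative is nonzero
because `z` inverts `ψ` near `0`. -/
theorem complexDeriv_ne_zero_of_eventuallyEq_symm {φ' : QuadraticDifferential ℂ} {P : X}
    {z : OpenPartialHomeomorph X ℂ} (hz : φ.IsCanonicalCoord φ' P z) {ψ : ℂ → X}
    (h : ψ =ᶠ[𝓝 0] z.symm) : complexDeriv ψ 0 ≠ 0 := by
  have hc := isCanonicalCoord_iff.1 hz
  have h0 : (0 : ℂ) ∈ z.target := hc.2.2.1 ▸ z.map_source hc.2.1
  rw [complexDeriv_congr h]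
  have := complexDeriv_mul_of_leftInverse
    (hz.isDev.mdifferentiableAt z.open_source (z.map_target h0))
    (hz.isDev_symm.mdifferentiableAt z.open_target h0) (z.eventually_right_inverse h0)
  exact right_ne_zero_of_mul (this ▸ one_ne_zero)

theorem complexDeriv_ne_zero_of_isDev {φ' : QuadraticDifferential ℂ} {P : X}
    {z : OpenPartialHomeomorph X ℂ} (hz : φ.IsCanonicalCoord φ' P z)
    (hv : ∀ w, φ'.val w = 0 → w = 0) {ψ : ℂ → X} {U : Set ℂ} (hψ : IsDev φ φ' ψ U)
    (hψz : ψ =ᶠ[𝓝 0] z.symm) {w : ℂ} (hw : w ∈ U) : complexDeriv ψ w ≠ 0 := by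
  by_cases h : w = 0
  · rw [h]
    exact complexDeriv_ne_zero_of_eventuallyEq_symm hz hψz
  · exact (complexDeriv_ne_zero_of_val_ne_zero hψ hw fun h' => h (hv w h')).1

theorem eq_zero_of_val_modelZero {w : ℂ} (h : modelZero.val w = 0) : w = 0 := by
  simpa using h

variable [T2Space X]

/-- Two radii from the same zero which meet head-on form a saddle connection. -/
theorem threshold_le_of_antipodal {P : X} (hP : P ∈ φ.zeros)
    {z : OpenPartialHomeomorph X ℂ} (hz : φ.IsCanonicalCoord modelZero P z) {ψ : ℂ → X} {R : ℝ}
    (hψ : IsDev φ modelZero ψ (Metric.ball 0 R)) (hψz : ψ =ᶠ[𝓝 0] z.symm) {w₁ w₂ : ℂ}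
    (hw₁ : w₁ ≠ 0) (hw : ‖w₂‖ = ‖w₁‖) (hR : ‖w₁‖ < R) (hψw : ψ w₁ = ψ w₂)
    {ζ : OpenPartialHomeomorph X ℂ} (hζ : φ.IsCanonicalCoord modelFlat (ψ w₁) ζ)
    (h₁ : ∀ᶠ y in 𝓝 w₁, ζ (ψ y) = sqrtCube w₁ y - sqrtCube w₁ w₁) {η : ℂ}
    (h₂ : ∀ᶠ y in 𝓝 w₂, ζ (ψ y) = η * (sqrtCube w₂ y - sqrtCube w₂ w₂))
    (hη : η * sqrtCube w₂ w₂ = -sqrtCube w₁ w₁) :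
    φ.threshold ≤ ENNReal.ofReal (2 * ‖w₁‖ ^ (3 / 2 : ℝ)) := by
  have hw₂ : w₂ ≠ 0 := by
    rw [← norm_pos_iff, hw]
    exact norm_pos_iff.2 hw₁
  have hR0 : 0 < R := (norm_nonneg _).trans_lt hR
  set L := ‖w₁‖ ^ (3 / 2 : ℝ) with hLd
  have hL : 0 < L := Real.rpow_pos_of_pos (norm_pos_iff.2 hw₁) _
  have hL₂ : ‖w₂‖ ^ (3 / 2 : ℝ) = L := by rw [hw]
  have hLR : L < R ^ (3 / 2 : ℝ) := Real.rpow_lt_rpow (norm_nonneg _) hR (by norm_num)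
  -- Out along one radius, back along the other.
  let γ : ℝ → X := fun t => if t ≤ L then ψ (ray w₁ t) else ψ (ray w₂ (2 * L - t))
  have γle : ∀ t, t ≤ L → γ t = ψ (ray w₁ t) := fun t ht => if_pos ht
  have γgt : ∀ t, L < t → γ t = ψ (ray w₂ (2 * L - t)) := fun t ht => if_neg ht.not_ge
  have hball₁ : ∀ t, 0 ≤ t → t ≤ L → ray w₁ t ∈ Metric.ball (0 : ℂ) R := fun t h0 h1 =>
    mem_ball_zero_iff.2 (norm_ray_lt hw₁ h0 hR0.le (h1.trans_lt hLR))
  have hball₂ : ∀ t, 0 ≤ t → t ≤ L → ray w₂ t ∈ Metric.ball (0 : ℂ) R := fun t h0 h1 =>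
    mem_ball_zero_iff.2 (norm_ray_lt hw₂ h0 hR0.le (h1.trans_lt hLR))
  have hz0 : ψ 0 = P := by
    have hc := isCanonicalCoord_iff.1 hz
    rw [hψz.self_of_nhds, ← hc.2.2.1, z.left_inv hc.2.1]
  refine threshold_le (γ := γ) (by positivity) (fun t ht => ?_) ?_ ?_ (fun t ht => ?_)
  · rcases lt_trichotomy t L with htL | htL | htL
    · have hev : ∀ᶠ s in 𝓝 t, s ∈ Icc 0 (2 * L) → γ s = ψ (ray w₁ s) :=
        (gt_mem_nhds htL).mono fun s hs _ => γle s hs.le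
      refine IsIsometricAt.congr ?_ hev
      rcases ht.1.eq_or_lt with rfl | h0
      · exact (isIsometricAt_ray_zero hz hR0 hψ hψz hw₁).mono fun s hs => hs.1
      · exact (isIsometricAt_ray_of_pos Metric.isOpen_ball hψ hw₁ h0
          (hball₁ t h0.le htL.le)).mono (subset_univ _)
    -- At the junction both halves are affine in `ζ`, and `hη` gives them the same slope, so they
    -- form one straight segment.
    · obtain ⟨N, hN, hNs, hNd⟩ := exists_nhds_dist_eq hζ
      have r₁ : Tendsto (ray w₁) (𝓝 t) (𝓝 w₁) := by
        have := (continuous_ray w₁).tendsto L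
        rwa [ray_self hw₁, ← htL] at this
      have r₂ : Tendsto (fun s => ray w₂ (2 * L - s)) (𝓝 t) (𝓝 w₂) := by
        have h : Tendsto (fun s => ray w₂ (2 * L - s)) (𝓝 L) (𝓝 (ray w₂ (2 * L - L))) :=
          ((continuous_ray w₂).tendsto _).comp ((continuous_const.sub continuous_id).tendsto L)
        have e : 2 * L - L = ‖w₂‖ ^ (3 / 2 : ℝ) := by rw [hL₂]; ring
        rw [e, ray_self hw₂] at h
        rwa [htL]
      have b₁ : w₁ ∈ Metric.ball (0 : ℂ) R := mem_ball_zero_iff.2 hR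
      have b₂ : w₂ ∈ Metric.ball (0 : ℂ) R := mem_ball_zero_iff.2 (hw.trans_lt hR)
      have n₁ : ∀ᶠ y in 𝓝 w₁, ψ y ∈ N :=
        hψ.continuousOn.continuousAt (Metric.isOpen_ball.mem_nhds b₁) hN
      have n₂ : ∀ᶠ y in 𝓝 w₂, ψ y ∈ N :=
        hψ.continuousOn.continuousAt (Metric.isOpen_ball.mem_nhds b₂) (hψw ▸ hN)
      refine IsIsometricAt.of_coord hNd (a := ((L : ℝ) : ℂ)⁻¹ * sqrtCube w₁ w₁)
        (b := - sqrtCube w₁ w₁) ?_ ?_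
      · rw [norm_mul, norm_inv, norm_sqrtCube hw₁, Complex.norm_real, Real.norm_of_nonneg hL.le,
          inv_mul_cancel₀ hL.ne']
      · have hL0 : (L : ℂ) ≠ 0 := Complex.ofReal_ne_zero.2 hL.ne'
        filter_upwards [r₁.eventually (n₁.and h₁), r₂.eventually (n₂.and h₂)]
          with s q₁ q₂ hs
        rcases le_or_gt s L with hsL | hsL
        · rw [γle s hsL]
          refine ⟨q₁.1, ?_⟩
          rw [q₁.2, sqrtCube_ray hw₁ hs.1]
          push_cast
          ring
        · rw [γgt s hsL]
          refine ⟨q₂.1, ?_⟩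
          rw [q₂.2, sqrtCube_ray hw₂ (sub_nonneg.2 hs.2), hL₂]
          push_cast
          have e : ∀ c : ℂ, η * (c * sqrtCube w₂ w₂ - sqrtCube w₂ w₂)
              = (c - 1) * (η * sqrtCube w₂ w₂) := fun c => by ring
          rw [e, hη]
          field_simp
          ring
    · have hev : ∀ᶠ s in 𝓝 t, s ∈ Icc 0 (2 * L) → γ s = ψ (ray w₂ (2 * L - s)) :=
        (lt_mem_nhds htL).mono fun s hs _ => γgt s hs
      refine IsIsometricAt.congr ?_ hev
      -- The second half is a radius run backwards; its far end is handled as an initial point at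
      -- the zero.
      rcases ht.2.eq_or_lt with h2 | h2
      · refine ((isIsometricAt_ray_zero hz hR0 hψ hψz hw₂).reflect (c := 2 * L)
          (sub_eq_zero.2 h2.symm)).mono fun s hs => ?_
        exact sub_nonneg.2 hs.2
      · refine ((isIsometricAt_ray_of_pos Metric.isOpen_ball hψ hw₂ (sub_pos.2 h2)
          (hball₂ _ (sub_nonneg.2 h2.le) (by linarith))).reflect (c := 2 * L) rfl).mono
          (subset_univ _)
  · rwa [γle 0 hL.le, ray_zero, hz0]
  · rwa [γgt _ (by linarith), sub_self, ray_zero, hz0]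
  · rcases le_or_gt t L with h | h
    · rw [γle t h]
      exact notMem_zeros_of_isDev hψ (hball₁ t ht.1.le h) (ray_ne_zero hw₁ ht.1)
    · rw [γgt t h]
      have h0 : 0 < 2 * L - t := sub_pos.2 ht.2
      exact notMem_zeros_of_isDev hψ (hball₂ _ h0.le (by linarith)) (ray_ne_zero hw₂ h0)

end QuadraticDifferential

end

/-! ### Injectivity up to half the threshold. -/

noncomputable section

/-- Two discs of radius `L`, translated so that their boundary points `a` and `b` coincide, are
disjoint near that point only if `a` and `b` are opposite. Otherwise moving `b` towards `-a` enters
one disc, and the translated point, on the segment from `a` to `-b`, enters the other. -/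
theorem eq_neg_of_eventually_norm {a b : ℂ} {L : ℝ} (ha : ‖a‖ = L) (hb : ‖b‖ = L)
    (h : ∀ᶠ v in 𝓝 b, ¬ (‖v‖ < L ∧ ‖v - b + a‖ < L)) : b = -a := by
  by_contra hne
  have ht : Tendsto (fun t : ℝ => (1 - t) • b + t • (-a)) (𝓝[>] 0) (𝓝 b) := by
    have hc : Continuous fun t : ℝ => (1 - t) • b + t • (-a) := by fun_prop
    have := hc.tendsto 0
    simp only [sub_zero, one_smul, zero_smul, add_zero] at this
    exact this.mono_left nhdsWithin_le_nhds
  obtain ⟨t, h1, h2⟩ := ((ht.eventually h).and (Ioo_mem_nhdsGT zero_lt_one)).exists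
  refine h1 ⟨?_, ?_⟩
  · exact norm_combo_lt_of_ne hb.le (by rw [norm_neg, ha]) hne (sub_pos.2 h2.2) h2.1 (by ring)
  · have e : (1 - t) • b + t • (-a) - b + a = (1 - t) • a + t • (-b) := by
      simp only [sub_smul, one_smul, smul_neg]
      ring
    rw [e]
    exact norm_combo_lt_of_ne ha.le (by rw [norm_neg, hb])
      (fun hab => hne (by rw [hab, neg_neg])) (sub_pos.2 h2.2) h2.1 (by ring)

namespace QuadraticDifferential

/-- The derivative is nonzero at `w`, so conditions near the image point can be checked on points
near `w`. -/
theorem map_nhds_mul_sqrtCube {η w : ℂ} (hη : η ≠ 0) (hw : w ≠ 0) :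
    map (fun y => η * sqrtCube w y) (𝓝 w) = 𝓝 (η * sqrtCube w w) := by
  obtain ⟨h1, h2⟩ := (isDev_modelFlat_iff (isOpen_slitDomain w)).1 (isDev_sqrtCube hw)
  have hd := ((h1.analyticAt ((isOpen_slitDomain w).mem_nhds
    (self_mem_slitDomain hw))).hasStrictDerivAt).const_mul η
  refine hd.map_nhds_eq (mul_ne_zero hη fun h => hw ?_)
  have := h2 w (self_mem_slitDomain hw)
  rw [h] at this
  exact eq_zero_of_val_modelZero (by rw [← this]; ring)

variable {X : Type*} [TopologicalSpace X] [ChartedSpace ℂ X]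
  [IsManifold 𝓘(ℂ) ω X] [T2Space X] {φ : QuadraticDifferential X}

omit [T2Space X] in
-- This allows the radii of two points with the same image to be compared in a single flat
-- coordinate, at the cost of a sign.
theorem eventually_flat_coord_eq {ψ : ℂ → X} {R : ℝ}
    (hψ : IsDev φ modelZero ψ (Metric.ball 0 R)) {w : ℂ} (hw : w ≠ 0) (hR : ‖w‖ < R)
    {ζ : OpenPartialHomeomorph X ℂ} (hζ : φ.IsCanonicalCoord modelFlat (ψ w) ζ) :
    ∃ η : ℂ, (η = 1 ∨ η = -1) ∧
      ∀ᶠ y in 𝓝 w, ζ (ψ y) = η * (sqrtCube w y - sqrtCube w w) := by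
  have hc := isCanonicalCoord_iff.1 hζ
  have hwb : w ∈ Metric.ball (0 : ℂ) R := mem_ball_zero_iff.2 hR
  have hev : ∀ᶠ y in 𝓝 w, (y ∈ Metric.ball (0 : ℂ) R ∧ y ∈ slitDomain w) ∧ y ≠ 0 ∧
      ψ y ∈ ζ.source := by
    filter_upwards [Metric.isOpen_ball.mem_nhds hwb,
      (isOpen_slitDomain w).mem_nhds (self_mem_slitDomain hw), isOpen_ne.mem_nhds hw,
      (hψ.continuousOn.continuousAt (Metric.isOpen_ball.mem_nhds hwb))
        (ζ.open_source.mem_nhds hc.2.1)] with y h1 h2 h3 h4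
    exact ⟨⟨h1, h2⟩, h3, h4⟩
  obtain ⟨ε, hε, hb⟩ := Metric.eventually_nhds_iff_ball.1 hev
  obtain ⟨η, c, hη, h⟩ := IsDev.eq_neg_or_eq_add (f := ζ ∘ ψ) (g := sqrtCube w)
    Metric.isOpen_ball (Metric.isPreconnected_ball (x := w) (r := ε))
    (hc.2.2.2.comp (hψ.mono fun y hy => (hb y hy).1.1) ζ.open_source Metric.isOpen_ball
      fun y hy => (hb y hy).2.2)
    ((isDev_sqrtCube hw).mono fun y hy => (hb y hy).1.2)
    (fun y hy h0 => (hb y hy).2.1 (eq_zero_of_val_modelZero h0))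
  refine ⟨η, hη, ?_⟩
  have h0 := h w (Metric.mem_ball_self hε)
  rw [Function.comp_apply, hc.2.2.1] at h0
  filter_upwards [Metric.ball_mem_nhds w hε] with y hy
  have := h y hy
  rw [Function.comp_apply] at this
  rw [this]
  linear_combination -h0

/-- The developing map of a zero is injective up to half the threshold. -/
theorem injOn_ball {P : X} (hP : P ∈ φ.zeros) {z : OpenPartialHomeomorph X ℂ}
    (hz : φ.IsCanonicalCoord modelZero P z) {ψ : ℂ → X} {R : ℝ}
    (hψ : IsDev φ modelZero ψ (Metric.ball 0 R)) (hψz : ψ =ᶠ[𝓝 0] z.symm)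
    (hM : ENNReal.ofReal (2 * R ^ (3 / 2 : ℝ)) ≤ φ.threshold) : InjOn ψ (Metric.ball 0 R) := by
  have hloc : ∀ w ∈ Metric.ball (0 : ℂ) R, ∃ Φ : OpenPartialHomeomorph ℂ X, w ∈ Φ.source ∧
      EqOn ψ Φ Φ.source := by
    intro w hw
    obtain ⟨Φ, h1, -, h3⟩ := isLocalDiffeomorphAt_of_complexDeriv_ne_zero Metric.isOpen_ball
      hψ.contMDiffOn hw (complexDeriv_ne_zero_of_isDev hz (fun _ => eq_zero_of_val_modelZero)
        hψ hψz hw)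
    exact ⟨Φ.toOpenPartialHomeomorph, h1, h3⟩
  intro x hx y hy hxy
  set r := max ‖x‖ ‖y‖ with hr
  have hrR : r < R := max_lt (mem_ball_zero_iff.1 hx) (mem_ball_zero_iff.1 hy)
  have hsub : Metric.closedBall (0 : ℂ) r ⊆ Metric.ball 0 R := Metric.closedBall_subset_ball hrR
  suffices hinj : InjOn ψ (Metric.closedBall 0 r) from
    hinj (mem_closedBall_zero_iff.2 (le_max_left _ _))
      (mem_closedBall_zero_iff.2 (le_max_right _ _)) hxy
  by_contra hn
  obtain ⟨w₁, w₂, hne, hψw, hle, hwr, hmin⟩ := exists_minimal_pair_of_not_injOn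
    (hψ.continuousOn.mono hsub) (fun w hw => by
      obtain ⟨Φ, h1, h2⟩ := hloc w (hsub hw)
      exact ⟨Φ.source, Φ.open_source.mem_nhds h1, h2.symm.injOn_iff.1 Φ.injOn⟩) hn
  have hR₂ : ‖w₂‖ < R := hwr.trans_lt hrR
  have hR₁ : ‖w₁‖ < R := hle.trans_lt hR₂
  obtain ⟨Φ, hΦ, hΦe⟩ := hloc w₁ (mem_ball_zero_iff.2 hR₁)
  have hc₂ : ContinuousAt ψ w₂ := hψ.continuousOn.continuousAt
    (Metric.isOpen_ball.mem_nhds (mem_ball_zero_iff.2 hR₂))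
  have hΦw : ψ w₂ = Φ w₁ := by rw [← hψw, hΦe hΦ]
  have htgt : ψ w₂ ∈ Φ.target := hΦw ▸ Φ.map_source hΦ
  -- Each `y` near `w₂` acquires a partner near `w₁` with the same image.
  have hσ : Tendsto (fun y => Φ.symm (ψ y)) (𝓝 w₂) (𝓝 w₁) := by
    have h1 := (Φ.symm.continuousAt htgt).tendsto.comp hc₂
    rwa [hΦw, Φ.left_inv hΦ] at h1
  have hσψ : ∀ᶠ y in 𝓝 w₂, ψ (Φ.symm (ψ y)) = ψ y := by
    filter_upwards [hc₂ (Φ.open_target.mem_nhds htgt)] with y hy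
    rw [hΦe (Φ.map_target hy), Φ.right_inv hy]
  have hσne : ∀ᶠ y in 𝓝 w₂, Φ.symm (ψ y) ≠ y := by
    have := hσ.prodMk_nhds (tendsto_id (α := ℂ) (x := 𝓝 w₂))
    exact this (isClosed_diagonal.isOpen_compl.mem_nhds hne)
  -- This is the minimality of the pair.
  have hstar : ∀ᶠ y in 𝓝 w₂, ¬ (‖y‖ < ‖w₂‖ ∧ ‖Φ.symm (ψ y)‖ < ‖w₂‖) := by
    filter_upwards [hσψ, hσne] with y h1 h2 h3
    exact h2 (hmin _ _ h1 h3.2 h3.1)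
  -- If `w₁` were strictly smaller, moving `w₂` slightly inwards would give a smaller pair.
  have hw : ‖w₁‖ = ‖w₂‖ := by
    refine hle.eq_or_lt.resolve_right fun hlt => ?_
    have h1 : ∀ᶠ y in 𝓝 w₂, ‖Φ.symm (ψ y)‖ < ‖w₂‖ := hσ.norm.eventually (gt_mem_nhds hlt)
    have hw2 : ‖w₂‖ ≠ 0 := ((norm_nonneg _).trans_lt hlt).ne'
    have h2 : w₂ ∈ closure (Metric.ball (0 : ℂ) ‖w₂‖) := by
      rw [closure_ball _ hw2]
      exact mem_closedBall_zero_iff.2 le_rfl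
    obtain ⟨y, hy, hyb⟩ := mem_closure_iff_nhds.1 h2 _ (h1.and hstar)
    exact hy.2 ⟨mem_ball_zero_iff.1 hyb, hy.1⟩
  have hw₁ : w₁ ≠ 0 := by
    rintro rfl
    rw [norm_zero, eq_comm, norm_eq_zero] at hw
    exact hne hw.symm
  have hw₂ : w₂ ≠ 0 := by
    rintro rfl
    rw [norm_zero, norm_eq_zero] at hw
    exact hw₁ hw
  obtain ⟨ζ, hζ, hζe⟩ := exists_flat_coord_of_isDev Metric.isOpen_ball hψ
    (isOpen_slitDomain w₁) (isDev_sqrtCube hw₁) (mem_ball_zero_iff.2 hR₁)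
    (self_mem_slitDomain hw₁) (fun h => hw₁ (eq_zero_of_val_modelZero h))
  obtain ⟨η, hη, hηe⟩ := eventually_flat_coord_eq hψ hw₂ hR₂ (hψw ▸ hζ)
  have hηn : ‖η‖ = 1 := by rcases hη with rfl | rfl <;> simp
  have hη0 : η ≠ 0 := norm_ne_zero_iff.1 (hηn ▸ one_ne_zero)
  -- For `v = η * sqrtCube w₂ y`, the translate `v - b + a` is the value of `sqrtCube w₁` at the
  -- partner of `y`; `hstar` forbids both moduli from being small.
  have hanti : η * sqrtCube w₂ w₂ = - sqrtCube w₁ w₁ := by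
    refine eq_neg_of_eventually_norm (L := ‖w₂‖ ^ (3 / 2 : ℝ)) (by rw [norm_sqrtCube hw₁, hw])
      (by rw [norm_mul, hηn, one_mul, norm_sqrtCube hw₂]) ?_
    rw [← map_nhds_mul_sqrtCube hη0 hw₂, eventually_map]
    filter_upwards [hstar, hηe, hσψ, hσ.eventually hζe] with y h1 h2 h3 h4 h5
    refine h1 ⟨?_, ?_⟩
    · have := h5.1
      rw [norm_mul, hηn, one_mul, norm_sqrtCube hw₂] at this
      exact (Real.rpow_lt_rpow_iff (norm_nonneg _) (norm_nonneg _) (by norm_num)).1 this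
    · have e := h4.2
      rw [h3, h2] at e
      have e' : η * sqrtCube w₂ y - η * sqrtCube w₂ w₂ + sqrtCube w₁ w₁
          = sqrtCube w₁ (Φ.symm (ψ y)) := by linear_combination e
      have := h5.2
      rw [e', norm_sqrtCube hw₁] at this
      exact (Real.rpow_lt_rpow_iff (norm_nonneg _) (norm_nonneg _) (by norm_num)).1 this
  have hthr := threshold_le_of_antipodal hP hz hψ hψz hw₁ hw.symm hR₁ hψw hζ
    (hζe.mono fun y hy => hy.2) hηe hanti
  have hlt := hM.trans hthr
  have hRw : ‖w₁‖ ^ (3 / 2 : ℝ) < R ^ (3 / 2 : ℝ) :=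
    Real.rpow_lt_rpow (norm_nonneg _) hR₁ (by norm_num)
  rw [ENNReal.ofReal_le_ofReal_iff (by positivity)] at hlt
  linarith

end QuadraticDifferential

end

/-! ### Model domains and the two maximal developing maps. -/

noncomputable section

namespace QuadraticDifferential

theorem ofReal_norm_rpow_lt_iff {w : ℂ} {r : ℝ≥0∞} :
    ENNReal.ofReal (‖w‖ ^ (3 / 2 : ℝ)) < r ↔ w ∈ disc (r ^ (2 / 3 : ℝ)) := by
  change _ ↔ ‖w‖ₑ < r ^ (2 / 3 : ℝ)
  rw [← ENNReal.ofReal_rpow_of_nonneg (norm_nonneg w) (by norm_num), ofReal_norm,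
    show (2 / 3 : ℝ) = (3 / 2)⁻¹ by norm_num, ENNReal.lt_rpow_inv_iff (by norm_num)]

/-- The straight radius gives one inequality; the other is the local lower bound, applied to the
identity chart of the plane. -/
theorem modelZero_dist_zero (w : ℂ) : modelZero.dist 0 w = ENNReal.ofReal (‖w‖ ^ (3 / 2 : ℝ)) := by
  refine le_antisymm (dist_le_norm_rpow isRadial_modelZero isOpen_univ (isDev_id modelZero univ)
    fun u _ => mem_univ _) ?_
  by_contra hlt
  rw [not_le] at hlt
  exact hlt.not_ge (isModel_zero.mem_source_of_dist_lt (z := OpenPartialHomeomorph.refl ℂ)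
    (isDev_id modelZero univ) (mem_univ _) rfl (norm_nonneg w)
    (subset_univ _) hlt).2

theorem mem_modelDomain_iff {w : ℂ} {r : ℝ≥0∞} :
    w ∈ modelDomain r ↔ ENNReal.ofReal (‖w‖ ^ (3 / 2 : ℝ)) < r := by
  rw [← modelZero_dist_zero]
  rfl

theorem modelDomain_eq_disc (r : ℝ≥0∞) : modelDomain r = disc (r ^ (2 / 3 : ℝ)) := by
  ext w
  rw [mem_modelDomain_iff, ofReal_norm_rpow_lt_iff]

theorem isOpen_disc (r : ℝ≥0∞) : IsOpen (disc r) := isOpen_lt continuous_enorm continuous_const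

theorem isOpen_modelDomain (r : ℝ≥0∞) : IsOpen (modelDomain r) :=
  modelDomain_eq_disc r ▸ isOpen_disc _

theorem zero_mem_modelDomain {r : ℝ≥0∞} (hr : 0 < r) : (0 : ℂ) ∈ modelDomain r := by
  rw [mem_modelDomain_iff, norm_zero, Real.zero_rpow (by norm_num), ENNReal.ofReal_zero]
  exact hr

theorem modelDomain_mono {r s : ℝ≥0∞} (h : r ≤ s) : modelDomain r ⊆ modelDomain s :=
  fun _ hw => lt_of_lt_of_le hw h

theorem ball_subset_modelDomain {c : ℝ} (hc : 0 ≤ c) {r : ℝ≥0∞} (h : ENNReal.ofReal c ≤ r) :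
    Metric.ball 0 (c ^ (2 / 3 : ℝ)) ⊆ modelDomain r := by
  intro w hw
  rw [mem_modelDomain_iff]
  refine lt_of_lt_of_le ?_ h
  have h1 : ‖w‖ ^ (3 / 2 : ℝ) < c := by
    rw [← rpow_two_thirds_rpow hc]
    exact Real.rpow_lt_rpow (norm_nonneg _) (mem_ball_zero_iff.1 hw) (by norm_num)
  exact (ENNReal.ofReal_lt_ofReal_iff ((Real.rpow_nonneg (norm_nonneg _) _).trans_lt h1)).2 h1

theorem mem_ball_of_norm_rpow_lt {w : ℂ} {c : ℝ} (h : ‖w‖ ^ (3 / 2 : ℝ) < c) :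
    w ∈ Metric.ball (0 : ℂ) (c ^ (2 / 3 : ℝ)) := by
  have hc : 0 ≤ c := (Real.rpow_nonneg (norm_nonneg _) _).trans h.le
  rw [mem_ball_zero_iff]
  rw [← rpow_two_thirds_rpow hc] at h
  exact (Real.rpow_lt_rpow_iff (norm_nonneg _) (by positivity) (by norm_num)).1 h

theorem ofReal_mul_mem_disc {r : ℝ≥0∞} {w : ℂ} (hw : w ∈ disc r) {u : ℝ} (hu : u ∈ Icc (0 : ℝ) 1) :
    (u : ℂ) * w ∈ disc r := by
  refine lt_of_le_of_lt (b := ‖w‖ₑ) ?_ hw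
  rw [enorm_mul]
  refine mul_le_of_le_one_left' ?_
  rw [← ofReal_norm, Complex.norm_real, Real.norm_of_nonneg hu.1]
  exact ENNReal.ofReal_le_one.2 hu.2

section General

variable {X : Type*} [TopologicalSpace X] [ChartedSpace ℂ X]
  {φ : QuadraticDifferential X} {φ' : QuadraticDifferential ℂ}

theorem IsDev.dist_le {p : ℝ} (hp : IsRadial φ' p) {ψ : ℂ → X} {r : ℝ≥0∞}
    (hψ : IsDev φ φ' ψ (disc r)) {w : ℂ} (hw : w ∈ disc r) :
    φ.dist (ψ 0) (ψ w) ≤ ENNReal.ofReal (‖w‖ ^ p) :=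
  dist_le_norm_rpow hp (isOpen_disc r) hψ fun _ hu => ofReal_mul_mem_disc hw hu

variable [IsManifold 𝓘(ℂ) ω X]

theorem apply_zero_of_eventuallyEq_symm {P : X} {z : OpenPartialHomeomorph X ℂ}
    (hz : φ.IsCanonicalCoord φ' P z) {ψ : ℂ → X} (h : ψ =ᶠ[𝓝 0] z.symm) : ψ 0 = P := by
  have hc := isCanonicalCoord_iff.1 hz
  rw [h.self_of_nhds, ← hc.2.2.1, z.left_inv hc.2.1]

theorem isLocalDiffeomorphOn_of_isDev {P : X} {z : OpenPartialHomeomorph X ℂ}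
    (hz : φ.IsCanonicalCoord φ' P z) (hv : ∀ w, φ'.val w = 0 → w = 0) {ψ : ℂ → X} {U : Set ℂ}
    (hU : IsOpen U) (hψ : IsDev φ φ' ψ U) (hψz : ψ =ᶠ[𝓝 0] z.symm) :
    IsLocalDiffeomorphOn 𝓘(ℂ) 𝓘(ℂ) ω ψ U := by
  rintro ⟨w, hw⟩
  obtain ⟨Φ, h1, -, h3⟩ := isLocalDiffeomorphAt_of_complexDeriv_ne_zero hU hψ.contMDiffOn hw
    (complexDeriv_ne_zero_of_isDev hz hv hψ hψz hw)
  exact ⟨Φ, h1, h3⟩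

omit [IsManifold 𝓘(ℂ) ω X] in
/-- An injective local diffeomorphism has a holomorphic inverse. -/
theorem exists_openPartialHomeomorph_of_injOn {ψ : ℂ → X} {U : Set ℂ} (hU : IsOpen U)
    (hψ : ContMDiffOn 𝓘(ℂ) 𝓘(ℂ) ω ψ U) (hl : IsLocalDiffeomorphOn 𝓘(ℂ) 𝓘(ℂ) ω ψ U)
    (hinj : InjOn ψ U) : ∃ G : OpenPartialHomeomorph ℂ X, (G : ℂ → X) = ψ ∧ G.source = U ∧
      ContMDiffOn 𝓘(ℂ) 𝓘(ℂ) ω G.symm G.target := by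
  -- Openness, with continuity and injectivity, makes `ψ` a homeomorphism onto an open set;
  -- analyticity of the inverse is then local.
  have hopen : IsOpenMap (U.domRestrict ψ) := by
    refine IsOpenMap.of_nhds_le fun x => ?_
    obtain ⟨Φ, h1, h2⟩ := hl x
    have e1 : map (U.domRestrict ψ) (𝓝 x) = map ψ (𝓝 (x : ℂ)) := by
      rw [← hU.isOpenEmbedding_subtypeVal.map_nhds_eq x, map_map]
      rfl
    have e2 : map ψ (𝓝 (x : ℂ)) = map Φ (𝓝 (x : ℂ)) :=
      map_congr (h2.eventuallyEq_of_mem (Φ.open_source.mem_nhds h1))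
    rw [e1, e2]
    refine ((Φ.toOpenPartialHomeomorph.map_nhds_eq h1).trans ?_).ge
    exact congrArg 𝓝 (h2 h1).symm
  let G : OpenPartialHomeomorph ℂ X := OpenPartialHomeomorph.ofContinuousOpenRestrict
    (hinj.toPartialEquiv ψ U) hψ.continuousOn hopen hU
  have hG : ∀ x, G x = ψ x := fun x => rfl
  have hGs : G.source = U := rfl
  refine ⟨G, rfl, rfl, fun y hy => ?_⟩
  have hx : G.symm y ∈ U := G.map_target hy
  obtain ⟨Φ', h1', h2'⟩ := hl ⟨_, hx⟩
  let Φ : OpenPartialHomeomorph ℂ X := Φ'.toOpenPartialHomeomorph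
  have h1 : G.symm y ∈ Φ.source := h1'
  have h2 : EqOn ψ Φ Φ.source := h2'
  have hxy : Φ (G.symm y) = y := by rw [← h2 h1, ← hG, G.right_inv hy]
  have hyt : y ∈ Φ.target := hxy ▸ Φ.map_source h1
  have hΦy : Φ.symm y = G.symm y := by
    conv_lhs => rw [← hxy]
    exact Φ.left_inv h1
  have hcd : ContMDiffAt 𝓘(ℂ) 𝓘(ℂ) ω Φ.symm y :=
    Φ'.contMDiffOn_invFun.contMDiffAt (Φ.open_target.mem_nhds hyt)
  refine (hcd.congr_of_eventuallyEq ?_).contMDiffWithinAt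
  filter_upwards [Φ.open_target.mem_nhds hyt,
    hcd.continuousAt (hΦy ▸ hU.mem_nhds hx : U ∈ 𝓝 (Φ.symm y))] with v hv hvU
  have e : G (Φ.symm v) = v := by
    rw [hG, h2 (Φ.map_target hv)]
    exact Φ.right_inv hv
  conv_lhs => rw [← e]
  exact G.left_inv hvU

theorem exists_ball_subset_target {P : X} {z : OpenPartialHomeomorph X ℂ}
    (hz : φ.IsCanonicalCoord φ' P z) : ∃ δ > 0, Metric.ball 0 δ ⊆ z.target := by
  have hc := isCanonicalCoord_iff.1 hz
  exact Metric.isOpen_iff.1 z.open_target 0 (hc.2.2.1 ▸ z.map_source hc.2.1)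

variable [T2Space X] [CompactSpace X]

/-- A radius inside the model domain is shorter than the threshold, so it cannot end at a zero. -/
theorem exists_isDev_modelDomain_threshold (hφ : φ.HasSimpleZeros) {P : X} (hP : P ∈ φ.zeros)
    {z : OpenPartialHomeomorph X ℂ} (hz : φ.IsCanonicalCoord modelZero P z) :
    ∃ ψ : ℂ → X, IsDev φ modelZero ψ (modelDomain φ.threshold) ∧ ψ =ᶠ[𝓝 0] z.symm := by
  obtain ⟨δ, hδ, hb⟩ := exists_ball_subset_target hz
  rw [modelDomain_eq_disc]
  refine exists_isDev_disc (fun _ => eq_zero_of_val_modelZero) hδ (hz.isDev_symm.mono hb)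
    (ENNReal.rpow_pos_of_nonneg (threshold_pos hφ) (by norm_num)) ?_
  intro R hR hRT ψ hψ hψz w hw
  obtain ⟨Q, hlim, hd⟩ := exists_radial_limit hφ isRadial_modelZero hR hψ hw
  refine ⟨Q, fun hQ => ?_, hlim⟩
  have h1 := threshold_le_of_radial_limit hφ hP hz hR hψ hψz hw hQ hlim hd
  rw [← hw] at h1 hRT
  refine h1.not_gt (ofReal_norm_rpow_lt_iff.2 ?_)
  rwa [ofReal_norm] at hRT

/-- A radius ending at a zero would be at least as long as the distance from `P` to the zeros. -/
theorem exists_isDev_disc_distZeros (hφ : φ.HasSimpleZeros) {P : X} (hP : P ∉ φ.zeros)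
    {z : OpenPartialHomeomorph X ℂ} (hz : φ.IsCanonicalCoord modelFlat P z) :
    ∃ ψ : ℂ → X, IsDev φ modelFlat ψ (disc (φ.distZeros P)) ∧ ψ =ᶠ[𝓝 0] z.symm := by
  obtain ⟨δ, hδ, hb⟩ := exists_ball_subset_target hz
  refine exists_isDev_disc (fun w h => absurd h (by simp)) hδ (hz.isDev_symm.mono hb)
    (distZeros_pos hφ hP) ?_
  intro R hR hRT ψ hψ hψz w hw
  obtain ⟨Q, hlim, hd⟩ := exists_radial_limit hφ isRadial_modelFlat hR hψ hw
  refine ⟨Q, fun hQ => ?_, hlim⟩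
  have h1 := hd 0 le_rfl zero_lt_one
  rw [Complex.ofReal_zero, zero_mul, apply_zero_of_eventuallyEq_symm hz hψz] at h1
  simp only [Real.rpow_one, one_mul, zero_mul, sub_zero, hw] at h1
  exact ((iInf₂_le Q hQ).trans h1).not_gt hRT

omit [CompactSpace X] in
theorem injOn_modelDomain_half_threshold {P : X} (hP : P ∈ φ.zeros)
    {z : OpenPartialHomeomorph X ℂ} (hz : φ.IsCanonicalCoord modelZero P z) {ψ : ℂ → X}
    (hψ : IsDev φ modelZero ψ (modelDomain φ.threshold)) (hψz : ψ =ᶠ[𝓝 0] z.symm) :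
    InjOn ψ (modelDomain (φ.threshold / 2)) := by
  intro x hx y hy hxy
  rw [mem_modelDomain_iff] at hx hy
  -- A real `c` below half the threshold covers the case of an infinite threshold.
  obtain ⟨c, hc, h1, h2⟩ := ENNReal.lt_iff_exists_real_btwn.1 (max_lt hx hy)
  have hM : ENNReal.ofReal (2 * c) ≤ φ.threshold := by
    rw [ENNReal.ofReal_mul zero_le_two, ENNReal.ofReal_ofNat]
    calc 2 * ENNReal.ofReal c ≤ 2 * (φ.threshold / 2) := by gcongr
      _ = φ.threshold := ENNReal.mul_div_cancel two_ne_zero ENNReal.ofNat_ne_top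
  have hsub : Metric.ball 0 (c ^ (2 / 3 : ℝ)) ⊆ modelDomain φ.threshold :=
    ball_subset_modelDomain hc ((ENNReal.ofReal_le_ofReal (by linarith)).trans hM)
  have hmem : ∀ w : ℂ, ENNReal.ofReal (‖w‖ ^ (3 / 2 : ℝ)) < ENNReal.ofReal c →
      w ∈ Metric.ball (0 : ℂ) (c ^ (2 / 3 : ℝ)) := fun w hw => mem_ball_of_norm_rpow_lt
    ((ENNReal.ofReal_lt_ofReal_iff_of_nonneg (by positivity)).1 hw)
  exact injOn_ball hP hz (hψ.mono hsub) hψz (by rwa [rpow_two_thirds_rpow hc])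
    (hmem x ((le_max_left _ _).trans_lt h1)) (hmem y ((le_max_right _ _).trans_lt h1)) hxy

omit [CompactSpace X] in
/-- A canonical coordinate onto a model domain is centred at the origin of a metric ball. -/
theorem mem_source_of_dist_lt_of_target_eq {P : X} {Z : OpenPartialHomeomorph X ℂ}
    (hZ : φ.IsCanonicalCoord modelZero P Z) {r : ℝ≥0∞} (ht : Z.target = modelDomain r) {Q : X}
    (hQ : φ.dist P Q < r) : Q ∈ Z.source ∧ modelZero.dist 0 (Z Q) ≤ φ.dist P Q := by
  have hc := isCanonicalCoord_iff.1 hZ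
  obtain ⟨c, hc0, h1, h2⟩ := ENNReal.lt_iff_exists_real_btwn.1 hQ
  -- The second number leaves room for a closed disc inside the open target.
  obtain ⟨c', hc0', h1', h2'⟩ := ENNReal.lt_iff_exists_real_btwn.1 h2
  have hcc : c < c' := (ENNReal.ofReal_lt_ofReal_iff_of_nonneg hc0).1 h1'
  rw [modelZero_dist_zero]
  refine isModel_zero.mem_source_of_dist_lt hc.2.2.2 hc.2.1 hc.2.2.1
    (ρ := c ^ (2 / 3 : ℝ)) (Real.rpow_nonneg hc0 _) ?_ (by rwa [rpow_two_thirds_rpow hc0])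
  rw [ht]
  exact (Metric.closedBall_subset_ball (Real.rpow_lt_rpow hc0 hcc (by norm_num))).trans
    (ball_subset_modelDomain hc0' h2'.le)

end General

end QuadraticDifferential

end

/-! ### Metric balls as images of model domains, and the theorem. -/

noncomputable section

namespace QuadraticDifferential

variable {X : Type*} [TopologicalSpace X] [ChartedSpace ℂ X]
  {φ : QuadraticDifferential X} [IsManifold 𝓘(ℂ) ω X]

theorem image_modelDomain_subset_ball {P : X} {z : OpenPartialHomeomorph X ℂ}
    (hz : φ.IsCanonicalCoord modelZero P z) {ψ : ℂ → X} {r κ : ℝ≥0∞}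
    (hψ : IsDev φ modelZero ψ (modelDomain r)) (hψz : ψ =ᶠ[𝓝 0] z.symm) (hκ : κ ≤ r) :
    ψ '' modelDomain κ ⊆ φ.ball P κ := by
  rintro _ ⟨w, hw, rfl⟩
  have hwr := modelDomain_mono hκ hw
  rw [modelDomain_eq_disc] at hψ hwr
  have h := hψ.dist_le isRadial_modelZero hwr
  rw [apply_zero_of_eventuallyEq_symm hz hψz] at h
  exact h.trans_lt (mem_modelDomain_iff.1 hw)

theorem image_disc_subset_ball {P : X} {z : OpenPartialHomeomorph X ℂ}
    (hz : φ.IsCanonicalCoord modelFlat P z) {ψ : ℂ → X} {r κ : ℝ≥0∞}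
    (hψ : IsDev φ modelFlat ψ (disc r)) (hψz : ψ =ᶠ[𝓝 0] z.symm) (hκ : κ ≤ r) :
    ψ '' disc κ ⊆ φ.ball P κ := by
  rintro _ ⟨w, hw, rfl⟩
  have h := hψ.dist_le isRadial_modelFlat (lt_of_lt_of_le hw hκ : w ∈ disc r)
  rw [apply_zero_of_eventuallyEq_symm hz hψz, Real.rpow_one, ofReal_norm] at h
  exact lt_of_le_of_lt h hw

variable [T2Space X]

/-- The inverse of the developing map of a zero. -/
theorem exists_canonicalCoord_ball {P : X} (hP : P ∈ φ.zeros) {z : OpenPartialHomeomorph X ℂ}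
    (hz : φ.IsCanonicalCoord modelZero P z) (hM : 0 < φ.threshold) {ψ : ℂ → X}
    (hψ : IsDev φ modelZero ψ (modelDomain φ.threshold)) (hψz : ψ =ᶠ[𝓝 0] z.symm) :
    ∃ Z : OpenPartialHomeomorph X ℂ, φ.IsCanonicalCoord modelZero P Z ∧ Z =ᶠ[𝓝 P] z ∧
      Z.source = φ.ball P (φ.threshold / 2) ∧ (∀ κ, 0 < κ → κ ≤ φ.threshold / 2 →
        IsOpen (φ.ball P κ) ∧ Z '' φ.ball P κ = modelDomain κ) ∧ (Z.symm : ℂ → X) = ψ := by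
  have hψ' : IsDev φ modelZero ψ (modelDomain (φ.threshold / 2)) :=
    hψ.mono (modelDomain_mono ENNReal.half_le_self)
  obtain ⟨G, hG, hGs, hGd⟩ := exists_openPartialHomeomorph_of_injOn
    (isOpen_modelDomain (φ.threshold / 2)) hψ'.contMDiffOn
    (isLocalDiffeomorphOn_of_isDev hz (fun _ => eq_zero_of_val_modelZero)
      (isOpen_modelDomain _) hψ' hψz) (injOn_modelDomain_half_threshold hP hz hψ hψz)
  have h0 : (0 : ℂ) ∈ G.source := by
    rw [hGs]
    exact zero_mem_modelDomain (ENNReal.half_pos hM.ne')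
  have hψ0 := apply_zero_of_eventuallyEq_symm hz hψz
  have hP0 : G.symm P = 0 := by rw [← hψ0, ← hG, G.left_inv h0]
  have hPt : P ∈ G.target := by
    rw [← hψ0, ← hG]
    exact G.map_source h0
  have hGdev : IsDev φ modelZero G G.source := by rw [hG, hGs]; exact hψ'
  have hZ : φ.IsCanonicalCoord modelZero P G.symm := by
    refine isCanonicalCoord_iff.2 ⟨?_, hPt, hP0, hGdev.symm hGd⟩
    exact hGdev.contMDiffOn
  have hsub : ∀ κ ≤ φ.threshold / 2, ψ '' modelDomain κ ⊆ φ.ball P κ := fun κ hκ =>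
    image_modelDomain_subset_ball hz hψ' hψz hκ
  -- A path from `P` of length less than `κ` cannot leave the domain of the inverse of `ψ`, and this
  -- inverse does not increase the distance from the centre.
  have hball : ∀ κ ≤ φ.threshold / 2, φ.ball P κ = ψ '' modelDomain κ := by
    refine fun κ hκ => Subset.antisymm (fun Q hQ => ?_) (hsub κ hκ)
    obtain ⟨h1, h2⟩ := mem_source_of_dist_lt_of_target_eq hZ hGs
      (lt_of_lt_of_le hQ hκ : φ.dist P Q < _)
    refine ⟨G.symm Q, lt_of_le_of_lt h2 hQ, ?_⟩
    rw [← hG]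
    exact G.right_inv h1
  refine ⟨G.symm, hZ, ?_, ?_, fun κ _ hκ => ⟨?_, ?_⟩, hG⟩
  · have hc := isCanonicalCoord_iff.1 hz
    have hzc : Tendsto z (𝓝 P) (𝓝 0) := by
      simpa [hc.2.2.1] using (z.continuousAt hc.2.1).tendsto
    filter_upwards [z.open_source.mem_nhds hc.2.1, hzc.eventually hψz,
      hzc.eventually (G.open_source.mem_nhds h0)] with Q h1 h2 h3
    have e : G (z Q) = Q := by rw [hG, h2, z.left_inv h1]
    conv_lhs => rw [← e]
    exact G.left_inv h3
  · rw [hball _ le_rfl, ← hG, ← hGs]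
    exact G.image_source_eq_target.symm
  · rw [hball κ hκ, ← hG]
    exact G.isOpen_image_of_subset_source (isOpen_modelDomain κ)
      (hGs ▸ modelDomain_mono hκ)
  · rw [hball κ hκ, ← hG, image_image]
    refine (image_congr fun w hw => ?_).trans (image_id _)
    exact G.left_inv (hGs ▸ modelDomain_mono hκ hw)

end QuadraticDifferential

end

theorem proposition23p9p30p10
    {X : Type*} [TopologicalSpace X] [T2Space X] [CompactSpace X] [ConnectedSpace X]
    [ChartedSpace ℂ X] [IsManifold 𝓘(ℂ) ω X]
    (φ : QuadraticDifferential X) (hφ : φ.form ≠ 0) (hsimple : φ.HasSimpleZeros) :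
    (∀ r : ℝ≥0∞, QuadraticDifferential.modelDomain r = QuadraticDifferential.disc (r ^ (2 / 3 : ℝ)))
    ∧
    (∀ P ∈ φ.zeros,
      0 < φ.threshold ∧
      (∃ z, φ.IsCanonicalCoord QuadraticDifferential.modelZero P z) ∧
      ∀ z, φ.IsCanonicalCoord QuadraticDifferential.modelZero P z →
        ∃ Z : OpenPartialHomeomorph X ℂ,
          φ.IsCanonicalCoord QuadraticDifferential.modelZero P Z ∧
          Z =ᶠ[𝓝 P] z ∧
          Z.source = φ.ball P (φ.threshold / 2) ∧
          (∀ κ : ℝ≥0∞, 0 < κ → κ ≤ φ.threshold / 2 →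
            IsOpen (φ.ball P κ) ∧ Z '' φ.ball P κ = QuadraticDifferential.modelDomain κ) ∧
          ∃ ψ : ℂ → X,
            EqOn ψ Z.symm (QuadraticDifferential.modelDomain (φ.threshold / 2)) ∧
            IsLocalDiffeomorphOn 𝓘(ℂ) 𝓘(ℂ) ω ψ
              (QuadraticDifferential.modelDomain φ.threshold) ∧
            (∀ w ∈ QuadraticDifferential.modelDomain φ.threshold,
              φ.pullback ψ w = QuadraticDifferential.modelZero.form w) ∧
            QuadraticDifferential.modelDomain φ.threshold ∩ ψ ⁻¹' φ.zeros = {0} ∧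
            ∀ κ : ℝ≥0∞, 0 < κ → κ ≤ φ.threshold →
              ψ '' QuadraticDifferential.modelDomain κ ⊆ φ.ball P κ)
    ∧
    (∀ P ∉ φ.zeros,
      0 < φ.distZeros P ∧
      (∃ z, φ.IsCanonicalCoord QuadraticDifferential.modelFlat P z) ∧
      ∀ z, φ.IsCanonicalCoord QuadraticDifferential.modelFlat P z →
        ∃ ψ : ℂ → X,
          ψ =ᶠ[𝓝 0] z.symm ∧
          IsLocalDiffeomorphOn 𝓘(ℂ) 𝓘(ℂ) ω ψ (QuadraticDifferential.disc (φ.distZeros P)) ∧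
          (∀ w ∈ QuadraticDifferential.disc (φ.distZeros P),
            φ.pullback ψ w = QuadraticDifferential.modelFlat.form w) ∧
          QuadraticDifferential.disc (φ.distZeros P) ∩ ψ ⁻¹' φ.zeros = ∅ ∧
          ∀ κ : ℝ≥0∞, 0 < κ → κ ≤ φ.distZeros P →
            ψ '' QuadraticDifferential.disc κ ⊆ φ.ball P κ) := by
  open QuadraticDifferential in
  refine ⟨modelDomain_eq_disc, fun P hP => ?_, fun P hP => ?_⟩
  · have hM := threshold_pos hsimple
    refine ⟨hM, exists_isCanonicalCoord_modelZero (hsimple P hP), fun z hz => ?_⟩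
    -- The map is continued up to the full threshold before `Z` is defined as the inverse of its
    -- restriction, so one `ψ` serves both (1a) and (1b).
    obtain ⟨ψ, hψ, hψz⟩ := exists_isDev_modelDomain_threshold hsimple hP hz
    obtain ⟨Z, h1, h2, h3, h4, h5⟩ := exists_canonicalCoord_ball hP hz hM hψ hψz
    refine ⟨Z, h1, h2, h3, h4, ψ, fun w _ => by rw [h5],
      isLocalDiffeomorphOn_of_isDev hz (fun _ => eq_zero_of_val_modelZero)
        (isOpen_modelDomain _) hψ hψz,
      fun w hw => (pullback_eq_form_iff _ _ _ _).2 (hψ.val_eq w hw), ?_,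
      fun κ _ hκ => image_modelDomain_subset_ball hz hψ hψz hκ⟩
    refine Subset.antisymm (fun w hw => ?_) ?_
    · by_contra hw0
      exact notMem_zeros_of_isDev hψ hw.1 hw0 hw.2
    · rintro w rfl
      refine ⟨zero_mem_modelDomain hM, ?_⟩
      rw [mem_preimage, apply_zero_of_eventuallyEq_symm hz hψz]
      exact hP
  · refine ⟨distZeros_pos hsimple hP, exists_isCanonicalCoord_modelFlat hP, fun z hz => ?_⟩
    obtain ⟨ψ, hψ, hψz⟩ := exists_isDev_disc_distZeros hsimple hP hz
    refine ⟨ψ, hψz, isLocalDiffeomorphOn_of_isDev hz (fun w h => absurd h (by simp))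
        (isOpen_disc _) hψ hψz,
      fun w hw => (pullback_eq_form_iff _ _ _ _).2 (hψ.val_eq w hw), ?_,
      fun κ _ hκ => image_disc_subset_ball hz hψ hψz hκ⟩
    refine eq_empty_of_forall_notMem fun w hw => ?_
    exact (complexDeriv_ne_zero_of_val_ne_zero hψ hw.1 (by simp)).2
      ((mem_zeros_iff φ _).1 hw.2)
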